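/- Let $k$ be a positive integer and let $f$ be a cusp form of weight $k$ for $SL_2(\mathbb{Z})$ which is a normalized Hecke eigenform: $f$ is an eigenfunction of all Hecke operators $T_n$ ($n\ge 1$), and its Fourier expansion $f(z)=\sum_{n\ge1}a_f(n)e^{2\pi i n z}$ has $a_f(1)=1$. Put $\lambda_f(n)=a_f(n)n^{-(k-1)/2}$ and let $L_f(s)=\sum_{n\ge1}\lambda_f(n)n^{-s}$ $(\mathrm{Re}\,s>1)$ be its $L$-function, continued to an entire function by $$(2\pi)^{-s-\frac{k-1}{2}}\,\Gamma\!\left(s+\tfrac{k-1}{2}\right)L_f(s)=\int_0^\infty f(iy)\,y^{s+\frac{k-1}{2}-1}\,dy .$$ For an integer $m\ge0$ let $L_f^{(m)}$ be the $m$-th derivative of $L_f$. Then for every integer $m\ge0$: (i) There is a real number $\sigma_{f,m}>1$ such that $L_f^{(m)}(s)$ has no zero with $\mathrm{Re}\,s\ge\sigma_{f,m}$. (ii) For every real $\varepsilon>0$ there is a real number $\delta_{f,m,\varepsilon}>\frac{k-1}{2}+1$ such that $L_f^{(m)}(s)$ has no zero with $|s|\ge\delta_{f,m,\varepsilon}$,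 $\mathrm{Re}\,s\le-\varepsilon$ and $|\mathrm{Im}\,s|\ge\varepsilon$. (iii) There is a real number $\alpha_{f,m}<-\frac{k-1}{2}-1$ such that every zero of $L_f^{(m)}(s)$ with $\mathrm{Re}\,s\le\alpha_{f,m}$ is real, and for every integer $n\le\alpha_{f,m}$ there is exactly one zero of $L_f^{(m)}$ in the open interval $(n-1,n)$. -/

import Mathlib

open scoped MatrixGroups UpperHalfPlane

noncomputable section

namespace EigenformL

/-- The `n`-th Hecke operator of weight `k` for `SL₂(ℤ)`:
`(T_n f)(τ) = n ^ (k - 1) * ∑_{a d = n} ∑_{0 ≤ b < d} d ^ (-k) * f ((a τ + b) / d)`.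
For `n ≥ 1` the point `(a τ + b) / d` lies in the upper half plane, so `ofComplex` just
re-bundles it. -/
def heckeOp (k : ℤ) (n : ℕ) (f : ℍ → ℂ) (τ : ℍ) : ℂ :=
  (n : ℂ) ^ (k - 1) * ∑ d ∈ n.divisors, ∑ b ∈ Finset.range d,
    (d : ℂ) ^ (-k) *
      f (UpperHalfPlane.ofComplex ((((n / d : ℕ) : ℂ) * (τ : ℂ) + (b : ℂ)) / (d : ℂ)))

/-- A cusp form of weight `k` for `SL₂(ℤ)` is a normalized Hecke eigenform if its first Fourier
coefficient is `1` and it is an eigenfunction of all Hecke operators `T_n`, `n ≥ 1`. -/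
structure IsNormalizedHeckeEigenform {k : ℤ} (f : CuspForm 𝒮ℒ k) : Prop where
  coeff_one : (UpperHalfPlane.qExpansion 1 f).coeff 1 = 1
  eigen : ∀ n : ℕ, 0 < n → ∃ c : ℂ, ∀ τ : ℍ, heckeOp k n f τ = c * f τ

/-- The normalized Fourier coefficients `λ_f(n) = a_f(n) / n ^ ((k - 1) / 2)`. -/
def normCoeff {k : ℤ} (f : CuspForm 𝒮ℒ k) (n : ℕ) : ℂ :=
  (UpperHalfPlane.qExpansion 1 f).coeff n / (n : ℂ) ^ (((k : ℂ) - 1) / 2)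

/-- The `L`-function `L_f(s)`, normalized so that its functional equation relates `s` and `1 - s`:
`(2π) ^ (-w) * Γ(w) * L_f(s) = ∫_0^∞ f(iy) y ^ (w - 1) dy` with `w = s + (k - 1) / 2`,
that is, Mathlib's `L`-function of `f`, shifted by `(k - 1) / 2`. -/
def L {k : ℤ} (hk : 0 < k) (f : CuspForm 𝒮ℒ k) (s : ℂ) : ℂ :=
  ModularForm.L hk f (s + ((k : ℂ) - 1) / 2)

/-- `L_f` is entire. -/
theorem differentiable_L {k : ℤ} (hk : 0 < k) (f : CuspForm 𝒮ℒ k) :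
    Differentiable ℂ (L hk f) := by
  have h := CuspForm.differentiable_L hk f
  unfold L
  fun_prop

/-- `L_f` satisfies the defining Mellin transform formula, at every `s` at which the Gamma factor
is regular. -/
theorem mellin_L {k : ℤ} (hk : 0 < k) (f : CuspForm 𝒮ℒ k) (s : ℂ)
    (hs : ∀ j : ℕ, s + ((k : ℂ) - 1) / 2 ≠ -j) :
    (2 * (Real.pi : ℂ)) ^ (-(s + ((k : ℂ) - 1) / 2)) * Complex.Gamma (s + ((k : ℂ) - 1) / 2) *
        L hk f s =
      ∫ y in Set.Ioi (0 : ℝ), f (UpperHalfPlane.ofComplex (Complex.I * y)) *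
        (y : ℂ) ^ (s + ((k : ℂ) - 1) / 2 - 1) := by
  have hG := Complex.Gamma_ne_zero hs
  have hp : (2 * (Real.pi : ℂ)) ^ (-(s + ((k : ℂ) - 1) / 2)) ≠ 0 := by
    rw [Ne, Complex.cpow_eq_zero_iff]
    simp [Real.pi_ne_zero]
  have h2 : L hk f s * ((2 * (Real.pi : ℂ)) ^ (-(s + ((k : ℂ) - 1) / 2)) *
      Complex.Gamma (s + ((k : ℂ) - 1) / 2)) =
      mellin (fun t ↦ f (UpperHalfPlane.ofComplex (Complex.I * t))) (s + ((k : ℂ) - 1) / 2) := by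
    rw [L, ModularForm.L, CuspForm.Λ_eq_mellin, Complex.Gammaℂ]
    generalize s + ((k : ℂ) - 1) / 2 = w at hG hp ⊢
    field_simp
  rw [mul_comm, h2, mellin]
  simp only [smul_eq_mul]
  exact MeasureTheory.setIntegral_congr_fun measurableSet_Ioi (fun y _ ↦ mul_comm _ _)

/-- `L_f` is the analytic continuation of the Dirichlet series `∑ λ_f(n) n ^ (-s)`. -/
theorem hasSum_L {k : ℤ} (hk : 0 < k) (f : CuspForm 𝒮ℒ k) {s : ℂ} (hs : 3 / 2 < s.re) :
    LSeriesHasSum (normCoeff f) s (L hk f s) := by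
  have hre : (k : ℝ) / 2 + 1 < (s + ((k : ℂ) - 1) / 2).re := by
    have : (((k : ℂ) - 1) / 2).re = ((k : ℝ) - 1) / 2 := by
      have : ((k : ℂ) - 1) / 2 = ((((k : ℝ) - 1) / 2 : ℝ) : ℂ) := by push_cast; ring
      rw [this, Complex.ofReal_re]
    rw [Complex.add_re, this]
    linarith
  have h := CuspForm.hasSum_L hk f hre
  simp only [Subgroup.strictWidthInfty_SL2Z, Complex.ofReal_one, Complex.one_cpow,
    one_mul] at h
  unfold LSeriesHasSum L
  convert h using 1
  ext n
  rcases Nat.eq_zero_or_pos n with rfl | hn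
  · have h0 : s + ((k : ℂ) - 1) / 2 ≠ 0 := by
      intro h0
      rw [h0, Complex.zero_re] at hre
      have : (0 : ℝ) < k := mod_cast hk
      linarith
    simp [Complex.zero_cpow h0]
  · have hn' : (n : ℂ) ≠ 0 := by exact_mod_cast hn.ne'
    rw [LSeries.term_of_ne_zero hn.ne', normCoeff, Complex.cpow_add _ _ hn', div_div, mul_comm]

end EigenformL

end

/-! ### The digamma function: series, growth of the real part, bounded variation. -/

noncomputable section
namespace EigenformL

open Filter Topology

/-! Put κ = (k - 1) / 2. For `re s > 1`, off the slit (1, κ], the functional equation reads L(1 - s)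
= 2 cos(πs) G(s), where G(s) = (2π)^(-2s) Γ(s + κ) Γ(s - κ) L(s) has no zeros (`L_one_sub`). Its
logarithmic derivative Q is a constant plus two digamma values plus L'/L. Far out, away from the
slit, the real part of Q tends to infinity, while Q changes by O(1) on small discs. By Cauchy's
estimate, differentiation therefore costs one power of Q less than multiplication by Q, and the m-th
derivative of L at 1 - s is (-1)^m 2G(s) (A cos πs + B sin πs) with A = Q^m + lower order and B of
lower order (`exists_iteratedDeriv_eq`, `exists_iteratedDeriv_L_eq`).

Its zeros are those of cos πs + r sin πs, where r = B/A is small. Away from the real axis tan πs is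
bounded, so there are none: this is (ii). In a strip between consecutive integers, r has small
Lipschitz constant and there is at most one zero. Conjugation symmetry makes it real, and the
opposite signs of the m-th derivative at consecutive integers make it exist: this is (iii). For (i),
the first nonzero coefficient of the differentiated Dirichlet series dominates far to the right.

Three facts about L are needed. Absolute convergence for `re s > 1` follows from a mean-square bound
on the coefficients (Parseval and the bound |f| ≪ y^(-k/2)). A positive lower bound for |L| on `re s
≥ 1 + ε` comes from removing finitely many Euler factors (`exists_lower_bound_LSeries`). Reality of
the coefficients comes from self-adjointness of the Hecke operators for the Petersson product
(`conj_eigenvalue`). -/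

/-- The half plane `re z > -1 / 2` cut off at distance `r` from the origin. -/
def cutHalfPlane (r : ℝ) : Set ℂ := {z | -(1 / 2) < z.re} ∩ Metric.ball 0 r

theorem isOpen_cutHalfPlane (r : ℝ) : IsOpen (cutHalfPlane r) :=
  (isOpen_lt continuous_const Complex.continuous_re).inter Metric.isOpen_ball

theorem isPreconnected_cutHalfPlane (r : ℝ) : IsPreconnected (cutHalfPlane r) :=
  ((convex_halfSpace_re_gt _).inter (convex_ball _ _)).isPreconnected

/-- The general term of the Weierstrass series of `log Γ (z + 1)`. -/
def logGammaTerm (n : ℕ) (z : ℂ) : ℂ := z / (n + 1) - Complex.log (1 + z / (n + 1))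

theorem natCast_succ_le_norm_add {z : ℂ} (hz : 0 ≤ z.re) (n : ℕ) :
    (n : ℝ) + 1 ≤ ‖(n : ℂ) + 1 + z‖ := by
  refine le_trans ?_ (Complex.re_le_norm _)
  simp only [Complex.add_re, Complex.natCast_re, Complex.one_re]
  linarith

/-- The abscissa -1/2 gives an open neighbourhood of the closed half plane `0 ≤ re z`. It contains
0, where every term of the series vanishes, and still keeps the denominators of size comparable to n
+ 1. -/
theorem half_le_norm_add {z : ℂ} (hz : -(1 / 2) < z.re) (n : ℕ) :
    ((n : ℝ) + 1) / 2 ≤ ‖(n : ℂ) + 1 + z‖ := by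
  refine le_trans ?_ (Complex.re_le_norm _)
  have : (0 : ℝ) ≤ n := n.cast_nonneg
  simp only [Complex.add_re, Complex.natCast_re, Complex.one_re]
  linarith

theorem one_add_div_mem_slitPlane {z : ℂ} (hz : -(1 / 2) < z.re) (n : ℕ) :
    1 + z / ((n : ℂ) + 1) ∈ Complex.slitPlane := by
  left
  have h : z / ((n : ℂ) + 1) = z / ((n + 1 : ℝ) : ℂ) := by push_cast; rfl
  rw [h, Complex.add_re, Complex.div_ofReal_re, Complex.one_re]
  have hn : (0 : ℝ) ≤ n := n.cast_nonneg
  have : -(1 / 2) ≤ z.re / (n + 1) := by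
    rw [le_div_iff₀ (by positivity)]
    nlinarith
  linarith

theorem hasDerivAt_logGammaTerm {z : ℂ} (hz : -(1 / 2) < z.re) (n : ℕ) :
    HasDerivAt (logGammaTerm n) (1 / ((n : ℂ) + 1) - 1 / ((n : ℂ) + 1 + z)) z := by
  have hn : (n : ℂ) + 1 ≠ 0 := Nat.cast_add_one_ne_zero n
  have hm : (n : ℂ) + 1 + z ≠ 0 := by
    rw [← norm_pos_iff]
    exact lt_of_lt_of_le (by positivity) (half_le_norm_add hz n)
  have h1 : HasDerivAt (fun z : ℂ ↦ 1 + z / ((n : ℂ) + 1)) (1 / ((n : ℂ) + 1)) z :=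
    ((hasDerivAt_id z).div_const _).const_add 1
  have h2 := ((hasDerivAt_id z).div_const ((n : ℂ) + 1)).sub
    (h1.clog (one_add_div_mem_slitPlane hz n))
  refine HasDerivAt.congr_deriv (f := logGammaTerm n) h2 ?_
  have : 1 + z / ((n : ℂ) + 1) = ((n : ℂ) + 1 + z) / (n + 1) := by field_simp
  rw [this]
  field_simp

theorem norm_inv_sub_inv_le {z : ℂ} {r : ℝ} (hz : z ∈ cutHalfPlane r) (n : ℕ) :
    ‖1 / ((n : ℂ) + 1) - 1 / ((n : ℂ) + 1 + z)‖ ≤ 2 * r * (1 / ((n : ℝ) + 1) ^ 2) := by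
  have hn : (n : ℂ) + 1 ≠ 0 := Nat.cast_add_one_ne_zero n
  have h2 := half_le_norm_add hz.1 n
  have hm : (n : ℂ) + 1 + z ≠ 0 := by
    rw [← norm_pos_iff]
    exact lt_of_lt_of_le (by positivity) h2
  have h3 : ‖(n : ℂ) + 1‖ = n + 1 := by
    have : ((n : ℂ) + 1) = ((n + 1 : ℝ) : ℂ) := by push_cast; rfl
    rw [this, Complex.norm_real, Real.norm_of_nonneg (by positivity)]
  have hr : ‖z‖ < r := by simpa using hz.2
  rw [div_sub_div _ _ hn hm, norm_div, norm_mul, h3]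
  simp only [one_mul, mul_one, add_sub_cancel_left]
  rw [div_le_iff₀ (by positivity)]
  have : 2 * r * (1 / ((n : ℝ) + 1) ^ 2) * ((n + 1) * (((n : ℝ) + 1) / 2)) = r := by
    field_simp
  have hr0 : 0 ≤ r := (norm_nonneg z).trans hr.le
  calc ‖z‖ ≤ r := hr.le
    _ = 2 * r * (1 / ((n : ℝ) + 1) ^ 2) * ((n + 1) * (((n : ℝ) + 1) / 2)) := this.symm
    _ ≤ _ := by gcongr

theorem summable_inv_succ_sq : Summable fun n : ℕ ↦ 1 / ((n : ℝ) + 1) ^ 2 := by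
  have := (summable_nat_add_iff 1).mpr (Real.summable_one_div_nat_pow.mpr one_lt_two)
  simpa using this

/-- The bridge from the Weierstrass series to Euler's limit for Γ. The last factor tends to exp(γz),
which is how Euler's constant enters. -/
theorem prod_exp_logGammaTerm {z : ℂ} (hz : -(1 / 2) < z.re) (hz0 : z ≠ 0) {N : ℕ} (hN : N ≠ 0) :
    Complex.exp (∑ n ∈ Finset.range N, logGammaTerm n z) =
      z * Complex.GammaSeq z N * Complex.exp (z * ((harmonic N : ℝ) - Real.log N : ℝ)) := by
  have hterm (n : ℕ) : Complex.exp (logGammaTerm n z) =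
      Complex.exp (z / (n + 1)) * (((n : ℂ) + 1) / (z + (n + 1))) := by
    have hn : (n : ℂ) + 1 ≠ 0 := Nat.cast_add_one_ne_zero n
    rw [logGammaTerm, Complex.exp_sub,
      Complex.exp_log (Complex.slitPlane_ne_zero (one_add_div_mem_slitPlane hz n))]
    have : 1 + z / ((n : ℂ) + 1) = (z + (n + 1)) / (n + 1) := by field_simp; ring
    rw [this, div_div_eq_mul_div, mul_div_assoc]
  rw [Complex.exp_sum, Finset.prod_congr rfl fun n _ ↦ hterm n, Finset.prod_mul_distrib,
    ← Complex.exp_sum, Finset.prod_div_distrib, Complex.GammaSeq, Finset.prod_range_succ']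
  have hfac : ∏ n ∈ Finset.range N, ((n : ℂ) + 1) = (N.factorial : ℂ) := by
    rw [← Finset.prod_range_add_one_eq_factorial]
    push_cast
    rfl
  have hH : ∑ n ∈ Finset.range N, z / ((n : ℂ) + 1) = z * ((harmonic N : ℝ) : ℂ) := by
    simp [harmonic, Finset.mul_sum, div_eq_mul_inv]
  have hN' : (N : ℂ) ≠ 0 := Nat.cast_ne_zero.mpr hN
  have hpow : (N : ℂ) ^ z = Complex.exp (z * (Real.log N : ℝ)) := by
    rw [Complex.cpow_def_of_ne_zero hN', mul_comm, Complex.ofReal_log N.cast_nonneg]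
    simp
  rw [hfac, hH, hpow, Complex.ofReal_sub, mul_sub, Complex.exp_sub]
  simp only [Nat.cast_zero, add_zero, Nat.cast_add, Nat.cast_one]
  have hP : ∏ n ∈ Finset.range N, (z + ((n : ℂ) + 1)) ≠ 0 := by
    refine Finset.prod_ne_zero_iff.mpr fun n _ ↦ ?_
    rw [add_comm, ← norm_pos_iff]
    exact lt_of_lt_of_le (by positivity) (half_le_norm_add hz n)
  have := Complex.exp_ne_zero (z * (Real.log N : ℝ))
  field_simp

theorem hasSum_logGammaTerm {z : ℂ} (hz : -(1 / 2) < z.re) :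
    Summable fun n ↦ logGammaTerm n z := by
  obtain ⟨r, hr⟩ := exists_gt ‖z‖
  refine summable_of_summable_hasDerivAt_of_isPreconnected
    (summable_inv_succ_sq.mul_left (2 * r)) (isOpen_cutHalfPlane r) (isPreconnected_cutHalfPlane r)
    (fun n y hy ↦ hasDerivAt_logGammaTerm hy.1 n) (fun n y hy ↦ norm_inv_sub_inv_le hy n)
    (y₀ := 0) ⟨by simp, by simpa using (norm_nonneg z).trans_lt hr⟩ ?_ ⟨hz, by simpa using hr⟩
  simp [logGammaTerm]

theorem hasDerivAt_tsum_logGammaTerm {z : ℂ} (hz : -(1 / 2) < z.re) :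
    HasDerivAt (fun z ↦ ∑' n, logGammaTerm n z)
      (∑' n : ℕ, (1 / ((n : ℂ) + 1) - 1 / ((n : ℂ) + 1 + z))) z := by
  obtain ⟨r, hr⟩ := exists_gt ‖z‖
  refine hasDerivAt_tsum_of_isPreconnected
    (summable_inv_succ_sq.mul_left (2 * r)) (isOpen_cutHalfPlane r) (isPreconnected_cutHalfPlane r)
    (fun n y hy ↦ hasDerivAt_logGammaTerm hy.1 n) (fun n y hy ↦ norm_inv_sub_inv_le hy n)
    (y₀ := 0) ⟨by simp, by simpa using (norm_nonneg z).trans_lt hr⟩ ?_ ⟨hz, by simpa using hr⟩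
  simp [logGammaTerm]

theorem Gamma_add_one_eq_exp {z : ℂ} (hz : -(1 / 2) < z.re) :
    Complex.Gamma (z + 1) =
      Complex.exp (∑' n, logGammaTerm n z) * Complex.exp (-(z * Real.eulerMascheroniConstant)) := by
  rcases eq_or_ne z 0 with rfl | hz0
  · simp [logGammaTerm]
  have h1 : Tendsto (fun N ↦ Complex.exp (∑ n ∈ Finset.range N, logGammaTerm n z)) atTop
      (𝓝 (Complex.exp (∑' n, logGammaTerm n z))) :=
    (Complex.continuous_exp.tendsto _).comp (hasSum_logGammaTerm hz).hasSum.tendsto_sum_nat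
  have h2 : Tendsto (fun N : ℕ ↦ z * Complex.GammaSeq z N *
      Complex.exp (z * ((harmonic N : ℝ) - Real.log N : ℝ))) atTop
      (𝓝 (z * Complex.Gamma z * Complex.exp (z * Real.eulerMascheroniConstant))) := by
    refine ((Complex.GammaSeq_tendsto_Gamma z).const_mul z).mul
      ((Complex.continuous_exp.tendsto _).comp (Tendsto.const_mul z ?_))
    exact (Complex.continuous_ofReal.tendsto _).comp Real.tendsto_harmonic_sub_log
  have h3 := tendsto_nhds_unique (h1.congr' (by
    filter_upwards [eventually_ne_atTop 0] with N hN
    exact prod_exp_logGammaTerm hz hz0 hN)) h2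
  rw [h3, Complex.Gamma_add_one z hz0, mul_assoc, ← Complex.exp_add, add_neg_cancel,
    Complex.exp_zero, mul_one]

theorem digamma_add_one_eq_tsum {z : ℂ} (hz : -(1 / 2) < z.re) :
    Complex.digamma (z + 1) = -Real.eulerMascheroniConstant +
      ∑' n : ℕ, (1 / ((n : ℂ) + 1) - 1 / ((n : ℂ) + 1 + z)) := by
  have h1 : HasDerivAt (fun z ↦ Complex.exp (∑' n, logGammaTerm n z) *
      Complex.exp (-(z * Real.eulerMascheroniConstant))) _ z :=
    (hasDerivAt_tsum_logGammaTerm hz).cexp.mul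
      (((hasDerivAt_id z).mul_const (Real.eulerMascheroniConstant : ℂ)).neg.cexp)
  have h2 : HasDerivAt (fun z ↦ Complex.Gamma (z + 1)) _ z := h1.congr_of_eventuallyEq (by
    filter_upwards [(isOpen_lt continuous_const Complex.continuous_re).mem_nhds hz] with w hw
    exact Gamma_add_one_eq_exp hw)
  have h3 := h2.deriv
  rw [deriv_comp_add_const] at h3
  rw [Complex.digamma_def, logDeriv_apply, h3, Gamma_add_one_eq_exp hz,
    div_eq_iff (mul_ne_zero (Complex.exp_ne_zero _) (Complex.exp_ne_zero _))]
  simp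
  ring

theorem summable_digamma_terms {z : ℂ} (hz : -(1 / 2) < z.re) :
    Summable fun n : ℕ ↦ (1 / ((n : ℂ) + 1) - 1 / ((n : ℂ) + 1 + z)) := by
  obtain ⟨r, hr⟩ := exists_gt ‖z‖
  exact .of_norm_bounded (summable_inv_succ_sq.mul_left (2 * r))
    fun n ↦ norm_inv_sub_inv_le ⟨hz, by simpa using hr⟩ n

/-- The terms of the two series differ by (z - w) / ((n + z)(n + w)), which is at most ‖z - w‖ / (n
+ 1)² in norm. -/
theorem exists_lipschitz_digamma :
    ∃ C : ℝ, 0 ≤ C ∧ ∀ z w : ℂ, 1 ≤ z.re → 1 ≤ w.re →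
      ‖Complex.digamma z - Complex.digamma w‖ ≤ C * ‖z - w‖ := by
  refine ⟨∑' n : ℕ, 1 / ((n : ℝ) + 1) ^ 2, tsum_nonneg fun n ↦ by positivity, fun z w hz hw ↦ ?_⟩
  have hz' : 0 ≤ (z - 1).re := by simpa using hz
  have hw' : 0 ≤ (w - 1).re := by simpa using hw
  rw [← sub_add_cancel z 1, ← sub_add_cancel w 1,
    digamma_add_one_eq_tsum (by linarith), digamma_add_one_eq_tsum (by linarith),
    add_sub_add_left_eq_sub, ← Summable.tsum_sub (summable_digamma_terms (by linarith))
      (summable_digamma_terms (by linarith)), ← tsum_mul_right]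
  refine tsum_of_norm_bounded (summable_inv_succ_sq.mul_right _).hasSum fun n ↦ ?_
  have h1 := natCast_succ_le_norm_add hz' n
  have h2 := natCast_succ_le_norm_add hw' n
  have h1' : (n : ℂ) + 1 + (z - 1) ≠ 0 := by
    rw [← norm_pos_iff]; exact lt_of_lt_of_le (by positivity) h1
  have h2' : (n : ℂ) + 1 + (w - 1) ≠ 0 := by
    rw [← norm_pos_iff]; exact lt_of_lt_of_le (by positivity) h2
  have : (1 / ((n : ℂ) + 1) - 1 / ((n : ℂ) + 1 + (z - 1))) -
      (1 / ((n : ℂ) + 1) - 1 / ((n : ℂ) + 1 + (w - 1))) =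
      (z - w) / (((n : ℂ) + 1 + (z - 1)) * ((n : ℂ) + 1 + (w - 1))) := by
    rw [sub_sub_sub_cancel_left, div_sub_div _ _ h2' h1', mul_comm ((n : ℂ) + 1 + (z - 1))]
    congr 1
    ring
  rw [this, norm_div, norm_mul, sub_add_cancel, sub_add_cancel, div_eq_mul_one_div, mul_comm, sq]
  gcongr

/-- All terms of the series have nonnegative real part, so finitely many of them already bound it
below by a piece of the harmonic series. -/
theorem digamma_re_large (M : ℝ) :
    ∃ r : ℝ, ∀ z : ℂ, 1 ≤ z.re → r ≤ ‖z‖ → M ≤ (Complex.digamma z).re := by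
  obtain ⟨N, hN⟩ : ∃ N : ℕ, M + Real.eulerMascheroniConstant + 1 ≤
      ∑ n ∈ Finset.range N, 1 / ((n : ℝ) + 1) :=
    (tendsto_atTop.mp Real.tendsto_sum_range_one_div_nat_succ_atTop _).exists
  -- If ‖z‖ ≥ 2N + 1, the first N denominators z + n have norm at least N, so their reciprocals
  -- together cost at most 1.
  refine ⟨2 * N + 1, fun z hz hr ↦ ?_⟩
  have hz' : 0 ≤ (z - 1).re := by simpa using hz
  have hre (n : ℕ) : (1 / ((n : ℂ) + 1) - 1 / ((n : ℂ) + 1 + (z - 1))).re =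
      1 / ((n : ℝ) + 1) - (1 / ((n : ℂ) + 1 + (z - 1))).re := by
    have : (1 / ((n : ℂ) + 1)) = ((1 / ((n : ℝ) + 1) : ℝ) : ℂ) := by push_cast; rfl
    rw [this, Complex.sub_re, Complex.ofReal_re]
  have hle (n : ℕ) : (1 / ((n : ℂ) + 1 + (z - 1))).re ≤ 1 / ‖(n : ℂ) + 1 + (z - 1)‖ := by
    refine (Complex.re_le_norm _).trans ?_
    rw [norm_div, norm_one]
  have hs := summable_digamma_terms (z := z - 1) (by linarith)
  have hnonneg (n : ℕ) : 0 ≤ (1 / ((n : ℂ) + 1) - 1 / ((n : ℂ) + 1 + (z - 1))).re := by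
    rw [hre, sub_nonneg]
    exact (hle n).trans (one_div_le_one_div_of_le (by positivity) (natCast_succ_le_norm_add hz' n))
  have hsum : ∑ n ∈ Finset.range N, (1 / ((n : ℝ) + 1)) - 1 ≤
      ∑ n ∈ Finset.range N, (1 / ((n : ℂ) + 1) - 1 / ((n : ℂ) + 1 + (z - 1))).re := by
    have : ∑ n ∈ Finset.range N, (1 / ((n : ℂ) + 1 + (z - 1))).re ≤ 1 := by
      rcases Nat.eq_zero_or_pos N with rfl | hNpos
      · simp
      have hN' : (0 : ℝ) < N := by exact_mod_cast hNpos
      calc _ ≤ ∑ n ∈ Finset.range N, (1 / (N : ℝ)) := by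
            refine Finset.sum_le_sum fun n hn ↦ (hle n).trans
              (one_div_le_one_div_of_le hN' ?_)
            have h1 : (n : ℂ) + 1 + (z - 1) = z + n := by ring
            have h2 : ‖z‖ ≤ ‖z + n‖ + n := by
              have := norm_sub_le (z + n) (n : ℂ)
              simpa using this
            have h3 : (n : ℝ) ≤ N := by exact_mod_cast (Finset.mem_range.mp hn).le
            rw [h1]
            linarith
        _ = 1 := by simp [hN'.ne']
    simp only [hre, Finset.sum_sub_distrib]
    linarith
  rw [← sub_add_cancel z 1, digamma_add_one_eq_tsum (by linarith), Complex.add_re,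
    ← Complex.ofReal_neg, Complex.ofReal_re, Complex.re_tsum hs]
  have := ((Complex.hasSum_re hs.hasSum).summable).sum_le_tsum (Finset.range N)
    fun n _ ↦ hnonneg n
  linarith

/-- The part of the half plane `re z ≥ -A` at distance at least `ε` from `(-∞, 0]`, roughly. -/
def slitHalfPlane (A ε : ℝ) : Set ℂ := {z | -A ≤ z.re ∧ (ε ≤ |z.im| ∨ ε ≤ z.re)}

theorem le_norm_add_natCast {A ε : ℝ} {z : ℂ} (hz : z ∈ slitHalfPlane A ε) (j : ℕ) :
    ε ≤ ‖z + j‖ := by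
  rcases hz.2 with h | h
  · refine h.trans (le_trans (le_of_eq ?_) (Complex.abs_im_le_norm _))
    simp
  · refine le_trans ?_ (Complex.re_le_norm _)
    have : (0 : ℝ) ≤ j := j.cast_nonneg
    simp only [Complex.add_re, Complex.natCast_re]
    linarith

theorem digamma_eq_shift {A ε : ℝ} (hε : 0 < ε) {z : ℂ} (hz : z ∈ slitHalfPlane A ε) (K : ℕ) :
    Complex.digamma z = Complex.digamma (z + K) - ∑ j ∈ Finset.range K, (z + j)⁻¹ := by
  induction K with
  | zero => simp
  | succ K ih =>
    have h : ∀ m : ℕ, z + K ≠ -m := by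
      intro m hm
      have h1 := le_norm_add_natCast hz (K + m)
      have : z + ((K + m : ℕ) : ℂ) = 0 := by
        push_cast
        linear_combination hm
      rw [this, norm_zero] at h1
      linarith
    rw [Finset.sum_range_succ, ih, Nat.cast_add, Nat.cast_one, ← add_assoc,
      Complex.digamma_apply_add_one _ h]
    ring

theorem norm_sum_inv_le {A ε : ℝ} (hε : 0 < ε) {z : ℂ} (hz : z ∈ slitHalfPlane A ε) (K : ℕ) :
    ‖∑ j ∈ Finset.range K, (z + j)⁻¹‖ ≤ K * ε⁻¹ := by
  refine (norm_sum_le_of_le (n := fun _ ↦ ε⁻¹) _ fun j _ ↦ ?_).trans (by simp)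
  rw [norm_inv]
  exact inv_anti₀ hε (le_norm_add_natCast hz j)

/-- K steps of the recurrence ψ(z + 1) = ψ(z) + 1/z lead into `re z ≥ 1`. They cost at most K/ε,
because the region keeps distance ε from the poles. -/
theorem digamma_re_large_of_mem_slitHalfPlane (A : ℝ) {ε : ℝ} (hε : 0 < ε) (M : ℝ) :
    ∃ r : ℝ, ∀ z ∈ slitHalfPlane A ε, r ≤ ‖z‖ → M ≤ (Complex.digamma z).re := by
  obtain ⟨K, hK⟩ := exists_nat_ge (A + 1)
  obtain ⟨r, hr⟩ := digamma_re_large (M + K * ε⁻¹)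
  refine ⟨r + K, fun z hz hzr ↦ ?_⟩
  have h1 : r ≤ ‖z + K‖ := by
    have := norm_sub_le (z + K) (K : ℂ)
    simp only [add_sub_cancel_right, Complex.norm_natCast] at this
    linarith
  have h2 := hr (z + K) (by simpa using by linarith [hz.1]) h1
  have h3 := (Complex.re_le_norm _).trans (norm_sum_inv_le hε hz K)
  rw [digamma_eq_shift hε hz K, Complex.sub_re]
  linarith

/-- The summand 1 on the right absorbs the reciprocals produced by the shift, which are simply
bounded by K/ε at each of the two points. -/
theorem digamma_variation_of_mem_slitHalfPlane (A : ℝ) {ε : ℝ} (hε : 0 < ε) :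
    ∃ C : ℝ, ∀ z ∈ slitHalfPlane A ε, ∀ w ∈ slitHalfPlane A ε,
      ‖Complex.digamma z - Complex.digamma w‖ ≤ C * (1 + ‖z - w‖) := by
  obtain ⟨K, hK⟩ := exists_nat_ge (A + 1)
  obtain ⟨C, hC0, hC⟩ := exists_lipschitz_digamma
  refine ⟨max C (2 * (K * ε⁻¹)), fun z hz w hw ↦ ?_⟩
  have h2 := hC (z + K) (w + K) (by simpa using by linarith [hz.1])
    (by simpa using by linarith [hw.1])
  rw [add_sub_add_right_eq_sub] at h2
  rw [digamma_eq_shift hε hz K, digamma_eq_shift hε hw K, sub_sub_sub_comm]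
  have h4 := norm_sub_le (Complex.digamma (z + K) - Complex.digamma (w + K))
    (∑ j ∈ Finset.range K, (z + j)⁻¹ - ∑ j ∈ Finset.range K, (w + j)⁻¹)
  have h5 := norm_sub_le (∑ j ∈ Finset.range K, (z + j)⁻¹) (∑ j ∈ Finset.range K, (w + j)⁻¹)
  have h6 := norm_sum_inv_le hε hz K
  have h7 := norm_sum_inv_le hε hw K
  have h8 : C * ‖z - w‖ ≤ max C (2 * (K * ε⁻¹)) * ‖z - w‖ := by gcongr; exact le_max_left _ _
  have h9 := le_max_right C (2 * (K * ε⁻¹))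
  linarith

end EigenformL
end

/-! ### Derivatives of cos(πs) G(s) when G' = QG with Q slowly varying. -/

noncomputable section
namespace EigenformL

open Filter Topology

/-- The domain `re s > 1`, slit along `(1, κ]`. -/
def slitDomain (κ : ℝ) : Set ℂ := {s | 1 < s.re ∧ (s.im ≠ 0 ∨ κ < s.re)}

/-- The points of `slitDomain κ` at distance at least `ε` from its boundary, in each coordinate. -/
def slitRegion (κ ε : ℝ) : Set ℂ := {s | 1 + ε ≤ s.re ∧ (ε ≤ |s.im| ∨ κ + ε ≤ s.re)}

theorem isOpen_slitDomain (κ : ℝ) : IsOpen (slitDomain κ) :=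
  (isOpen_lt continuous_const Complex.continuous_re).inter
    ((isOpen_ne_fun Complex.continuous_im continuous_const).union
      (isOpen_lt continuous_const Complex.continuous_re))

theorem slitRegion_subset (κ : ℝ) {ε : ℝ} (hε : 0 < ε) : slitRegion κ ε ⊆ slitDomain κ := by
  rintro s ⟨h1, h2⟩
  refine ⟨by linarith, h2.imp (fun h ↦ ?_) fun h ↦ by linarith⟩
  rw [← abs_pos]
  linarith

theorem slitRegion_mono (κ : ℝ) {ε δ : ℝ} (h : ε ≤ δ) : slitRegion κ δ ⊆ slitRegion κ ε :=
  fun _ hs ↦ ⟨by linarith [hs.1], hs.2.imp h.trans fun h ↦ by linarith⟩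

theorem closedBall_subset_slitRegion {κ ε : ℝ} {s : ℂ} (hs : s ∈ slitRegion κ ε) :
    Metric.closedBall s (ε / 2) ⊆ slitRegion κ (ε / 2) := by
  intro w hw
  rw [Metric.mem_closedBall, dist_comm, dist_eq_norm] at hw
  have hre := (Complex.re_le_norm _).trans hw
  have him := (Complex.abs_im_le_norm _).trans hw
  rw [Complex.sub_re] at hre
  rw [Complex.sub_im] at him
  refine ⟨by linarith [hs.1], hs.2.imp (fun h ↦ ?_) fun h ↦ by linarith⟩
  have := abs_sub_abs_le_abs_sub s.im w.im
  linarith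

/-- `g` is of order `Q ^ (i - 1)` on each `slitRegion κ ε`. -/
def SubGrowth (κ : ℝ) (Q : ℂ → ℂ) (i : ℕ) (g : ℂ → ℂ) : Prop :=
  ∀ ε > 0, ∃ C, 0 ≤ C ∧ ∀ s ∈ slitRegion κ ε, ‖g s‖ * (1 + ‖Q s‖) ≤ C * (1 + ‖Q s‖) ^ i

/-- `Q` varies by a bounded amount on discs well inside `slitDomain κ`. -/
def BoundedVariation (κ : ℝ) (Q : ℂ → ℂ) : Prop :=
  ∀ ε > 0, ∃ C, 0 ≤ C ∧ ∀ s ∈ slitRegion κ ε, ∀ w ∈ Metric.closedBall s (ε / 2), ‖Q w - Q s‖ ≤ C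

namespace SubGrowth

variable {κ : ℝ} {Q : ℂ → ℂ} {i : ℕ} {g h : ℂ → ℂ}

/-- The factor 1 + ‖Q‖ on the left of `SubGrowth` expresses order i - 1 without truncated
subtraction. At i = 0, where the induction starts, both error terms are zero. -/
theorem zero : SubGrowth κ Q i 0 := fun ε _ ↦ ⟨0, le_rfl, fun s _ ↦ by simp⟩

theorem add (hg : SubGrowth κ Q i g) (hh : SubGrowth κ Q i h) : SubGrowth κ Q i (g + h) := by
  intro ε hε
  obtain ⟨C, hC0, hC⟩ := hg ε hε
  obtain ⟨D, hD0, hD⟩ := hh ε hε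
  refine ⟨C + D, by positivity, fun s hs ↦ ?_⟩
  have h1 : ‖(g + h) s‖ * (1 + ‖Q s‖) ≤ (‖g s‖ + ‖h s‖) * (1 + ‖Q s‖) := by
    gcongr
    exact norm_add_le _ _
  linarith [hC s hs, hD s hs]

theorem const_smul (hg : SubGrowth κ Q i g) (c : ℂ) : SubGrowth κ Q i (c • g) := by
  intro ε hε
  obtain ⟨C, hC0, hC⟩ := hg ε hε
  refine ⟨‖c‖ * C, by positivity, fun s hs ↦ ?_⟩
  rw [Pi.smul_apply, norm_smul, mul_assoc, mul_assoc]
  exact mul_le_mul_of_nonneg_left (hC s hs) (norm_nonneg _)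

theorem mul_left (hg : SubGrowth κ Q i g) : SubGrowth κ Q (i + 1) (Q * g) := by
  intro ε hε
  obtain ⟨C, hC0, hC⟩ := hg ε hε
  refine ⟨C, hC0, fun s hs ↦ ?_⟩
  rw [Pi.mul_apply, norm_mul, mul_assoc]
  calc ‖Q s‖ * (‖g s‖ * (1 + ‖Q s‖)) ≤ (1 + ‖Q s‖) * (C * (1 + ‖Q s‖) ^ i) := by
        refine mul_le_mul ?_ (hC s hs) (by positivity) (by positivity)
        linarith [norm_nonneg (Q s)]
    _ = C * (1 + ‖Q s‖) ^ (i + 1) := by ring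

theorem succ (hg : SubGrowth κ Q i g) : SubGrowth κ Q (i + 1) g := by
  intro ε hε
  obtain ⟨C, hC0, hC⟩ := hg ε hε
  refine ⟨C, hC0, fun s hs ↦ (hC s hs).trans ?_⟩
  gcongr
  · linarith [norm_nonneg (Q s)]
  · exact i.le_succ

theorem pow_self (κ : ℝ) (Q : ℂ → ℂ) (i : ℕ) : SubGrowth κ Q (i + 1) (Q ^ i) := by
  intro ε hε
  refine ⟨1, zero_le_one, fun s hs ↦ ?_⟩
  rw [Pi.pow_apply, norm_pow, one_mul, pow_succ]
  gcongr
  linarith [norm_nonneg (Q s)]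

/-- Cauchy's estimate on a circle of radius ε/2. Bounded variation of Q makes 1 + ‖Q‖ at the centre
and on the circle comparable, so the order is preserved. -/
theorem deriv (hQ : BoundedVariation κ Q) (hd : DifferentiableOn ℂ g (slitDomain κ))
    (hg : SubGrowth κ Q i g) : SubGrowth κ Q i (deriv g) := by
  intro ε hε
  obtain ⟨C, hC0, hC⟩ := hg (ε / 2) (half_pos hε)
  obtain ⟨D, hD0, hD⟩ := hQ ε hε
  set K := C * (1 + D) ^ i * (1 + D) with hK
  refine ⟨K / (ε / 2), by positivity, fun s hs ↦ ?_⟩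
  have hsub := closedBall_subset_slitRegion hs
  have hu : 0 < 1 + ‖Q s‖ := by positivity
  have hbound : ∀ w ∈ Metric.sphere s (ε / 2), ‖g w‖ ≤ K * (1 + ‖Q s‖) ^ i / (1 + ‖Q s‖) := by
    intro w hw
    have hw' := Metric.sphere_subset_closedBall hw
    have h1 := hD s hs w hw'
    have h2 := norm_sub_norm_le (Q w) (Q s)
    have h3 := norm_sub_norm_le (Q s) (Q w)
    rw [norm_sub_rev] at h3
    have h4 : 1 + ‖Q w‖ ≤ (1 + D) * (1 + ‖Q s‖) := by nlinarith [norm_nonneg (Q s)]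
    have h5 : 1 + ‖Q s‖ ≤ (1 + D) * (1 + ‖Q w‖) := by nlinarith [norm_nonneg (Q w)]
    rw [le_div_iff₀ hu]
    calc ‖g w‖ * (1 + ‖Q s‖) ≤ ‖g w‖ * ((1 + D) * (1 + ‖Q w‖)) := by gcongr
      _ = (‖g w‖ * (1 + ‖Q w‖)) * (1 + D) := by ring
      _ ≤ C * (1 + ‖Q w‖) ^ i * (1 + D) :=
          mul_le_mul_of_nonneg_right (hC w (hsub hw')) (by positivity)
      _ ≤ C * ((1 + D) * (1 + ‖Q s‖)) ^ i * (1 + D) := by gcongr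
      _ = K * (1 + ‖Q s‖) ^ i := by rw [hK, mul_pow]; ring
  have h := Complex.norm_deriv_le_of_forall_mem_sphere_norm_le (half_pos hε)
    ((hd.mono (hsub.trans (slitRegion_subset κ (half_pos hε)))).diffContOnCl_ball subset_rfl) hbound
  rw [div_div, le_div_iff₀ (by positivity)] at h
  rw [div_mul_eq_mul_div, le_div_iff₀ (half_pos hε), mul_assoc]
  exact h

end SubGrowth

/-- The derivatives of `cos (π s) * G s`, where `G' = Q * G`. -/
theorem exists_iteratedDeriv_eq {κ : ℝ} {F G Q : ℂ → ℂ}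
    (hF : ∀ s ∈ slitDomain κ, F s = G s * Complex.cos (Real.pi * s))
    (hG : ∀ s ∈ slitDomain κ, HasDerivAt G (Q s * G s) s)
    (hQd : DifferentiableOn ℂ Q (slitDomain κ)) (hQ : BoundedVariation κ Q) (i : ℕ) :
    ∃ A B : ℂ → ℂ, DifferentiableOn ℂ A (slitDomain κ) ∧ DifferentiableOn ℂ B (slitDomain κ) ∧
      SubGrowth κ Q i (A - Q ^ i) ∧ SubGrowth κ Q i B ∧
      ∀ s ∈ slitDomain κ, iteratedDeriv i F s =
        G s * (Complex.cos (Real.pi * s) * A s + Complex.sin (Real.pi * s) * B s) := by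
  have hopen := isOpen_slitDomain κ
  induction i with
  | zero =>
    refine ⟨1, 0, differentiableOn_const _, differentiableOn_const _, ?_, .zero, fun s hs ↦ ?_⟩
    · simpa using SubGrowth.zero
    · simp [hF s hs]
  | succ i ih =>
    obtain ⟨A, B, hA, hB, hA', hB', h⟩ := ih
    have hAg : SubGrowth κ Q (i + 1) A := by
      simpa using hA'.succ.add (SubGrowth.pow_self κ Q i)
    -- The Leibniz rule with G' = QG. Only multiplication by Q raises the order; the derivatives of
    -- cosine and sine interchange A and B with factors ±π. Hence Q^(i + 1) is the only term of top
    -- order.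
    refine ⟨deriv A + Q * A + (Real.pi : ℂ) • B, deriv B + Q * B - (Real.pi : ℂ) • A,
      ((hA.deriv hopen).add (hQd.mul hA)).add (hB.const_smul _),
      ((hB.deriv hopen).add (hQd.mul hB)).sub (hA.const_smul _), ?_, ?_, fun s hs ↦ ?_⟩
    · have : deriv A + Q * A + (Real.pi : ℂ) • B - Q ^ (i + 1) =
          deriv A + Q * (A - Q ^ i) + (Real.pi : ℂ) • B := by ring
      rw [this]
      exact ((hAg.deriv hQ hA).add hA'.mul_left).add (hB'.succ.const_smul _)
    · rw [sub_eq_add_neg, ← neg_smul]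
      exact ((hB'.deriv hQ hB).succ.add hB'.mul_left).add (hAg.const_smul _)
    · have hev : iteratedDeriv i F =ᶠ[𝓝 s] fun s ↦
          G s * (Complex.cos (Real.pi * s) * A s + Complex.sin (Real.pi * s) * B s) := by
        filter_upwards [hopen.mem_nhds hs] with w hw using h w hw
      have hAs := (hA.differentiableAt (hopen.mem_nhds hs)).hasDerivAt
      have hBs := (hB.differentiableAt (hopen.mem_nhds hs)).hasDerivAt
      have hlin : HasDerivAt (fun s : ℂ ↦ (Real.pi : ℂ) * s) (Real.pi : ℂ) s := by
        simpa using (hasDerivAt_id s).const_mul (Real.pi : ℂ)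
      have hder := (hG s hs).mul ((hlin.ccos.mul hAs).add (hlin.csin.mul hBs))
      rw [iteratedDeriv_succ, hev.deriv_eq]
      refine hder.deriv.trans ?_
      simp only [Pi.add_apply, Pi.mul_apply, Pi.sub_apply, Pi.smul_apply, smul_eq_mul]
      ring

/-- Once ‖Q‖ ≥ 1, 1 + ‖Q‖ is at most 2‖Q‖, and the missing power of ‖Q‖ beats the constant C 2^i /
η. -/
theorem SubGrowth.eventually_le {κ : ℝ} {Q g : ℂ → ℂ} {i : ℕ} (hg : SubGrowth κ Q i g)
    (hQ : ∀ ε > 0, ∀ M : ℝ, ∃ r : ℝ, ∀ s ∈ slitRegion κ ε, r ≤ ‖s‖ → M ≤ (Q s).re)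
    {ε η : ℝ} (hε : 0 < ε) (hη : 0 < η) :
    ∃ r : ℝ, ∀ s ∈ slitRegion κ ε, r ≤ ‖s‖ → ‖g s‖ ≤ η * ‖Q s‖ ^ i := by
  obtain ⟨C, hC0, hC⟩ := hg ε hε
  obtain ⟨r, hr⟩ := hQ ε hε (max 1 (C * 2 ^ i / η))
  refine ⟨r, fun s hs hsr ↦ ?_⟩
  have h1 := (hr s hs hsr).trans (Complex.re_le_norm _)
  have h2 : 1 ≤ ‖Q s‖ := (le_max_left _ _).trans h1
  have h3 : C * 2 ^ i ≤ η * ‖Q s‖ := by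
    rw [← div_le_iff₀' hη]
    exact (le_max_right _ _).trans h1
  have hpos : 0 < 1 + ‖Q s‖ := by positivity
  refine le_of_mul_le_mul_right ((hC s hs).trans ?_) hpos
  calc C * (1 + ‖Q s‖) ^ i ≤ C * (2 * ‖Q s‖) ^ i := by gcongr; linarith
    _ = C * 2 ^ i * ‖Q s‖ ^ i := by rw [mul_pow]; ring
    _ ≤ η * (1 + ‖Q s‖) * ‖Q s‖ ^ i :=
        mul_le_mul_of_nonneg_right (by linarith) (by positivity)
    _ = _ := by ring

end EigenformL
end

/-! ### The functional equation in the form L(1 - s) = 2 cos(πs) G(s). -/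

noncomputable section
namespace EigenformL

open Filter Topology

/-- The matrix -1 acts trivially on the upper half plane and contributes the factor (-1)^k. -/
theorem even_of_ne_zero {k : ℤ} (f : CuspForm 𝒮ℒ k) (hf : ∃ τ, f τ ≠ 0) : Even k := by
  by_contra hk
  rw [Int.not_even_iff_odd] at hk
  obtain ⟨z, hz⟩ := hf
  have hf := SlashInvariantForm.slash_action_eqn'' f
    (show (-1 : GL (Fin 2) ℝ) ∈ 𝒮ℒ from ⟨-1, by ext; simp⟩) z
  rw [UpperHalfPlane.neg_smul, one_smul, UpperHalfPlane.denom_neg, UpperHalfPlane.denom_one,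
    hk.neg_one_zpow] at hf
  have h2 : (2 : ℂ) * f z = 0 := by linear_combination hf
  exact hz ((mul_eq_zero.mp h2).resolve_left (by norm_num))

theorem IsNormalizedHeckeEigenform.ne_zero {k : ℤ} {f : CuspForm 𝒮ℒ k}
    (hf : IsNormalizedHeckeEigenform f) : ∃ τ, f τ ≠ 0 := by
  by_contra! h
  have : (f : ℍ → ℂ) = 0 := funext h
  have h1 := hf.coeff_one
  rw [this, UpperHalfPlane.qExpansion_zero] at h1
  simp at h1

/-- The general functional equation relates f to its translate by S, which at level one is f itself.
-/
theorem completed_functional_equation {k : ℤ} (hk : 0 < k) (f : CuspForm 𝒮ℒ k) (s : ℂ) :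
    ModularForm.Λ hk f (k - s) = Complex.I ^ k * ModularForm.Λ hk f s := by
  have h := (ModularForm.weakFEPair hk f).functional_equation s
  rw [(CuspForm.isStrongFEPair hk f).symm_Λ_eq] at h
  have hg : (ModularForm.weakFEPair hk f).g =
      fun t : ℝ ↦ f (UpperHalfPlane.ofComplex (Complex.I * t)) := by
    ext t
    have : (ModularForm.translate f ModularGroup.S : ℍ → ℂ) = f :=
      SlashInvariantFormClass.slash_action_eq f _ ⟨ModularGroup.S, rfl⟩
    exact congrFun this _
  rw [hg, ← CuspForm.Λ_eq_mellin hk f] at h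
  simpa [ModularForm.Λ] using h

/-- The smooth factor in the functional equation `L (1 - s) = 2 cos (π s) G s`. -/
def reflectionFactor {k : ℤ} (hk : 0 < k) (f : CuspForm 𝒮ℒ k) (s : ℂ) : ℂ :=
  (2 * (Real.pi : ℂ)) ^ (-(2 * s)) * Complex.Gamma (s + ((k : ℂ) - 1) / 2) *
    Complex.Gamma (s - ((k : ℂ) - 1) / 2) * L hk f s

/-- The slit (1, κ] is removed precisely so that s - κ avoids the poles of Γ. -/
theorem slitDomain_sub_ne {κ : ℝ} {s : ℂ} (hs : s ∈ slitDomain κ) (m : ℕ) : s - κ ≠ -m := by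
  intro h
  rcases hs.2 with him | hre
  · have := congrArg Complex.im h
    simp at this
    exact him this
  · have := congrArg Complex.re h
    simp at this
    have : (0 : ℝ) ≤ m := m.cast_nonneg
    linarith

theorem ofReal_weight (k : ℤ) : ((k : ℂ) - 1) / 2 = ((((k : ℝ) - 1) / 2 : ℝ) : ℂ) := by
  push_cast
  rfl

theorem sin_pi_sub_weight {k : ℤ} (hk : Even k) (s : ℂ) :
    Complex.I ^ k * Complex.sin (Real.pi * (s - ((k : ℂ) - 1) / 2)) =
      Complex.cos (Real.pi * s) := by
  obtain ⟨l, rfl⟩ := hk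
  have h1 : (Real.pi : ℂ) * (s - (((l + l : ℤ) : ℂ) - 1) / 2) =
      (Real.pi * s - l * Real.pi) + Real.pi / 2 := by
    push_cast
    ring
  rw [h1, Complex.sin_add_pi_div_two, Complex.cos_antiperiodic.sub_int_mul_eq,
    Int.cast_negOnePow ℂ, ← mul_assoc, ← two_mul, zpow_mul]
  have : (Complex.I : ℂ) ^ (2 : ℤ) = -1 := by
    rw [zpow_ofNat, Complex.I_sq]
  rw [this, ← mul_zpow]
  simp

/-- The reflection formula turns 1/Γ(1 - (s - κ)) into Γ(s - κ) sin(π(s - κ))/π. As k is even, the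
root number i^k turns this sine into cos πs. -/
theorem L_one_sub {k : ℤ} (hk : 0 < k) (hk2 : Even k) (f : CuspForm 𝒮ℒ k) {s : ℂ}
    (hs : s ∈ slitDomain (((k : ℝ) - 1) / 2)) :
    L hk f (1 - s) = reflectionFactor hk f s * (2 * Complex.cos (Real.pi * s)) := by
  have hsub := slitDomain_sub_ne hs
  rw [← ofReal_weight] at hsub
  have hk' : (1 : ℝ) ≤ k := by exact_mod_cast hk
  have hpos : 0 < (s + ((k : ℂ) - 1) / 2).re := by
    rw [ofReal_weight, Complex.add_re, Complex.ofReal_re]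
    have := hs.1
    linarith
  have hG := Complex.Gamma_ne_zero_of_re_pos hpos
  have hG2 := Complex.Gamma_ne_zero hsub
  have hpi : (2 * (Real.pi : ℂ)) ≠ 0 := by simp [Real.pi_ne_zero]
  have hpi' : (Real.pi : ℂ) ≠ 0 := by simp [Real.pi_ne_zero]
  have hsin := Complex.Gamma_mul_Gamma_one_sub (s - ((k : ℂ) - 1) / 2)
  have hrec : (Complex.Gamma (1 - (s - ((k : ℂ) - 1) / 2)))⁻¹ =
      Complex.Gamma (s - ((k : ℂ) - 1) / 2) *
        Complex.sin (Real.pi * (s - ((k : ℂ) - 1) / 2)) / Real.pi := by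
    -- If the sine vanishes, 1 - (s - κ) is a pole of Γ. There `Complex.Gamma` takes the value 0, so
    -- its inverse is 0 as well and the identity persists.
    by_cases h0 : Complex.sin (Real.pi * (s - ((k : ℂ) - 1) / 2)) = 0
    · rw [h0, div_zero] at hsin
      rw [(mul_eq_zero.mp hsin).resolve_left hG2, h0]
      simp
    · have h1 : Complex.Gamma (1 - (s - ((k : ℂ) - 1) / 2)) ≠ 0 := by
        intro h
        rw [h, mul_zero, eq_comm, div_eq_zero_iff] at hsin
        exact hsin.elim hpi' h0
      rw [eq_div_iff h0] at hsin
      rw [inv_eq_iff_eq_inv, ← one_div, eq_div_iff (div_ne_zero (mul_ne_zero hG2 h0) hpi'),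
        mul_div_assoc', div_eq_one_iff_eq hpi', mul_left_comm, ← mul_assoc]
      exact hsin
  have hΛ := completed_functional_equation hk f (s + ((k : ℂ) - 1) / 2)
  have e1 : (k : ℂ) - (s + ((k : ℂ) - 1) / 2) = 1 - s + ((k : ℂ) - 1) / 2 := by ring
  have e2 : 1 - s + ((k : ℂ) - 1) / 2 = 1 - (s - ((k : ℂ) - 1) / 2) := by ring
  have e3 : ModularForm.Λ hk f (s + ((k : ℂ) - 1) / 2) = L hk f s *
      ((2 * (Real.pi : ℂ)) ^ (-(s + ((k : ℂ) - 1) / 2)) *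
        Complex.Gamma (s + ((k : ℂ) - 1) / 2)) := by
    have := (Complex.cpow_ne_zero_iff (x := 2 * (Real.pi : ℂ))
      (y := -(s + ((k : ℂ) - 1) / 2))).mpr (.inl hpi)
    rw [L, ModularForm.L, Complex.Gammaℂ]
    generalize s + ((k : ℂ) - 1) / 2 = w at this hG ⊢
    field_simp
  rw [e1, e3] at hΛ
  have e4 : (2 * (Real.pi : ℂ)) ^ (1 - s + ((k : ℂ) - 1) / 2) *
      (2 * (Real.pi : ℂ)) ^ (-(s + ((k : ℂ) - 1) / 2)) =
      (2 * Real.pi) * (2 * (Real.pi : ℂ)) ^ (-(2 * s)) := by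
    rw [← Complex.cpow_add _ _ hpi]
    nth_rewrite 2 [← Complex.cpow_one (2 * (Real.pi : ℂ))]
    rw [← Complex.cpow_add _ _ hpi]
    congr 1
    ring
  have e5 : (2 : ℂ) / Complex.Gammaℂ (1 - s + ((k : ℂ) - 1) / 2) =
      (2 * (Real.pi : ℂ)) ^ (1 - s + ((k : ℂ) - 1) / 2) *
        (Complex.Gamma (1 - (s - ((k : ℂ) - 1) / 2)))⁻¹ := by
    rw [Complex.Gammaℂ, ← e2, Complex.cpow_neg]
    field_simp
  rw [show L hk f (1 - s) = ModularForm.Λ hk f (1 - s + ((k : ℂ) - 1) / 2) *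
    (2 / Complex.Gammaℂ (1 - s + ((k : ℂ) - 1) / 2)) from rfl, hΛ, e5, hrec, reflectionFactor,
    ← sin_pi_sub_weight hk2]
  calc _ = ((2 * (Real.pi : ℂ)) ^ (1 - s + ((k : ℂ) - 1) / 2) *
        (2 * (Real.pi : ℂ)) ^ (-(s + ((k : ℂ) - 1) / 2))) / Real.pi *
        (Complex.I ^ k * L hk f s * Complex.Gamma (s + ((k : ℂ) - 1) / 2) *
        Complex.Gamma (s - ((k : ℂ) - 1) / 2) *
        Complex.sin (Real.pi * (s - ((k : ℂ) - 1) / 2))) := by ring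
    _ = _ := by
      rw [e4]
      field_simp

/-- `L_f` vanishes at the trivial zero `-(k - 1) / 2`. -/
theorem L_trivial_zero {k : ℤ} (hk : 0 < k) (f : CuspForm 𝒮ℒ k) :
    L hk f (-(((k : ℂ) - 1) / 2)) = 0 := by
  -- By convention `Complex.Gamma 0 = 0` and division by zero gives 0. This agrees with the
  -- continuation, since `differentiable_L` holds for this very function.
  rw [L, ModularForm.L, neg_add_cancel, Complex.Gammaℂ]
  simp

end EigenformL
end

/-! ### A partition of unity for the action of SL₂(ℤ) on the upper half plane. -/

noncomputable section
namespace EigenformL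

open Filter Topology MeasureTheory ModularGroup
open scoped ENNReal

instance countable_SL2Z : Countable SL(2, ℤ) := by
  have : Countable (Matrix (Fin 2) (Fin 2) ℤ) := inferInstanceAs (Countable (Fin 2 → Fin 2 → ℤ))
  exact Subtype.countable

/-- After moving z into the fundamental domain, the classification of the matrices that map a point
of `fd` into `fd` leaves a finite list. -/
theorem finite_smul_mem_fd (z : ℍ) : {g : SL(2, ℤ) | g • z ∈ fd}.Finite := by
  obtain ⟨g₀, hg₀⟩ := exists_smul_mem_fd z
  have hfin : {g : SL(2, ℤ) | g • (g₀ • z) ∈ fd}.Finite := by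
    refine Set.Finite.subset (s := {1, -1, T, -T, T⁻¹, -T⁻¹, S, -S, T * S, -(T * S),
      T⁻¹ * S * T⁻¹, -(T⁻¹ * S * T⁻¹), S * T⁻¹, -(S * T⁻¹), S * T, -(S * T), T * S * T,
      -(T * S * T), T⁻¹ * S, -(T⁻¹ * S)}) (Set.toFinite _) fun g hg ↦ ?_
    rcases cases_of_mem_fd_smul_mem_fd hg₀ hg with (h | h) | ⟨h | h, -⟩ | ⟨h | h, -⟩ |
      ⟨h | h, -⟩ | ⟨h | h, -⟩ | ⟨h | h, -⟩ | ⟨h | h, -⟩ | ⟨h | h, -⟩ | ⟨h | h, -⟩ | ⟨h | h, -⟩ <;>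
    simp only [h, Set.mem_insert_iff, true_or, or_true, Set.mem_singleton_iff]
  refine (hfin.image (· * g₀)).subset fun g hg ↦ ⟨g * g₀⁻¹, ?_, by simp⟩
  simpa [← mul_smul] using hg

/-- The number of `γ ∈ SL₂(ℤ)` moving `z` into the standard fundamental domain. -/
def fdCount (z : ℍ) : ℝ≥0∞ := ∑' g : SL(2, ℤ), Set.indicator fd 1 (g • z)

theorem fdCount_ne_top (z : ℍ) : fdCount z ≠ ∞ := by
  rw [fdCount, tsum_eq_sum (s := (finite_smul_mem_fd z).toFinset)]
  · refine ENNReal.sum_ne_top.mpr fun g _ ↦ ?_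
    exact ((Set.indicator_le_self fd (1 : ℍ → ℝ≥0∞) (g • z)).trans_lt ENNReal.one_lt_top).ne
  · intro g hg
    simpa using hg

theorem fdCount_ne_zero (z : ℍ) : fdCount z ≠ 0 := by
  obtain ⟨g, hg⟩ := exists_smul_mem_fd z
  have := ENNReal.le_tsum (f := fun g : SL(2, ℤ) ↦ Set.indicator fd (1 : ℍ → ℝ≥0∞) (g • z)) g
  rw [Set.indicator_of_mem hg, Pi.one_apply] at this
  exact (zero_lt_one.trans_le this).ne'

theorem fdCount_smul (g : SL(2, ℤ)) (z : ℍ) : fdCount (g • z) = fdCount z := by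
  rw [fdCount, fdCount, ← (Equiv.mulRight g).tsum_eq fun h : SL(2, ℤ) ↦
    Set.indicator fd (1 : ℍ → ℝ≥0∞) (h • z)]
  simp only [Equiv.coe_mulRight, mul_smul]

theorem measurable_fdCount : Measurable fdCount := by
  refine Measurable.tsum fun g ↦ ?_
  refine (measurable_one.indicator isClosed_fd.measurableSet).comp ?_
  exact (continuous_const_smul (g : GL (Fin 2) ℝ)).measurable

/-- A weight on the upper half plane whose `SL₂(ℤ)`-translates sum to `1`. -/
def fdWeight (z : ℍ) : ℝ := (Set.indicator fd 1 z / fdCount z).toReal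

theorem measurable_fdWeight : Measurable fdWeight :=
  ((measurable_one.indicator isClosed_fd.measurableSet).div measurable_fdCount).ennreal_toReal

theorem fdWeight_nonneg (z : ℍ) : 0 ≤ fdWeight z := ENNReal.toReal_nonneg

theorem fdWeight_pos {z : ℍ} (hz : z ∈ fd) : 0 < fdWeight z := by
  rw [fdWeight, Set.indicator_of_mem hz, Pi.one_apply]
  exact ENNReal.toReal_pos (ENNReal.div_ne_zero.mpr ⟨one_ne_zero, fdCount_ne_top z⟩)
    (ENNReal.div_ne_top ENNReal.one_ne_top (fdCount_ne_zero z))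

theorem fdWeight_le (z : ℍ) : fdWeight z ≤ Set.indicator fd 1 z := by
  by_cases hz : z ∈ fd
  · rw [fdWeight, Set.indicator_of_mem hz, Set.indicator_of_mem hz, Pi.one_apply, Pi.one_apply]
    have h1 : 1 ≤ fdCount z := by
      have := ENNReal.le_tsum
        (f := fun g : SL(2, ℤ) ↦ Set.indicator fd (1 : ℍ → ℝ≥0∞) (g • z)) 1
      rwa [one_smul, Set.indicator_of_mem hz, Pi.one_apply] at this
    refine ENNReal.toReal_le_of_le_ofReal zero_le_one ?_
    rw [ENNReal.ofReal_one]
    exact ENNReal.div_le_of_le_mul (by simpa using h1)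
  · simp [fdWeight, hz]

/-- The count is invariant, so it factors out of the sum. Dividing by it accounts exactly for ±1,
for stabilizers and for boundary overlaps, with no appeal to null sets. -/
theorem hasSum_fdWeight_smul (z : ℍ) : HasSum (fun g : SL(2, ℤ) ↦ fdWeight (g • z)) 1 := by
  have h : ∑' g : SL(2, ℤ), Set.indicator fd (1 : ℍ → ℝ≥0∞) (g • z) / fdCount (g • z) = 1 := by
    simp only [fdCount_smul, div_eq_mul_inv]
    rw [ENNReal.tsum_mul_right]
    exact ENNReal.mul_inv_cancel (fdCount_ne_zero z) (fdCount_ne_top z)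
  have h1 := ENNReal.hasSum_toReal (h ▸ ENNReal.one_ne_top)
  rw [← ENNReal.tsum_toReal_eq (f := fun g : SL(2, ℤ) ↦ Set.indicator fd (1 : ℍ → ℝ≥0∞) (g • z) /
    fdCount (g • z)) fun g ↦ ENNReal.ne_top_of_tsum_ne_top (h ▸ ENNReal.one_ne_top) g,
    h, ENNReal.toReal_one] at h1
  exact h1

theorem fdWeight_le_one (z : ℍ) : fdWeight z ≤ 1 := by
  refine (fdWeight_le z).trans ?_
  exact Set.indicator_le_self' (fun _ _ ↦ zero_le_one) z

/-- The domain lies in the strip |x| ≤ 1/2, y > 1/2, where y⁻² is integrable. -/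
theorem volume_fd_lt_top : volume fd < ∞ := by
  rw [UpperHalfPlane.volume_eq_lintegral]
  set E : Set (ℝ × ℝ) := Set.Icc (-(1 / 2)) (1 / 2) ×ˢ Set.Ioi (1 / 2)
  have hsub : (UpperHalfPlane.coe '' fd) ⊆ Complex.measurableEquivRealProd ⁻¹' E := by
    rintro _ ⟨z, hz, rfl⟩
    have h1 := three_le_four_mul_im_sq_of_mem_fd hz
    have h2 := abs_le.mp hz.2
    have h3 := z.im_pos
    refine ⟨⟨h2.1, h2.2⟩, ?_⟩
    change 1 / 2 < z.im
    nlinarith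
  refine (lintegral_mono_set hsub).trans_lt ?_
  have hmp := Complex.volume_preserving_equiv_real_prod
  have h := hmp.setLIntegral_comp_preimage_emb Complex.measurableEquivRealProd.measurableEmbedding
    (fun p : ℝ × ℝ ↦ (((1 / ‖p.2‖₊) ^ 2 : NNReal) : ℝ≥0∞)) E
  refine (le_of_eq h).trans_lt ?_
  rw [Measure.volume_eq_prod, ← Measure.prod_restrict,
    lintegral_prod _ (by fun_prop)]
  simp only [lintegral_const]
  refine ENNReal.mul_lt_top ?_ (by simp)
  have hint : IntegrableOn (fun y : ℝ ↦ y ^ (-2 : ℝ)) (Set.Ioi (1 / 2)) :=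
    integrableOn_Ioi_rpow_of_lt (by norm_num) (by norm_num)
  refine lt_of_le_of_lt (le_of_eq ?_) hint.2
  refine setLIntegral_congr_fun measurableSet_Ioi fun y hy ↦ ?_
  have hy0 : (0 : ℝ) < y := lt_trans (by norm_num) hy
  change (((1 / ‖y‖₊) ^ 2 : NNReal) : ℝ≥0∞) = ((‖y ^ (-2 : ℝ)‖₊ : NNReal) : ℝ≥0∞)
  rw [Real.rpow_neg hy0.le, nnnorm_inv, Real.rpow_two, nnnorm_pow, one_div, inv_pow]

theorem integrable_fdWeight : Integrable fdWeight := by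
  have h : Integrable (Set.indicator fd (1 : ℍ → ℝ)) :=
    (integrable_indicator_iff isClosed_fd.measurableSet).mpr
      (integrableOn_const volume_fd_lt_top.ne)
  refine h.mono' measurable_fdWeight.aestronglyMeasurable (.of_forall fun z ↦ ?_)
  rw [Real.norm_of_nonneg (fdWeight_nonneg z)]
  exact fdWeight_le z

end EigenformL
end

/-! ### Integer matrices of determinant n: slash action, adjugates, representatives. -/

noncomputable section
namespace EigenformL

open Filter Topology MeasureTheory ModularGroup UpperHalfPlane ModularForm
open scoped ENNReal ComplexConjugate

instance countable_fixedDetMatrix (n : ℤ) : Countable (FixedDetMatrix (Fin 2) ℤ n) := by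
  have : Countable (Matrix (Fin 2) (Fin 2) ℤ) := inferInstanceAs (Countable (Fin 2 → Fin 2 → ℤ))
  exact Subtype.countable

variable {n : ℕ} [NeZero n]

/-- An integer matrix of determinant `n > 0` as an element of `GL₂(ℝ)`. -/
def detToGL (A : FixedDetMatrix (Fin 2) ℤ n) : GL (Fin 2) ℝ :=
  Matrix.GeneralLinearGroup.mkOfDetNeZero (A.1.map (Int.cast : ℤ → ℝ)) (by
    have h := (Int.castRingHom ℝ).map_det A.1
    rw [A.2] at h
    have h' : (A.1.map (Int.cast : ℤ → ℝ)).det = n := by simpa using h.symm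
    rw [h']
    exact Nat.cast_ne_zero.mpr (NeZero.ne n))

theorem detToGL_apply (A : FixedDetMatrix (Fin 2) ℤ n) (i j : Fin 2) :
    detToGL A i j = (A.1 i j : ℝ) := rfl

theorem coe_detToGL (A : FixedDetMatrix (Fin 2) ℤ n) :
    (detToGL A : Matrix (Fin 2) (Fin 2) ℝ) = A.1.map (Int.cast : ℤ → ℝ) := rfl

theorem det_detToGL (A : FixedDetMatrix (Fin 2) ℤ n) : (detToGL A).det.val = n := by
  have h := (Int.castRingHom ℝ).map_det A.1
  rw [A.2] at h
  rw [Matrix.GeneralLinearGroup.val_det_apply, coe_detToGL]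
  simpa using h.symm

theorem detToGL_smul (g : SL(2, ℤ)) (A : FixedDetMatrix (Fin 2) ℤ n) :
    detToGL (g • A) = (g : GL (Fin 2) ℝ) * detToGL A := by
  ext i j
  rw [detToGL_apply, FixedDetMatrices.smul_coe]
  fin_cases i <;> fin_cases j <;> simp [Matrix.mul_apply, Fin.sum_univ_two, detToGL_apply]

/-- The adjugate, as an involution of the integer matrices of determinant `n`. -/
def adjugateEquiv (n : ℕ) : FixedDetMatrix (Fin 2) ℤ n ≃ FixedDetMatrix (Fin 2) ℤ n where
  toFun A := ⟨A.1.adjugate, by rw [Matrix.det_adjugate, A.2]; simp⟩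
  invFun A := ⟨A.1.adjugate, by rw [Matrix.det_adjugate, A.2]; simp⟩
  left_inv A := by
    apply FixedDetMatrices.ext'
    simp [Matrix.adjugate_fin_two]
    exact (Matrix.eta_fin_two A.1).symm
  right_inv A := by
    apply FixedDetMatrices.ext'
    simp [Matrix.adjugate_fin_two]
    exact (Matrix.eta_fin_two A.1).symm

theorem detToGL_adjugate_mul (A : FixedDetMatrix (Fin 2) ℤ n) :
    (detToGL (adjugateEquiv n A) * detToGL A : GL (Fin 2) ℝ) =
      Matrix.GeneralLinearGroup.scalar (Fin 2)
        (Units.mk0 (n : ℝ) (Nat.cast_ne_zero.mpr (NeZero.ne n))) := by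
  apply Units.ext
  have h : (A.1.adjugate * A.1) = (n : ℤ) • (1 : Matrix (Fin 2) (Fin 2) ℤ) := by
    rw [Matrix.adjugate_mul, A.2]
  have h2 := congrArg (fun M : Matrix (Fin 2) (Fin 2) ℤ ↦ M.map (Int.castRingHom ℝ)) h
  simp only [Matrix.map_mul] at h2
  refine Eq.trans h2 ?_
  ext i j
  rw [Matrix.map_apply, Matrix.smul_apply, Matrix.one_apply]
  fin_cases i <;> fin_cases j <;> simp [Matrix.GeneralLinearGroup.scalar, Matrix.natCast_apply]

theorem adjugate_smul_smul (A : FixedDetMatrix (Fin 2) ℤ n) (z : ℍ) :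
    detToGL (adjugateEquiv n A) • detToGL A • z = z := by
  rw [← mul_smul, detToGL_adjugate_mul]
  exact UpperHalfPlane.glScalar_smul _ _

theorem sigma_detToGL (A : FixedDetMatrix (Fin 2) ℤ n) (w : ℂ) : σ (detToGL A) w = w := by
  have : 0 < (detToGL A).det.val := by
    rw [det_detToGL]
    exact_mod_cast NeZero.pos n
  rw [σ, if_pos this]
  rfl

theorem slash_detToGL_apply (k : ℤ) (f : ℍ → ℂ) (A : FixedDetMatrix (Fin 2) ℤ n) (z : ℍ) :
    (f ∣[k] detToGL A) z =
      f (detToGL A • z) * (n : ℂ) ^ (k - 1) * denom (detToGL A) z ^ (-k) := by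
  rw [ModularForm.slash_apply, sigma_detToGL, det_detToGL]
  simp

/-- The product of the adjugate and A is the scalar n. The two determinant factors give n^(2(k - 1))
and the automorphy factor gives n^(-k). -/
theorem slash_adjugate_slash (k : ℤ) (f : ℍ → ℂ) (A : FixedDetMatrix (Fin 2) ℤ n) :
    (f ∣[k] detToGL (adjugateEquiv n A)) ∣[k] detToGL A = (n : ℂ) ^ (k - 2) • f := by
  have hn : (n : ℂ) ≠ 0 := Nat.cast_ne_zero.mpr (NeZero.ne n)
  ext z
  have hden : denom (detToGL (adjugateEquiv n A)) (detToGL A • z : ℍ) * denom (detToGL A) z =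
      n := by
    have h := denom_cocycle_σ (detToGL (adjugateEquiv n A)) (detToGL A) z
    rw [detToGL_adjugate_mul, sigma_detToGL, denom_scalar] at h
    simpa using h.symm
  rw [slash_detToGL_apply, slash_detToGL_apply, adjugate_smul_smul, Pi.smul_apply, smul_eq_mul]
  calc _ = f z * ((n : ℂ) ^ (k - 1) * (n : ℂ) ^ (k - 1)) *
        (denom (detToGL (adjugateEquiv n A)) (detToGL A • z : ℍ) * denom (detToGL A) z) ^ (-k) := by
        rw [mul_zpow]; ring
    _ = _ := by
      rw [hden, mul_assoc, ← zpow_add₀ hn, ← zpow_add₀ hn, mul_comm]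
      congr 2
      ring

/-- The adjoint of the slash action of `A` is that of its adjugate. -/
theorem petersson_slash_detToGL (k : ℤ) (f : ℍ → ℂ) (A : FixedDetMatrix (Fin 2) ℤ n) (z : ℍ) :
    petersson k (f ∣[k] detToGL A) f z =
      petersson k f (f ∣[k] detToGL (adjugateEquiv n A)) (detToGL A • z) := by
  have hn : (n : ℂ) ≠ 0 := Nat.cast_ne_zero.mpr (NeZero.ne n)
  have h := petersson_slash k f (f ∣[k] detToGL (adjugateEquiv n A)) (detToGL A) z
  rw [slash_adjugate_slash, sigma_detToGL, det_detToGL] at h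
  have h2 : petersson k (f ∣[k] detToGL A) ((n : ℂ) ^ (k - 2) • f) z =
      (n : ℂ) ^ (k - 2) * petersson k (f ∣[k] detToGL A) f z := by
    simp only [petersson, Pi.smul_apply, smul_eq_mul]
    ring
  rw [h2] at h
  refine mul_left_cancel₀ (zpow_ne_zero (k - 2) hn) (h.trans ?_)
  simp

/-- Every integer matrix of determinant `n` factors uniquely through a representative. -/
def repsEquiv (n : ℕ) [NeZero n] :
    FixedDetMatrices.reps (n : ℤ) × SL(2, ℤ) ≃ FixedDetMatrix (Fin 2) ℤ n :=
  Equiv.ofBijective (fun p ↦ p.2 • (p.1 : FixedDetMatrix (Fin 2) ℤ n)) <| by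
    constructor
    · rintro ⟨⟨r, hr⟩, g⟩ ⟨⟨r', hr'⟩, g'⟩ h
      have h1 : (g'⁻¹ * g) • r = r' := by
        rw [mul_smul, inv_smul_eq_iff]
        exact h
      -- d carries one representative to the other. The zero lower left entries make d upper
      -- triangular, positivity of the upper left entries makes its diagonal 1, and the range of the
      -- upper right entries makes its last entry 0.
      set d := g'⁻¹ * g with hd
      have h2 (i j : Fin 2) : d i 0 * r.1 0 j + d i 1 * r.1 1 j = r'.1 i j := by
        rw [← h1, FixedDetMatrices.smul_coe, Matrix.mul_apply, Fin.sum_univ_two]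
      have hdet : d 0 0 * d 1 1 - d 0 1 * d 1 0 = 1 := by
        have := d.det_coe
        rwa [Matrix.det_fin_two] at this
      obtain ⟨a1, a2, a3, a4⟩ := hr
      obtain ⟨b1, b2, b3, b4⟩ := hr'
      have c00 := h2 0 0
      have c10 := h2 1 0
      have c01 := h2 0 1
      have c11 := h2 1 1
      rw [a1, mul_zero, add_zero] at c00 c10
      rw [b1] at c10
      have hc : d 1 0 = 0 := (mul_eq_zero.mp c10).resolve_right a2.ne'
      rw [hc, mul_zero, sub_zero] at hdet
      have ha : d 0 0 = 1 := by
        rcases Int.eq_one_or_neg_one_of_mul_eq_one hdet with h | h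
        · exact h
        · rw [h] at c00
          linarith
      have hdd : d 1 1 = 1 := by rw [ha, one_mul] at hdet; exact hdet
      rw [ha, one_mul] at c01
      rw [hc, hdd, zero_mul, one_mul, zero_add] at c11
      have hb : d 0 1 = 0 := by
        by_contra hne
        rw [← c11] at b4
        have e1 : |r'.1 0 1 - r.1 0 1| < |r.1 1 1| := by
          rw [abs_of_nonneg a3] at a4
          rw [abs_of_nonneg b3] at b4
          rw [abs_lt]
          constructor <;> linarith
        rw [← c01, add_sub_cancel_left, abs_mul] at e1
        have e2 : 1 ≤ |d 0 1| := Int.one_le_abs hne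
        nlinarith [abs_nonneg (r.1 1 1)]
      have hd1 : d = 1 := by
        ext i j
        fin_cases i <;> fin_cases j <;> simp [ha, hb, hc, hdd]
      have hg : g = g' := by
        rw [hd1, eq_comm, inv_mul_eq_one] at hd
        exact hd.symm
      rw [hd1, one_smul] at h1
      subst h1 hg
      rfl
    · intro A
      have hn : (n : ℤ) ≠ 0 := by exact_mod_cast NeZero.ne n
      refine FixedDetMatrices.induction_on
        (C := fun A ↦ ∃ p : FixedDetMatrices.reps (n : ℤ) × SL(2, ℤ),
          p.2 • (p.1 : FixedDetMatrix (Fin 2) ℤ n) = A) hn ?_ ?_ ?_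
      · intro A h1 h2 h3 h4
        exact ⟨⟨⟨A, h1, h2, h3, h4⟩, 1⟩, one_smul _ _⟩
      · rintro _ ⟨p, rfl⟩
        exact ⟨⟨p.1, S * p.2⟩, mul_smul _ _ _⟩
      · rintro _ ⟨p, rfl⟩
        exact ⟨⟨p.1, T * p.2⟩, mul_smul _ _ _⟩

end EigenformL
end

/-! ### Self-adjointness for the Petersson product: eigenvalues are real. -/

noncomputable section
namespace EigenformL

open Filter Topology MeasureTheory ModularGroup UpperHalfPlane ModularForm
open scoped ENNReal ComplexConjugate

section

variable {n : ℕ} [NeZero n] {k : ℤ} (f : CuspForm 𝒮ℒ k)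

theorem continuous_slash_detToGL (A : FixedDetMatrix (Fin 2) ℤ n) :
    Continuous (⇑f ∣[k] detToGL A) := by
  have h : (⇑f ∣[k] detToGL A) = fun z ↦
      f (detToGL A • z) * (n : ℂ) ^ (k - 1) * denom (detToGL A) z ^ (-k) :=
    funext (slash_detToGL_apply k f A)
  rw [h]
  have hf : Continuous f := ModularFormClass.continuous f
  have hden : Continuous fun z : ℍ ↦ denom (detToGL A) z := by
    simp only [denom]
    fun_prop
  exact ((hf.comp (continuous_const_smul _)).mul continuous_const).mul
    (hden.zpow₀ _ fun z ↦ .inl (denom_ne_zero _ z))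

theorem slash_smul_eq (g : SL(2, ℤ)) (A : FixedDetMatrix (Fin 2) ℤ n) :
    (⇑f ∣[k] detToGL (g • A)) = ⇑f ∣[k] detToGL A := by
  rw [detToGL_smul, SlashAction.slash_mul]
  congr 1
  exact SlashInvariantFormClass.slash_action_eq f _ ⟨g, rfl⟩

/-- The product of the absolute values of f and f|A is at most the sum of their squares, and y^k
times either square is bounded because f is a cusp form. -/
theorem exists_petersson_slash_le (A : FixedDetMatrix (Fin 2) ℤ n) :
    ∃ C : ℝ, ∀ z, ‖petersson k f (⇑f ∣[k] detToGL A) z‖ ≤ C := by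
  obtain ⟨C, hC⟩ := CuspFormClass.petersson_bounded_left k 𝒮ℒ f f
  refine ⟨C + (n : ℝ) ^ (k - 2) * C, fun z ↦ ?_⟩
  have h1 := hC z
  have h2 := hC (detToGL A • z)
  have h3 := congrArg norm (petersson_slash k f f (detToGL A) z)
  rw [sigma_detToGL, det_detToGL] at h3
  have h4 : ‖petersson k (⇑f ∣[k] detToGL A) (⇑f ∣[k] detToGL A) z‖ ≤ (n : ℝ) ^ (k - 2) * C := by
    rw [h3, norm_mul]
    refine mul_le_mul (le_of_eq ?_) h2 (norm_nonneg _) (by positivity)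
    simp
  refine le_trans ?_ (add_le_add h1 h4)
  have him : 0 < ‖(z.im : ℂ) ^ k‖ := norm_pos_iff.mpr (zpow_ne_zero _ (by simpa using z.im_ne_zero))
  simp only [petersson, norm_mul, RCLike.norm_conj]
  rw [← add_mul]
  gcongr
  nlinarith [sq_nonneg (‖f z‖ - ‖(⇑f ∣[k] detToGL A) z‖), norm_nonneg (f z),
    norm_nonneg ((⇑f ∣[k] detToGL A) z)]

theorem integrable_petersson_slash (A : FixedDetMatrix (Fin 2) ℤ n) :
    Integrable fun z ↦ petersson k f (⇑f ∣[k] detToGL A) z * fdWeight z := by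
  obtain ⟨C, hC⟩ := exists_petersson_slash_le f A
  refine (integrable_fdWeight.ofReal (𝕜 := ℂ)).bdd_mul ?_ (.of_forall hC)
  exact (petersson_continuous k (ModularFormClass.continuous f)
    (continuous_slash_detToGL f A)).aestronglyMeasurable

/-- The contribution of `A` to the symmetric double coset sum. -/
def cosetIntegral (A : FixedDetMatrix (Fin 2) ℤ n) : ℂ :=
  ∫ z, petersson k f (⇑f ∣[k] detToGL A) z * fdWeight z * fdWeight (detToGL A • z)

theorem integrable_cosetIntegrand (A : FixedDetMatrix (Fin 2) ℤ n) (g : GL (Fin 2) ℝ) :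
    Integrable fun z ↦ petersson k f (⇑f ∣[k] detToGL A) z * fdWeight z * fdWeight (g • z) := by
  refine (integrable_petersson_slash f A).mul_bdd (c := 1) ?_ (.of_forall fun z ↦ ?_)
  · exact (Complex.measurable_ofReal.comp (measurable_fdWeight.comp
      (continuous_const_smul g).measurable)).aestronglyMeasurable
  · rw [Complex.norm_real, Real.norm_of_nonneg (fdWeight_nonneg _)]
    exact fdWeight_le_one _

/-- Substituting Az for z in the invariant measure exchanges the two weights and replaces A by its
adjugate. Weighting both z and Az is what makes the integral symmetric. -/
theorem conj_cosetIntegral (A : FixedDetMatrix (Fin 2) ℤ n) :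
    conj (cosetIntegral f A) = cosetIntegral f (adjugateEquiv n A) := by
  rw [cosetIntegral, cosetIntegral, ← integral_conj]
  refine Eq.trans (integral_congr_ae (.of_forall fun z ↦ ?_))
    (integral_smul_eq_self _ (g := detToGL A))
  simp only [map_mul, Complex.conj_ofReal]
  rw [← petersson_symm, petersson_slash_detToGL, adjugate_smul_smul]
  ring

/-- Unfolding: f|A depends only on the left SL₂(ℤ)-orbit of A, and the weights at the translates of
rz sum to 1. -/
theorem hasSum_cosetIntegral (r : FixedDetMatrix (Fin 2) ℤ n) :
    (Summable fun g : SL(2, ℤ) ↦ ‖cosetIntegral f (g • r)‖) ∧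
      HasSum (fun g : SL(2, ℤ) ↦ cosetIntegral f (g • r))
        (∫ z, petersson k f (⇑f ∣[k] detToGL r) z * fdWeight z) := by
  set F : SL(2, ℤ) → ℍ → ℂ := fun g z ↦
    petersson k f (⇑f ∣[k] detToGL r) z * fdWeight z * fdWeight (g • detToGL r • z) with hF
  have hFc (g : SL(2, ℤ)) : cosetIntegral f (g • r) = ∫ z, F g z := by
    rw [cosetIntegral, slash_smul_eq, detToGL_smul]
    simp only [mul_smul]
    rfl
  have hint (g : SL(2, ℤ)) : Integrable (F g) := by
    have := integrable_cosetIntegrand f r ((g : GL (Fin 2) ℝ) * detToGL r)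
    simp only [mul_smul] at this
    exact this
  have hP := integrable_petersson_slash f r
  have hsum : Summable fun g ↦ ∫ z, ‖F g z‖ := by
    refine summable_of_sum_le (c := ∫ z, ‖petersson k f (⇑f ∣[k] detToGL r) z * fdWeight z‖)
      (fun g ↦ integral_nonneg fun z ↦ norm_nonneg _) fun u ↦ ?_
    rw [← integral_finsetSum _ fun g _ ↦ (hint g).norm]
    refine integral_mono (integrable_finsetSum _ fun g _ ↦ (hint g).norm) hP.norm fun z ↦ ?_
    have hle : ∑ g ∈ u, fdWeight (g • detToGL r • z) ≤ 1 :=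
      sum_le_hasSum u (fun g _ ↦ fdWeight_nonneg _) (hasSum_fdWeight_smul (detToGL r • z))
    simp only [hF, norm_mul, Complex.norm_real, Real.norm_of_nonneg (fdWeight_nonneg _)]
    rw [← Finset.mul_sum]
    exact mul_le_of_le_one_right (mul_nonneg (norm_nonneg _) (fdWeight_nonneg _)) hle
  have h := hasSum_integral_of_summable_integral_norm hint hsum
  simp only [hFc]
  refine ⟨hsum.of_nonneg_of_le (fun g ↦ norm_nonneg _) fun g ↦ norm_integral_le_integral_norm _, ?_⟩
  convert! h using 1
  refine integral_congr_ae (.of_forall fun z ↦ ?_)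
  simp only [hF]
  rw [tsum_mul_left, ← Complex.ofReal_tsum, (hasSum_fdWeight_smul (detToGL r • z)).tsum_eq]
  simp

instance fintype_reps : Fintype (FixedDetMatrices.reps (n : ℤ)) := FixedDetMatrices.repsFintype n

theorem tsum_cosetIntegral :
    ∑' A : FixedDetMatrix (Fin 2) ℤ n, cosetIntegral f A =
      ∑ r : FixedDetMatrices.reps (n : ℤ),
        ∫ z, petersson k f (⇑f ∣[k] detToGL r.1) z * fdWeight z := by
  have hs : Summable fun p : FixedDetMatrices.reps (n : ℤ) × SL(2, ℤ) ↦
      cosetIntegral f (p.2 • (p.1 : FixedDetMatrix (Fin 2) ℤ n)) := by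
    refine .of_norm ?_
    rw [summable_prod_of_nonneg fun p ↦ norm_nonneg _]
    exact ⟨fun r ↦ (hasSum_cosetIntegral f r.1).1, (hasSum_fintype _).summable⟩
  have h1 := (repsEquiv n).tsum_eq (cosetIntegral f)
  rw [← h1]
  change ∑' p : FixedDetMatrices.reps (n : ℤ) × SL(2, ℤ),
    cosetIntegral f (p.2 • (p.1 : FixedDetMatrix (Fin 2) ℤ n)) = _
  rw [hs.tsum_prod' fun r ↦ (hasSum_cosetIntegral f r.1).2.summable, tsum_fintype]
  exact Finset.sum_congr rfl fun r _ ↦ (hasSum_cosetIntegral f r.1).2.tsum_eq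

/-- Conjugation permutes the summands, because the adjugate is an involution of the index set. -/
theorem conj_tsum_cosetIntegral :
    conj (∑' A : FixedDetMatrix (Fin 2) ℤ n, cosetIntegral f A) =
      ∑' A : FixedDetMatrix (Fin 2) ℤ n, cosetIntegral f A := by
  rw [Complex.conj_tsum]
  simp only [conj_cosetIntegral]
  exact (adjugateEquiv n).tsum_eq (cosetIntegral f)

end

theorem petersson_self {k : ℤ} (f : ℍ → ℂ) (z : ℍ) :
    petersson k f f z = ((‖f z‖ ^ 2 * z.im ^ k : ℝ) : ℂ) := by
  rw [petersson, mul_comm (conj (f z)), Complex.mul_conj, Complex.normSq_eq_norm_sq]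
  push_cast
  rfl

theorem volume_pos_of_isOpen {U : Set ℍ} (hU : IsOpen U) (hne : U.Nonempty) : volume U ≠ 0 := by
  intro h
  rw [volume_eq_lintegral, lintegral_eq_zero_iff (by fun_prop)] at h
  have hop : IsOpen (UpperHalfPlane.coe '' U) := isOpenEmbedding_coe.isOpenMap _ hU
  have h2 : volume (UpperHalfPlane.coe '' U) = 0 := by
    have h3 := (ae_restrict_iff' hop.measurableSet).mp h
    refine measure_mono_null ?_ h3
    rintro _ ⟨z, hz, rfl⟩ hmem
    have := hmem ⟨z, hz, rfl⟩
    simp [z.im_ne_zero] at this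
  exact (hop.measure_pos volume (hne.image _)).ne' h2

/-- The Petersson norm of a nonzero cusp form is positive. -/
theorem petersson_norm_pos {k : ℤ} (f : CuspForm 𝒮ℒ k) (hf : ∃ τ, f τ ≠ 0) :
    0 < ∫ z, ‖f z‖ ^ 2 * z.im ^ k * fdWeight z := by
  have hcont : Continuous f := ModularFormClass.continuous f
  have hnn (z : ℍ) : 0 ≤ ‖f z‖ ^ 2 * z.im ^ k * fdWeight z :=
    mul_nonneg (mul_nonneg (by positivity) (zpow_nonneg z.im_pos.le k)) (fdWeight_nonneg z)
  have hint : Integrable fun z : ℍ ↦ ‖f z‖ ^ 2 * z.im ^ k * fdWeight z := by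
    obtain ⟨C, hC⟩ := CuspFormClass.petersson_bounded_left k 𝒮ℒ f f
    refine integrable_fdWeight.bdd_mul (c := C) ?_ (.of_forall fun z ↦ ?_)
    · refine Continuous.aestronglyMeasurable ((hcont.norm.pow 2).mul ?_)
      exact UpperHalfPlane.continuous_im.zpow₀ _ fun z ↦ .inl z.im_ne_zero
    · have := hC z
      rwa [petersson_self, Complex.norm_real] at this
  refine lt_of_le_of_ne (integral_nonneg hnn) fun h ↦ ?_
  rw [eq_comm, integral_eq_zero_iff_of_nonneg hnn hint] at h
  have hzero : ∀ z ∈ fdo, f z = 0 := by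
    intro z hz
    by_contra hne
    have hU : IsOpen (fdo ∩ {z | f z ≠ 0}) :=
      isOpen_fdo.inter (isOpen_ne_fun hcont continuous_const)
    refine volume_pos_of_isOpen hU ⟨z, hz, hne⟩ (measure_mono_null ?_ h)
    rintro w ⟨hw, hfw⟩ hw0
    have : 0 < ‖f w‖ ^ 2 * w.im ^ k * fdWeight w :=
      mul_pos (mul_pos (by positivity) (zpow_pos w.im_pos k)) (fdWeight_pos (fdo_subset_fd hw))
    exact this.ne' hw0
  have hzero' : ∀ z ∈ fd, f z = 0 := by
    intro z hz
    rw [fd_eq_closure_fdo] at hz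
    exact (isClosed_eq hcont continuous_const).closure_subset_iff.mpr hzero hz
  obtain ⟨τ, hτ⟩ := hf
  obtain ⟨g, hg⟩ := exists_smul_mem_fd τ
  have h1 := SlashInvariantForm.slash_action_eqn'' f
    (show (g : GL (Fin 2) ℝ) ∈ 𝒮ℒ from ⟨g, rfl⟩) τ
  have h2 : f ((g : GL (Fin 2) ℝ) • τ) = 0 := hzero' _ hg
  rw [h2, eq_comm, mul_eq_zero] at h1
  exact h1.elim (zpow_ne_zero _ (denom_ne_zero _ _)) hτ

/-- An eigenvalue of `∑ f ∣ r`, over representatives of the matrices of determinant `n`, is real. -/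
theorem conj_eigenvalue {n : ℕ} [NeZero n] {k : ℤ} (f : CuspForm 𝒮ℒ k) (hf : ∃ τ, f τ ≠ 0) {c : ℂ}
    (hc : ∀ τ, ∑ r : FixedDetMatrices.reps (n : ℤ), (⇑f ∣[k] detToGL r.1) τ = c * f τ) :
    conj c = c := by
  -- Evaluated through the eigenvalue equation, the double coset sum is c times the squared
  -- Petersson norm. It is also real and the norm is positive, so c is real.
  have h1 : ∑ r : FixedDetMatrices.reps (n : ℤ),
        ∫ z, petersson k f (⇑f ∣[k] detToGL r.1) z * fdWeight z =
      c * ((∫ z, ‖f z‖ ^ 2 * z.im ^ k * fdWeight z : ℝ) : ℂ) := by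
    rw [← integral_finsetSum _ fun r _ ↦ integrable_petersson_slash f r.1,
      ← integral_complex_ofReal,
      ← integral_const_mul]
    refine integral_congr_ae (.of_forall fun z ↦ ?_)
    have h2 := petersson_self (k := k) f z
    simp only [petersson] at h2 ⊢
    rw [← Finset.sum_mul, ← Finset.sum_mul, ← Finset.mul_sum, hc, Complex.ofReal_mul, ← h2]
    ring
  have h2 := conj_tsum_cosetIntegral (n := n) f
  rw [tsum_cosetIntegral, h1, map_mul, Complex.conj_ofReal] at h2
  exact mul_right_cancel₀ (Complex.ofReal_ne_zero.mpr (petersson_norm_pos f hf).ne') h2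

end EigenformL
end

/-! ### Hecke operators as sums over representatives of determinant n. -/

noncomputable section
namespace EigenformL

open Filter Topology MeasureTheory ModularGroup UpperHalfPlane ModularForm
open scoped ENNReal ComplexConjugate

/-- The representative `(a b; 0 d)` of determinant `n = a d`. -/
def upperRep (n : ℕ) {d : ℕ} (hd : d ∣ n) (b : ℕ) : FixedDetMatrix (Fin 2) ℤ n :=
  ⟨!![((n / d : ℕ) : ℤ), (b : ℤ); 0, (d : ℤ)], by
    rw [Matrix.det_fin_two_of, mul_zero, sub_zero]
    exact_mod_cast Nat.div_mul_cancel hd⟩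

theorem slash_upperRep (k : ℤ) (n : ℕ) [NeZero n] {d : ℕ} (hd : d ∣ n) (b : ℕ) (f : ℍ → ℂ) (τ : ℍ) :
    (f ∣[k] detToGL (upperRep n hd b)) τ = (n : ℂ) ^ (k - 1) * ((d : ℂ) ^ (-k) *
      f (ofComplex ((((n / d : ℕ) : ℂ) * (τ : ℂ) + (b : ℂ)) / (d : ℂ)))) := by
  have hpos : 0 < (detToGL (upperRep n hd b)).det.val := by
    rw [det_detToGL]
    exact_mod_cast NeZero.pos n
  have hden : denom (detToGL (upperRep n hd b)) (τ : ℂ) = d := by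
    change (((0 : ℤ) : ℝ) : ℂ) * τ + (((d : ℤ) : ℝ) : ℂ) = d
    simp
  have hnum : num (detToGL (upperRep n hd b)) (τ : ℂ) = ((n / d : ℕ) : ℂ) * τ + b := by
    change ((((n / d : ℕ) : ℤ) : ℝ) : ℂ) * τ + (((b : ℤ) : ℝ) : ℂ) = _
    simp only [Int.cast_natCast, Complex.ofReal_natCast]
  have hsmul : ofComplex ((((n / d : ℕ) : ℂ) * (τ : ℂ) + (b : ℂ)) / (d : ℂ)) =
      detToGL (upperRep n hd b) • τ := by
    rw [← hnum, ← hden, ← coe_smul_of_det_pos hpos, ofComplex_apply]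
  rw [slash_detToGL_apply, hsmul, hden]
  ring

/-- The representatives are in Hermite normal form, so they are parametrized by ad = n and 0 ≤ b <
d, as in the classical definition. -/
theorem heckeOp_eq_sum_reps (k : ℤ) (n : ℕ) [NeZero n] (f : ℍ → ℂ) (τ : ℍ) :
    heckeOp k n f τ = ∑ r : FixedDetMatrices.reps (n : ℤ), (f ∣[k] detToGL r.1) τ := by
  have hmem {d b : ℕ} (hd : d ∣ n) (hb : b < d) :
      upperRep n hd b ∈ FixedDetMatrices.reps (n : ℤ) := by
    refine ⟨rfl, ?_, ?_, ?_⟩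
    · change (0 : ℤ) < ((n / d : ℕ) : ℤ)
      exact_mod_cast Nat.div_pos (Nat.le_of_dvd (NeZero.pos n) hd) (by omega)
    · exact Int.natCast_nonneg b
    · change |(b : ℤ)| < |(d : ℤ)|
      rw [abs_of_nonneg (Int.natCast_nonneg b), abs_of_nonneg (Int.natCast_nonneg d)]
      exact_mod_cast hb
  rw [heckeOp, Finset.mul_sum]
  simp_rw [Finset.mul_sum]
  rw [Finset.sum_sigma']
  have hp' (p : (_ : ℕ) × ℕ) (hp : p ∈ n.divisors.sigma Finset.range) :
      p.1 ∣ n ∧ p.2 < p.1 := by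
    simp only [Finset.mem_sigma, Nat.mem_divisors, Finset.mem_range] at hp
    exact ⟨hp.1.1, hp.2⟩
  refine Finset.sum_bij (fun p hp ↦ ⟨upperRep n (hp' p hp).1 p.2,
    hmem (hp' p hp).1 (hp' p hp).2⟩) ?_ ?_ ?_ ?_
  · simp
  · rintro ⟨d, b⟩ hp ⟨d', b'⟩ hp' h
    have h1 := congrArg (fun r : FixedDetMatrices.reps (n : ℤ) ↦ r.1.1) h
    have hd : (d : ℤ) = d' := congrFun (congrFun h1 1) 1
    have hb : (b : ℤ) = b' := congrFun (congrFun h1 0) 1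
    obtain rfl : d = d' := by exact_mod_cast hd
    obtain rfl : b = b' := by exact_mod_cast hb
    rfl
  · rintro ⟨r, h10, h00, h01, h11⟩ -
    have hdet := r.2
    rw [Matrix.det_fin_two, h10, mul_zero, sub_zero] at hdet
    have hn : (0 : ℤ) < n := by exact_mod_cast NeZero.pos n
    have hd : 0 < r.1 1 1 := by
      by_contra! hle
      nlinarith
    obtain ⟨d, hd'⟩ := Int.eq_ofNat_of_zero_le hd.le
    obtain ⟨b, hb'⟩ := Int.eq_ofNat_of_zero_le h01
    obtain ⟨a, ha'⟩ := Int.eq_ofNat_of_zero_le h00.le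
    rw [hb', hd', abs_of_nonneg (Int.natCast_nonneg b),
      abs_of_nonneg (Int.natCast_nonneg d)] at h11
    rw [ha', hd'] at hdet
    have hdet' : a * d = n := by exact_mod_cast hdet
    have hdn : d ∣ n := ⟨a, by rw [← hdet', mul_comm]⟩
    have hdpos : 0 < d := by rw [hd'] at hd; exact_mod_cast hd
    refine ⟨⟨d, b⟩, ?_, ?_⟩
    · simp only [Finset.mem_sigma, Nat.mem_divisors, Finset.mem_range]
      exact ⟨⟨hdn, NeZero.ne n⟩, by exact_mod_cast h11⟩
    · apply Subtype.ext
      apply FixedDetMatrices.ext'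
      have hnd : n / d = a := by rw [← hdet', Nat.mul_div_cancel _ hdpos]
      rw [Matrix.eta_fin_two r.1, h10, ha', hb', hd']
      simp [upperRep, hnd]
  · rintro ⟨d, b⟩ hp
    exact (slash_upperRep k n (hp' _ hp).1 b f τ).symm

theorem conj_heckeEigenvalue {n : ℕ} (hn : 0 < n) {k : ℤ} (f : CuspForm 𝒮ℒ k)
    (hf : ∃ τ, f τ ≠ 0) {c : ℂ} (hc : ∀ τ : ℍ, heckeOp k n f τ = c * f τ) : conj c = c := by
  have : NeZero n := ⟨hn.ne'⟩
  exact conj_eigenvalue f hf fun τ ↦ by rw [← hc, heckeOp_eq_sum_reps]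

end EigenformL
end

/-! ### Hecke relations at primes and reality of the Fourier coefficients. -/

noncomputable section
namespace EigenformL

open Filter Topology UpperHalfPlane ModularForm Function
open scoped ComplexConjugate

/-- The `n`-th Fourier coefficient. -/
def fourierCoefficient {k : ℤ} (f : CuspForm 𝒮ℒ k) (n : ℕ) : ℂ := (qExpansion 1 f).coeff n

variable {k : ℤ} (f : CuspForm 𝒮ℒ k)

theorem fourierCoefficient_zero : fourierCoefficient f 0 = 0 :=
  CuspFormClass.qExpansion_coeff_zero f one_pos one_mem_strictPeriods_SL

theorem hasSum_fourierCoefficient (τ : ℍ) :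
    HasSum (fun m ↦ fourierCoefficient f m * Complex.exp (2 * Real.pi * Complex.I * τ) ^ m)
      (f τ) := by
  simpa [Periodic.qParam] using! ModularForm.hasSum_qExpansion f one_pos
    one_mem_strictPeriods_SL τ

/-- Uniqueness of the power series at 0 of the cusp function of c f. -/
theorem eq_of_hasSum_smul {c : ℂ} {b : ℕ → ℂ}
    (h : ∀ τ : ℍ, HasSum (fun m ↦ b m * Complex.exp (2 * Real.pi * Complex.I * τ) ^ m)
      (c * f τ)) (m : ℕ) : b m = c * fourierCoefficient f m := by
  have han := ModularFormClass.analyticAt_cuspFunction_zero f one_pos one_mem_strictPeriods_SL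
  have han' : AnalyticAt ℂ (cuspFunction 1 (c • ⇑f)) 0 := by
    rw [cuspFunction_smul han.continuousAt]
    exact han.const_smul
  have h1 := hasFPowerSeriesOnBall_cuspFunction one_pos han' (c := b) fun τ ↦ by
    simpa [Periodic.qParam] using h τ
  have h2 := hasFPowerSeriesOnBall_cuspFunction one_pos han'
    (c := fun m ↦ c * fourierCoefficient f m) fun τ ↦ by
      simpa [Periodic.qParam, mul_assoc] using (hasSum_fourierCoefficient f τ).mul_left c
  have h3 := congrArg (fun p : FormalMultilinearSeries ℂ ℂ ℂ ↦ p.coeff m)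
    (h1.hasFPowerSeriesAt.eq_formalMultilinearSeries h2.hasFPowerSeriesAt)
  simpa [FormalMultilinearSeries.coeff_ofScalars] using h3

theorem sum_rootsOfUnity {p : ℕ} (hp : 0 < p) (m : ℕ) :
    ∑ b ∈ Finset.range p, Complex.exp (2 * Real.pi * Complex.I / p) ^ (b * m) =
      if p ∣ m then (p : ℂ) else 0 := by
  have hζ := Complex.isPrimitiveRoot_exp p hp.ne'
  set ζ := Complex.exp (2 * Real.pi * Complex.I / p)
  have h (b : ℕ) : ζ ^ (b * m) = (ζ ^ m) ^ b := by rw [← pow_mul, mul_comm]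
  simp only [h]
  split_ifs with hd
  · simp [(hζ.pow_eq_one_iff_dvd m).mpr hd]
  · have h1 : ζ ^ m ≠ 1 := fun h ↦ hd ((hζ.pow_eq_one_iff_dvd m).mp h)
    rw [geom_sum_eq h1, ← pow_mul, mul_comm, pow_mul, hζ.pow_eq_one, one_pow, sub_self, zero_div]

/-- The terms with d = p average over p-th roots of unity and retain the exponents divisible by p;
the term with d = 1 is a multiple of f(pτ). -/
theorem hasSum_heckeOp {p : ℕ} (hp : p.Prime) (τ : ℍ) :
    HasSum (fun m ↦ (fourierCoefficient f (p * m) + (p : ℂ) ^ (k - 1) *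
      (if p ∣ m then fourierCoefficient f (m / p) else 0)) *
        Complex.exp (2 * Real.pi * Complex.I * τ) ^ m) (heckeOp k p f τ) := by
  have hp0 : (p : ℂ) ≠ 0 := Nat.cast_ne_zero.mpr hp.ne_zero
  have hpR : (0 : ℝ) < p := by exact_mod_cast hp.pos
  have hinj : Injective fun m : ℕ ↦ p * m := fun _ _ h ↦ Nat.eq_of_mul_eq_mul_left hp.pos h
  set q := Complex.exp (2 * Real.pi * Complex.I * τ) with hq
  set r := Complex.exp (2 * Real.pi * Complex.I * (τ / p)) with hr
  set ζ := Complex.exp (2 * Real.pi * Complex.I / p) with hζ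
  have hrq : r ^ p = q := by
    rw [hr, hq, ← Complex.exp_nat_mul]
    congr 1
    field_simp
  -- the contribution of `f (p τ)`
  have h1 : HasSum (fun m ↦ (if p ∣ m then fourierCoefficient f (m / p) else 0) * q ^ m)
      (f (ofComplex (p * τ))) := by
    have him : 0 < ((p : ℂ) * τ).im := by
      simpa using mul_pos hpR τ.im_pos
    have h := hasSum_fourierCoefficient f (ofComplex (p * τ))
    rw [ofComplex_apply_of_im_pos him] at h ⊢
    rw [← hinj.hasSum_iff]
    · convert! h using 2 with m
      have : Complex.exp (2 * Real.pi * Complex.I * ((p : ℂ) * τ)) = q ^ p := by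
        rw [hq, ← Complex.exp_nat_mul]
        congr 1
        ring
      simp only [comp_apply, dvd_mul_right, if_true, Nat.mul_div_cancel_left _ hp.pos]
      rw [UpperHalfPlane.coe_mk, this, ← pow_mul]
    · intro m hm
      have : ¬ p ∣ m := fun ⟨j, hj⟩ ↦ hm ⟨j, hj.symm⟩
      simp [this]
  -- the contribution of `f ((τ + b) / p)`
  have h2 : HasSum (fun m ↦ fourierCoefficient f (p * m) * q ^ m)
      ((p : ℂ)⁻¹ * ∑ b ∈ Finset.range p, f (ofComplex ((τ + b) / p))) := by
    have hb (b : ℕ) : HasSum (fun m ↦ fourierCoefficient f m * (ζ ^ (b * m) * r ^ m))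
        (f (ofComplex ((τ + b) / p))) := by
      have him : 0 < (((τ : ℂ) + b) / p).im := by
        have : ((τ : ℂ) + b) / p = ((τ : ℂ) + b) / (p : ℝ) := by simp
        rw [this, Complex.div_ofReal_im]
        simpa using div_pos τ.im_pos hpR
      have h := hasSum_fourierCoefficient f (ofComplex ((τ + b) / p))
      rw [ofComplex_apply_of_im_pos him] at h ⊢
      convert! h using 2 with m
      have : Complex.exp (2 * Real.pi * Complex.I * (((τ : ℂ) + b) / p)) = ζ ^ b * r := by
        rw [hζ, hr, ← Complex.exp_nat_mul, ← Complex.exp_add]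
        congr 1
        ring
      rw [UpperHalfPlane.coe_mk, this, mul_pow, ← pow_mul]
    have h := (hasSum_sum fun b (_ : b ∈ Finset.range p) ↦ hb b).mul_left (p : ℂ)⁻¹
    rw [← hinj.hasSum_iff] at h
    · convert! h using 2 with m
      simp only [comp_apply]
      rw [← Finset.mul_sum, ← Finset.sum_mul, sum_rootsOfUnity hp.pos,
        if_pos (dvd_mul_right p m), pow_mul, hrq]
      field_simp
    · intro m hm
      have : ¬ p ∣ m := fun ⟨j, hj⟩ ↦ hm ⟨j, hj.symm⟩
      rw [← Finset.mul_sum, ← Finset.sum_mul, sum_rootsOfUnity hp.pos, if_neg this]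
      simp
  have hop : heckeOp k p f τ = (p : ℂ)⁻¹ * ∑ b ∈ Finset.range p, f (ofComplex ((τ + b) / p)) +
      (p : ℂ) ^ (k - 1) * f (ofComplex (p * τ)) := by
    rw [heckeOp, hp.sum_divisors, Nat.div_self hp.pos, Nat.div_one]
    simp only [Nat.cast_one, one_mul, Finset.range_one, Finset.sum_singleton, one_zpow,
      Nat.cast_zero, add_zero, div_one]
    rw [← Finset.mul_sum, mul_add, ← mul_assoc, ← zpow_add₀ hp0]
    congr 2
    rw [show k - 1 + -k = -1 by ring, zpow_neg_one]
  rw [hop]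
  convert! h2.add (h1.mul_left ((p : ℂ) ^ (k - 1))) using 2 with m
  ring

variable {f}

namespace IsNormalizedHeckeEigenform

theorem fourierCoefficient_one (hf : IsNormalizedHeckeEigenform f) : fourierCoefficient f 1 = 1 :=
  hf.coeff_one

/-- Comparing coefficients at m = 1 identifies the eigenvalue of T_p as the p-th coefficient. -/
theorem coeff_prime_mul (hf : IsNormalizedHeckeEigenform f) {p : ℕ} (hp : p.Prime) (m : ℕ) :
    fourierCoefficient f (p * m) + (p : ℂ) ^ (k - 1) *
      (if p ∣ m then fourierCoefficient f (m / p) else 0) =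
      fourierCoefficient f p * fourierCoefficient f m := by
  obtain ⟨c, hc⟩ := hf.eigen p hp.pos
  have h := eq_of_hasSum_smul f (c := c) fun τ ↦ (hc τ) ▸ hasSum_heckeOp f hp τ
  have h1 := h 1
  rw [mul_one, if_neg (by simpa using hp.ne_one), mul_zero, add_zero, hf.fourierCoefficient_one,
    mul_one] at h1
  rw [h m, h1]

theorem conj_coeff_prime (hf : IsNormalizedHeckeEigenform f) {p : ℕ} (hp : p.Prime) :
    conj (fourierCoefficient f p) = fourierCoefficient f p := by
  obtain ⟨c, hc⟩ := hf.eigen p hp.pos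
  have h1 := eq_of_hasSum_smul f (c := c) (fun τ ↦ (hc τ) ▸ hasSum_heckeOp f hp τ) 1
  rw [mul_one, if_neg (by simpa using hp.ne_one), mul_zero, add_zero, hf.fourierCoefficient_one,
    mul_one] at h1
  rw [h1]
  exact conj_heckeEigenvalue hp.pos f hf.ne_zero hc

/-- Splitting off the least prime factor of n, the Hecke relation reduces to prime coefficients and
smaller indices, so reality of the eigenvalues at primes suffices. -/
theorem conj_coeff (hf : IsNormalizedHeckeEigenform f) (n : ℕ) :
    conj (fourierCoefficient f n) = fourierCoefficient f n := by
  induction n using Nat.strong_induction_on with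
  | _ n ih =>
  rcases Nat.lt_or_ge n 2 with hn | hn
  · interval_cases n
    · simp [fourierCoefficient_zero]
    · simp [hf.fourierCoefficient_one]
  have hp := Nat.minFac_prime (n := n) (by omega)
  obtain ⟨m, hm⟩ := Nat.minFac_dvd n
  set p := n.minFac
  have hm0 : 0 < m := by
    rcases Nat.eq_zero_or_pos m with rfl | h
    · omega
    · exact h
  have hmn : m < n := by
    rw [hm]
    exact lt_mul_of_one_lt_left hm0 hp.one_lt
  have h := hf.coeff_prime_mul hp m
  rw [← hm, ← eq_sub_iff_add_eq] at h
  rw [h, map_sub, map_mul, map_mul, hf.conj_coeff_prime hp, ih m hmn, map_zpow₀, map_natCast]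
  congr 2
  split_ifs
  · exact ih _ ((Nat.div_le_self m p).trans_lt hmn)
  · simp

theorem normCoeff_one (hf : IsNormalizedHeckeEigenform f) : normCoeff f 1 = 1 := by
  rw [normCoeff, hf.coeff_one]
  simp

/-- The factor p^(k - 1) is the square of p^((k - 1)/2) and is absorbed by the normalization. -/
theorem normCoeff_prime_mul (hf : IsNormalizedHeckeEigenform f) {p : ℕ} (hp : p.Prime) (m : ℕ) :
    normCoeff f (p * m) + (if p ∣ m then normCoeff f (m / p) else 0) =
      normCoeff f p * normCoeff f m := by
  rcases Nat.eq_zero_or_pos m with rfl | hm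
  · have : (qExpansion 1 f).coeff 0 = 0 := fourierCoefficient_zero f
    simp [normCoeff, this]
  have hp0 : (p : ℂ) ≠ 0 := Nat.cast_ne_zero.mpr hp.ne_zero
  have hpow : ∀ n : ℕ, 0 < n → (n : ℂ) ^ (((k : ℂ) - 1) / 2) ≠ 0 := fun n hn ↦
    (Complex.cpow_ne_zero_iff).mpr (.inl (Nat.cast_ne_zero.mpr hn.ne'))
  have h := hf.coeff_prime_mul hp m
  simp only [fourierCoefficient] at h
  simp only [normCoeff]
  rw [div_mul_div_comm, ← h, Nat.cast_mul, Complex.natCast_mul_natCast_cpow, add_div]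
  congr 1
  split_ifs with hd
  · obtain ⟨j, rfl⟩ := hd
    have hj : 0 < j := Nat.pos_of_mul_pos_left hm
    rw [Nat.mul_div_cancel_left _ hp.pos, Nat.cast_mul, Complex.natCast_mul_natCast_cpow]
    have h2 : (p : ℂ) ^ (k - 1) =
        (p : ℂ) ^ (((k : ℂ) - 1) / 2) * (p : ℂ) ^ (((k : ℂ) - 1) / 2) := by
      rw [← Complex.cpow_add _ _ hp0, add_halves, ← Complex.cpow_intCast]
      push_cast
      rfl
    rw [h2]
    have := hpow p hp.pos
    have := hpow j hj
    field_simp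
  · simp

theorem conj_normCoeff (hf : IsNormalizedHeckeEigenform f) (n : ℕ) :
    conj (normCoeff f n) = normCoeff f n := by
  rcases Nat.eq_zero_or_pos n with rfl | hn
  · have : (qExpansion 1 f).coeff 0 = 0 := fourierCoefficient_zero f
    simp [normCoeff, this]
  have h1 := hf.conj_coeff n
  simp only [fourierCoefficient] at h1
  have h2 : (n : ℂ) ^ (((k : ℂ) - 1) / 2) = (((n : ℝ) ^ (((k : ℝ) - 1) / 2) : ℝ) : ℂ) := by
    rw [ofReal_weight, Complex.ofReal_cpow n.cast_nonneg, Complex.ofReal_natCast]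
  rw [normCoeff, map_div₀, h1, h2, Complex.conj_ofReal]

end IsNormalizedHeckeEigenform

end EigenformL
end

/-! ### Absolute convergence for `re s > 1` from a mean-square bound. -/

noncomputable section
namespace EigenformL

open Filter Topology UpperHalfPlane ModularForm Function MeasureTheory

variable {k : ℤ} (f : CuspForm 𝒮ℒ k)

/-- The restriction of `f` to the horizontal line of height `t`. -/
def horizontal (t x : ℝ) : ℂ := f (ofComplex (x + t * Complex.I))

theorem horizontal_eq {t : ℝ} (ht : 0 < t) (x : ℝ) :
    horizontal f t x = f ⟨x + t * Complex.I, by simpa using ht⟩ := by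
  rw [horizontal, ofComplex_apply_of_im_pos]

theorem continuous_horizontal {t : ℝ} (ht : 0 < t) : Continuous (horizontal f t) := by
  have : horizontal f t = fun x : ℝ ↦ f ⟨x + t * Complex.I, by simpa using ht⟩ :=
    funext (horizontal_eq f ht)
  rw [this]
  exact (ModularFormClass.continuous f).comp (by fun_prop)

theorem fourierCoeffOn_horizontal {t : ℝ} (ht : 0 < t) (n : ℕ) :
    fourierCoeffOn zero_lt_one (horizontal f t) n =
      fourierCoefficient f n * Real.exp (-2 * Real.pi * n * t) := by
  rw [fourierCoeffOn_eq_integral, fourierCoefficient,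
    ModularFormClass.qExpansion_coeff_eq_intervalIntegral f one_pos one_mem_strictPeriods_SL n ht]
  simp only [sub_zero, one_div, inv_one, one_smul, Complex.ofReal_one, one_mul]
  rw [← intervalIntegral.integral_mul_const]
  refine intervalIntegral.integral_congr fun x _ ↦ ?_
  simp only [smul_eq_mul]
  rw [horizontal_eq f ht, fourier_coe_apply, mul_right_comm _ (f _)]
  congr 1
  rw [Periodic.qParam, ← Complex.exp_nat_mul, ← Complex.exp_neg, Complex.ofReal_exp,
    ← Complex.exp_add]
  congr 1
  push_cast
  linear_combination (2 * Real.pi * n * t : ℂ) * Complex.I_sq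

/-- Parseval's identity on the line of height t, with the cusp form bound |f| ≤ C t^(-k/2). -/
theorem norm_sq_fourierCoefficient_sum_le : ∃ C : ℝ, ∀ t : ℝ, 0 < t → ∀ N : ℕ,
    ∑ n ∈ Finset.Icc 1 N, (‖fourierCoefficient f n‖ * Real.exp (-2 * Real.pi * n * t)) ^ 2 ≤
      C / t ^ (k : ℝ) := by
  obtain ⟨C, hC⟩ := CuspFormClass.exists_bound f
  refine ⟨C ^ 2, fun t ht N ↦ ?_⟩
  have hb (x : ℝ) : ‖horizontal f t x‖ ≤ C / t ^ (k / 2 : ℝ) := by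
    rw [horizontal_eq f ht]
    convert! hC _
    simp [UpperHalfPlane.im]
  have hmem : MemLp (horizontal f t) 2 (volume.restrict (Set.Ioc 0 1)) :=
    MemLp.of_bound (continuous_horizontal f ht).aestronglyMeasurable _ (ae_of_all _ hb)
  have h := hasSum_sq_fourierCoeffOn zero_lt_one hmem
  have h1 : (1 - 0 : ℝ)⁻¹ • ∫ x in (0 : ℝ)..1, ‖horizontal f t x‖ ^ 2 ≤ C ^ 2 / t ^ (k : ℝ) := by
    have h2 (x : ℝ) : ‖horizontal f t x‖ ^ 2 ≤ C ^ 2 / t ^ (k : ℝ) := by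
      refine (pow_le_pow_left₀ (norm_nonneg _) (hb x) 2).trans_eq ?_
      rw [div_pow, ← Real.rpow_mul_natCast ht.le]
      norm_num
    have h3 : ∫ x in (0 : ℝ)..1, ‖horizontal f t x‖ ^ 2 ≤ ∫ _ in (0 : ℝ)..1, C ^ 2 / t ^ (k : ℝ) :=
      intervalIntegral.integral_mono_on zero_le_one
        (((continuous_horizontal f ht).norm.pow 2).intervalIntegrable _ _) (by simp)
        fun x _ ↦ h2 x
    simpa using h3
  refine le_trans ?_ h1
  refine le_trans (le_of_eq ?_) (sum_le_hasSum ((Finset.Icc 1 N).map Nat.castEmbedding)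
    (fun _ _ ↦ by positivity) h)
  rw [Finset.sum_map]
  refine Finset.sum_congr rfl fun n _ ↦ ?_
  simp only [Nat.castEmbedding_apply, fourierCoeffOn_horizontal f ht, norm_mul, Complex.norm_real,
    Real.norm_eq_abs, Real.abs_exp]

/-- At height t = 1/N the squared exponential factors are at least exp(-4π) for all n ≤ N. -/
theorem norm_sq_fourierCoefficient_isBigO :
    (fun N : ℕ ↦ ∑ n ∈ Finset.Icc 1 N, ‖fourierCoefficient f n‖ ^ 2) =O[atTop]
      fun N ↦ (N : ℝ) ^ (k : ℝ) := by
  obtain ⟨C, hC⟩ := norm_sq_fourierCoefficient_sum_le f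
  refine Asymptotics.IsBigO.of_bound (C * Real.exp (4 * Real.pi)) ?_
  filter_upwards [eventually_gt_atTop 0] with N hN
  have hN' : (0 : ℝ) < N := by exact_mod_cast hN
  rw [Real.norm_of_nonneg (by positivity), Real.norm_of_nonneg (by positivity)]
  have h := hC (1 / N) (by positivity) N
  rw [Real.div_rpow zero_le_one hN'.le, Real.one_rpow, div_div_eq_mul_div, div_one] at h
  have h2 : (∑ n ∈ Finset.Icc 1 N, ‖fourierCoefficient f n‖ ^ 2) * Real.exp (-(4 * Real.pi)) ≤
      C * (N : ℝ) ^ (k : ℝ) := by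
    refine le_trans ?_ h
    rw [Finset.sum_mul]
    refine Finset.sum_le_sum fun n hn ↦ ?_
    have hn' : (n : ℝ) ≤ N := by exact_mod_cast (Finset.mem_Icc.mp hn).2
    rw [mul_pow, ← Real.exp_nat_mul]
    gcongr
    have : (n : ℝ) * (1 / N) ≤ 1 := by rw [mul_one_div]; exact div_le_one_of_le₀ hn' hN'.le
    push_cast
    nlinarith [Real.pi_pos]
  rw [Real.exp_neg, ← div_eq_mul_inv, div_le_iff₀ (Real.exp_pos _)] at h2
  linarith

/-- The inequality 2|λ| ≤ |λ|² + 1 compares the series with the mean-square one and with the sum of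
n^(-σ), both convergent for σ > 1. -/
theorem lseriesSummable_normCoeff (hk : 0 < k) {s : ℂ} (hs : 1 < s.re) :
    LSeriesSummable (normCoeff f) s := by
  have hk0 : (0 : ℝ) < k := by exact_mod_cast hk
  have h1 := LSeriesSummable_of_sum_norm_bigO_and_nonneg (norm_sq_fourierCoefficient_isBigO f)
    (fun _ ↦ by positivity) hk0.le (s := ((s.re + (k - 1) : ℝ) : ℂ))
    (by rw [Complex.ofReal_re]; linarith)
  have h2 := Real.summable_one_div_nat_rpow.mpr hs
  refine Summable.of_norm_bounded ((h1.norm.add h2).div_const 2) fun n ↦ ?_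
  rcases Nat.eq_zero_or_pos n with rfl | hn
  · have : 0 ≤ 1 / ((0 : ℕ) : ℝ) ^ s.re := by positivity
    simp only [LSeries.term_zero, norm_zero, zero_add]
    positivity
  have hn' : (0 : ℝ) < n := by exact_mod_cast hn
  rw [LSeries.term_of_ne_zero hn.ne', LSeries.term_of_ne_zero hn.ne', normCoeff, ofReal_weight]
  simp only [norm_div, Complex.norm_natCast_cpow_of_pos hn, Complex.ofReal_re]
  rw [Complex.norm_real, norm_pow, norm_norm, ← fourierCoefficient]
  have h3 : (n : ℝ) ^ (s.re + (k - 1)) = n ^ s.re * (n ^ (((k : ℝ) - 1) / 2)) ^ 2 := by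
    rw [Real.rpow_add hn', ← Real.rpow_mul_natCast hn'.le]
    norm_num
  rw [h3]
  set x := ‖fourierCoefficient f n‖
  have hp : (0 : ℝ) < n ^ (((k : ℝ) - 1) / 2) := by positivity
  have hq : (0 : ℝ) < n ^ s.re := by positivity
  rw [mul_comm ((n : ℝ) ^ s.re), ← div_div, ← div_pow, ← add_div,
    div_right_comm _ _ (2 : ℝ)]
  refine div_le_div_of_nonneg_right ?_ hq.le
  nlinarith [sq_nonneg (x / n ^ (((k : ℝ) - 1) / 2) - 1)]

theorem abscissa_normCoeff_le (hk : 0 < k) :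
    LSeries.abscissaOfAbsConv (normCoeff f) ≤ 1 :=
  LSeries.abscissaOfAbsConv_le_of_forall_lt_LSeriesSummable fun y hy ↦
    lseriesSummable_normCoeff f hk (by simpa using hy)

/-- `hasSum_L` only reaches `re s > 3/2`; the identity theorem extends it to the half plane of
absolute convergence. -/
theorem L_eq_LSeries (hk : 0 < k) {s : ℂ} (hs : 1 < s.re) :
    L hk f s = LSeries (normCoeff f) s := by
  have ho : IsOpen {s : ℂ | 1 < s.re} := isOpen_lt continuous_const Complex.continuous_re
  have hL : DifferentiableOn ℂ (LSeries (normCoeff f)) {s : ℂ | 1 < s.re} :=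
    (LSeries_differentiableOn _).mono fun z hz ↦
      lt_of_le_of_lt (abscissa_normCoeff_le f hk) (by exact_mod_cast hz)
  have hev : L hk f =ᶠ[𝓝 2] LSeries (normCoeff f) := by
    filter_upwards [(isOpen_lt continuous_const Complex.continuous_re).mem_nhds
      (show (2 : ℂ) ∈ {s : ℂ | 3 / 2 < s.re} by norm_num)] with z hz
    exact (hasSum_L hk f hz).LSeries_eq.symm
  exact ((differentiable_L hk f).differentiableOn.analyticOnNhd
    ho).eqOn_of_preconnected_of_eventuallyEq
    (hL.analyticOnNhd ho) (convex_halfSpace_re_gt 1).isPreconnected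
    (show (2 : ℂ) ∈ {s : ℂ | 1 < s.re} by norm_num) hev hs

end EigenformL
end

/-! ### Lower bounds for Dirichlet series by removing Euler factors. -/

noncomputable section
namespace EigenformL

open Filter Topology Function

theorem hasSum_ite_dvd {p : ℕ} (hp : 0 < p) {u : ℕ → ℂ} {S : ℂ}
    (hu : HasSum (fun m ↦ u (p * m)) S) : HasSum (fun n ↦ if p ∣ n then u n else 0) S := by
  have hinj : Injective fun m : ℕ ↦ p * m := fun _ _ h ↦ Nat.eq_of_mul_eq_mul_left hp h
  rw [← hinj.hasSum_iff]
  · simpa [comp_def] using hu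
  · intro m hm
    exact if_neg fun ⟨j, hj⟩ ↦ hm ⟨j, hj.symm⟩

/-- Removing the Euler factor at `p` from a Dirichlet series whose coefficients satisfy a Hecke
recursion at `p`. -/
theorem LSeries_remove_prime {g : ℕ → ℂ} {p : ℕ} (hp : 0 < p) {c s : ℂ}
    (hg : LSeriesSummable g s)
    (h : ∀ m, g (p * m) + (if p ∣ m then g (m / p) else 0) = c * g m) :
    LSeriesHasSum (fun n ↦ if p ∣ n then 0 else g n) s
      ((1 - c * ((p : ℂ) ^ s)⁻¹ + (((p : ℂ) ^ s)⁻¹) ^ 2) * LSeries g s) := by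
  have hps : (p : ℂ) ^ s ≠ 0 :=
    Complex.cpow_ne_zero_iff.mpr (.inl (Nat.cast_ne_zero.mpr hp.ne'))
  set q := ((p : ℂ) ^ s)⁻¹ with hq
  have hS : HasSum (LSeries.term g s) (LSeries g s) := hg.hasSum
  have h1 : HasSum (fun m ↦ if p ∣ m then LSeries.term g s (m / p) else 0) (LSeries g s) :=
    hasSum_ite_dvd hp (by simpa [Nat.mul_div_cancel_left _ hp] using hS)
  -- The recursion evaluates the part of the series over multiples of p. Subtracting that part
  -- leaves the Euler polynomial times the whole series.
  have h2 : HasSum (fun m ↦ LSeries.term g s (p * m))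
      (q * (c * LSeries g s - q * LSeries g s)) := by
    convert! ((hS.mul_left c).sub (h1.mul_left q)).mul_left q using 2 with m
    rcases Nat.eq_zero_or_pos m with rfl | hm
    · simp
    rw [LSeries.term_of_ne_zero (Nat.mul_pos hp hm).ne', LSeries.term_of_ne_zero hm.ne',
      eq_sub_of_add_eq (h m), Nat.cast_mul, Complex.natCast_mul_natCast_cpow]
    have hms : (m : ℂ) ^ s ≠ 0 :=
      Complex.cpow_ne_zero_iff.mpr (.inl (Nat.cast_ne_zero.mpr hm.ne'))
    split_ifs with hd
    · obtain ⟨j, rfl⟩ := hd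
      have hj : 0 < j := Nat.pos_of_mul_pos_left hm
      have hjs : (j : ℂ) ^ s ≠ 0 :=
        Complex.cpow_ne_zero_iff.mpr (.inl (Nat.cast_ne_zero.mpr hj.ne'))
      rw [Nat.mul_div_cancel_left _ hp, LSeries.term_of_ne_zero hj.ne', Nat.cast_mul,
        Complex.natCast_mul_natCast_cpow, hq]
      field_simp
    · rw [hq]
      field_simp
      ring
  have h3 := hS.sub (hasSum_ite_dvd hp h2)
  unfold LSeriesHasSum
  convert! h3 using 1
  · ext n
    by_cases hd : p ∣ n <;> simp [LSeries.term, hd]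
  · ring

/-- The coefficients `g n` at those `n` that are not divisible by any element of `P`. -/
def sifted (g : ℕ → ℂ) (P : Finset ℕ) (n : ℕ) : ℂ := if ∃ p ∈ P, p ∣ n then 0 else g n

theorem norm_sifted_le (g : ℕ → ℂ) (P : Finset ℕ) (n : ℕ) : ‖sifted g P n‖ ≤ ‖g n‖ := by
  unfold sifted
  split_ifs <;> simp

/-- A prime q ≠ p divides pj if and only if it divides j, so sifting by other primes does not
disturb the recursion at p. -/
theorem sifted_recursion {g : ℕ → ℂ} {P : Finset ℕ} {p : ℕ} (hp : p.Prime)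
    (hP : ∀ q ∈ P, q.Prime) (hpP : p ∉ P) {c : ℂ}
    (h : ∀ m, g (p * m) + (if p ∣ m then g (m / p) else 0) = c * g m) (m : ℕ) :
    sifted g P (p * m) + (if p ∣ m then sifted g P (m / p) else 0) = c * sifted g P m := by
  have key (j : ℕ) : (∃ q ∈ P, q ∣ p * j) ↔ ∃ q ∈ P, q ∣ j := by
    refine exists_congr fun q ↦ and_congr_right fun hq ↦ ?_
    refine ⟨fun hd ↦ ((hP q hq).dvd_mul.mp hd).resolve_left fun hqp ↦ hpP ?_,
      fun hd ↦ hd.mul_left p⟩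
    rwa [← (Nat.prime_dvd_prime_iff_eq (hP q hq) hp).mp hqp]
  have h' := h m
  unfold sifted
  by_cases hd : p ∣ m
  · obtain ⟨j, rfl⟩ := hd
    rw [Nat.mul_div_cancel_left _ hp.pos] at h' ⊢
    simp only [key, dvd_mul_right, if_true] at h' ⊢
    split_ifs
    · simp
    · exact h'
  · simp only [key, hd, if_false, add_zero] at h' ⊢
    split_ifs
    · simp
    · exact h'

theorem LSeries_sifted {g c : ℕ → ℂ} {s : ℂ} (hg : LSeriesSummable g s)
    (h : ∀ p, p.Prime → ∀ m, g (p * m) + (if p ∣ m then g (m / p) else 0) = c p * g m)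
    (P : Finset ℕ) (hP : ∀ p ∈ P, p.Prime) :
    LSeriesHasSum (sifted g P) s
      ((∏ p ∈ P, (1 - c p * ((p : ℂ) ^ s)⁻¹ + (((p : ℂ) ^ s)⁻¹) ^ 2)) * LSeries g s) := by
  induction P using Finset.induction_on with
  | empty =>
    have h0 : sifted g ∅ = g := by ext; simp [sifted]
    rw [h0, Finset.prod_empty, one_mul]
    exact hg.hasSum
  | insert p P hpP ih =>
    have ih' := ih fun q hq ↦ hP q (Finset.mem_insert_of_mem hq)
    have hp := hP p (Finset.mem_insert_self p P)
    have h1 := LSeries_remove_prime hp.pos ih'.LSeriesSummable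
      (sifted_recursion hp (fun q hq ↦ hP q (Finset.mem_insert_of_mem hq)) hpP (h p hp))
    rw [ih'.LSeries_eq, ← mul_assoc, ← Finset.prod_insert hpP
      (f := fun p : ℕ ↦ 1 - c p * ((p : ℂ) ^ s)⁻¹ + (((p : ℂ) ^ s)⁻¹) ^ 2)] at h1
    convert h1 using 1
    ext n
    by_cases hd : p ∣ n <;> simp [sifted, hd]

theorem norm_inv_natCast_cpow_le_one {p : ℕ} (hp : 0 < p) {s : ℂ} (hs : 0 ≤ s.re) :
    ‖((p : ℂ) ^ s)⁻¹‖ ≤ 1 := by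
  rw [norm_inv, Complex.norm_natCast_cpow_of_pos hp]
  exact inv_le_one_of_one_le₀ (Real.one_le_rpow (by exact_mod_cast hp) hs)

theorem sifted_one {g : ℕ → ℂ} {P : Finset ℕ} (hP : ∀ p ∈ P, p.Prime) : sifted g P 1 = g 1 :=
  if_neg fun ⟨p, hp, hp1⟩ ↦ (hP p hp).one_lt.ne' (Nat.dvd_one.mp hp1)

theorem sifted_primesBelow {g : ℕ → ℂ} {n N : ℕ} (hn0 : 0 < n) (hn1 : n ≠ 1) (hn : n < N) :
    sifted g N.primesBelow n = 0 :=
  if_pos ⟨n.minFac, Nat.mem_primesBelow.mpr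
    ⟨(Nat.minFac_le hn0).trans_lt hn, Nat.minFac_prime hn1⟩, n.minFac_dvd⟩

/-- Sifting by all primes below N leaves only n = 1 and indices n ≥ N, so the deviation from 1 is
controlled by a tail of the absolutely convergent series. -/
theorem norm_term_sifted_sub_le {g : ℕ → ℂ} (h1 : g 1 = 1) {s t : ℂ} (hs : t.re ≤ s.re)
    (n N : ℕ) :
    ‖LSeries.term (sifted g N.primesBelow) s n - if n = 1 then 1 else 0‖ ≤
      if n < N then 0 else ‖LSeries.term g t n‖ := by
  have hone : LSeries.term (sifted g N.primesBelow) s 1 = 1 := by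
    rw [LSeries.term_of_ne_zero one_ne_zero,
      sifted_one fun p hp ↦ Nat.prime_of_mem_primesBelow hp, h1]
    simp
  rcases Nat.lt_or_ge n 2 with hn2 | hn2
  · interval_cases n
    · simp
    · simp only [hone, if_true, sub_self, norm_zero]
      split_ifs <;> positivity
  rw [if_neg (by omega), sub_zero]
  split_ifs with hn
  · rw [LSeries.term_of_ne_zero (by omega), sifted_primesBelow (by omega) (by omega) hn]
    simp
  · exact (LSeries.norm_term_le s (norm_sifted_le g _ n)).trans
      (LSeries.norm_term_le_of_re_le_re g hs n)

theorem hasSum_ite_lt {a : ℕ → ℝ} {S : ℝ} (ha : HasSum a S) (N : ℕ) :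
    HasSum (fun n ↦ if n < N then 0 else a n) (S - ∑ n ∈ Finset.range N, a n) := by
  have h0 : HasSum (fun n ↦ if n < N then a n else 0)
      (∑ n ∈ Finset.range N, if n < N then a n else 0) :=
    hasSum_sum_of_ne_finset_zero fun n hn ↦ if_neg (by simpa using hn)
  rw [Finset.sum_congr rfl fun n hn ↦ if_pos (Finset.mem_range.mp hn)] at h0
  convert! ha.sub h0 using 2 with n
  split_ifs <;> simp

theorem norm_prod_euler_le (g : ℕ → ℂ) {P : Finset ℕ} (hP : ∀ p ∈ P, p.Prime) {s : ℂ}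
    (hs : 0 ≤ s.re) :
    ‖∏ p ∈ P, (1 - g p * ((p : ℂ) ^ s)⁻¹ + (((p : ℂ) ^ s)⁻¹) ^ 2)‖ ≤ ∏ p ∈ P, (2 + ‖g p‖) := by
  rw [norm_prod]
  refine Finset.prod_le_prod (fun _ _ ↦ norm_nonneg _) fun p hp ↦ ?_
  have hq := norm_inv_natCast_cpow_le_one (hP p hp).pos hs
  calc _ ≤ ‖(1 : ℂ)‖ + ‖g p * ((p : ℂ) ^ s)⁻¹‖ + ‖(((p : ℂ) ^ s)⁻¹) ^ 2‖ :=
        (norm_add_le _ _).trans (add_le_add_left (norm_sub_le _ _) _)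
    _ ≤ 1 + ‖g p‖ * 1 + 1 := by
        rw [norm_mul, norm_pow, norm_one]
        gcongr
        exact pow_le_one₀ (norm_nonneg _) hq
    _ = _ := by ring

/-- A Dirichlet series with the Hecke recursions at all primes is bounded away from zero on each
closed half plane of absolute convergence. -/
theorem exists_lower_bound_LSeries {g : ℕ → ℂ} {σ : ℝ} (hσ : 0 ≤ σ)
    (hg : LSeriesSummable g σ) (h1 : g 1 = 1)
    (h : ∀ p, p.Prime → ∀ m, g (p * m) + (if p ∣ m then g (m / p) else 0) = g p * g m) :
    ∃ B : ℝ, 0 < B ∧ ∀ s : ℂ, σ ≤ s.re → 1 ≤ B * ‖LSeries g s‖ := by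
  have hsum : HasSum (fun n ↦ ‖LSeries.term g σ n‖) (∑' n, ‖LSeries.term g σ n‖) := hg.norm.hasSum
  generalize (∑' n, ‖LSeries.term g σ n‖) = S at hsum
  -- With tail less than 1/2, the sifted series has norm at least 1/2. Dividing by the bound for the
  -- finite Euler product gives B.
  obtain ⟨N, hN⟩ := (hsum.tendsto_sum_nat.eventually
    (eventually_gt_nhds (show S - 1 / 2 < S by linarith))).exists
  have hP : ∀ p ∈ N.primesBelow, p.Prime := fun p hp ↦ Nat.prime_of_mem_primesBelow hp
  refine ⟨2 * ∏ p ∈ N.primesBelow, (2 + ‖g p‖),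
    mul_pos two_pos (Finset.prod_pos fun p _ ↦ by positivity), fun s hs ↦ ?_⟩
  have hgs : LSeriesSummable g s := hg.of_re_le_re (by simpa using hs)
  have hS : HasSum (LSeries.term (sifted g N.primesBelow) s) _ := LSeries_sifted hgs h _ hP
  have hδ : HasSum (fun n : ℕ ↦ if n = 1 then (1 : ℂ) else 0) 1 := hasSum_ite_eq 1 1
  have hle := fun n ↦ norm_term_sifted_sub_le h1 (t := (σ : ℂ)) (s := s) (by simpa using hs) n N
  have hbound := HasSum.norm_le_of_bounded (hS.sub hδ) (hasSum_ite_lt hsum N) hle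
  have hprod := norm_prod_euler_le g hP (hσ.trans hs)
  have h3 := norm_sub_norm_le (1 : ℂ) ((∏ p ∈ N.primesBelow, (1 - g p * ((p : ℂ) ^ s)⁻¹ +
    (((p : ℂ) ^ s)⁻¹) ^ 2)) * LSeries g s)
  rw [norm_sub_rev, norm_one, norm_mul] at h3
  have h4 := mul_le_mul_of_nonneg_right hprod (norm_nonneg (LSeries g s))
  rw [mul_assoc]
  linarith

end EigenformL
end

/-! ### Consequences for L: bounds, conjugation symmetry, zero-free right half planes. -/

noncomputable section
namespace EigenformL

open Filter Topology Function
open scoped ComplexConjugate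

/-- A Dirichlet series with a nonzero coefficient has no zeros far to the right. -/
theorem exists_LSeries_ne_zero {g : ℕ → ℂ} (hg : LSeries.abscissaOfAbsConv g < ⊤) {n : ℕ}
    (hn : 0 < n) (hgn : g n ≠ 0) : ∃ σ : ℝ, ∀ s : ℂ, σ ≤ s.re → LSeries g s ≠ 0 := by
  classical
  have hex : ∃ n, 0 < n ∧ g n ≠ 0 := ⟨n, hn, hgn⟩
  obtain ⟨m, hm⟩ := Nat.exists_eq_succ_of_ne_zero (Nat.find_spec hex).1.ne'
  have hgm : g (m + 1) ≠ 0 := by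
    have := (Nat.find_spec hex).2
    rwa [hm] at this
  have hmin {j : ℕ} (hj0 : 0 < j) (hj : j ≤ m) : g j = 0 := by
    by_contra h
    have := Nat.find_min' hex ⟨hj0, h⟩
    omega
  -- The series of absolute values depends only on `re s`, so its asymptotics along the real axis
  -- give estimates uniform in the imaginary part.
  set a : ℕ → ℂ := fun j ↦ if j = 0 then 0 else (‖g j‖ : ℂ) with ha
  have hnorm (j : ℕ) (s : ℂ) : LSeries.term a (s.re : ℂ) j = ‖LSeries.term g s j‖ := by
    rcases Nat.eq_zero_or_pos j with rfl | hj
    · simp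
    rw [LSeries.term_of_ne_zero hj.ne', LSeries.term_of_ne_zero hj.ne', norm_div,
      Complex.norm_natCast_cpow_of_pos hj, Complex.ofReal_div,
      Complex.ofReal_cpow j.cast_nonneg, Complex.ofReal_natCast, ha]
    simp [hj.ne']
  have hsummable {s : ℂ} (h : LSeriesSummable g s) : LSeriesSummable a (s.re : ℂ) := by
    refine Summable.of_norm ?_
    simpa [hnorm] using h.norm
  obtain ⟨y, hgy, hy⟩ := exists_between hg
  lift y to ℝ using ⟨hy.ne, ((OrderBot.bot_le _).trans_lt hgy).ne'⟩
  have ha_abs : LSeries.abscissaOfAbsConv a < ⊤ := by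
    refine lt_of_le_of_lt (LSeries.abscissaOfAbsConv_le_of_forall_lt_LSeriesSummable (x := y)
      fun z hz ↦ ?_) hy
    have := hsummable (LSeriesSummable_of_abscissaOfAbsConv_lt_re (f := g) (s := (z : ℂ))
      (by simpa using hgy.trans (by exact_mod_cast hz)))
    simpa using this
  have hlim := LSeries.tendsto_cpow_mul_atTop (f := a) (n := m) (fun j hj ↦ by
    rcases Nat.eq_zero_or_pos j with rfl | hj0
    · simp [ha]
    · simp [ha, hmin hj0 hj]) ha_abs
  have hc : a (m + 1) = (‖g (m + 1)‖ : ℂ) := by simp [ha]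
  have hev := (hlim.sub_const (a (m + 1))).norm.eventually_lt_const
    (show ‖a (m + 1) - a (m + 1)‖ < ‖g (m + 1)‖ by simpa using hgm)
  obtain ⟨σ, hσ⟩ := (hev.and (eventually_gt_atTop y)).exists_forall_of_atTop
  refine ⟨σ, fun s hs h0 ↦ ?_⟩
  obtain ⟨h1, h2⟩ := hσ s.re hs
  have hgs : LSeriesSummable g s := LSeriesSummable_of_abscissaOfAbsConv_lt_re
    (hgy.trans (by exact_mod_cast h2))
  have hS : HasSum (LSeries.term g s) 0 := h0 ▸ hgs.hasSum
  have hA := (hsummable hgs).hasSum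
  set q : ℝ := ((m : ℝ) + 1) ^ s.re with hq
  have hqpos : 0 < q := by positivity
  have hqC : ((m : ℂ) + 1) ^ (s.re : ℂ) = q := by
    rw [hq, Complex.ofReal_cpow (by positivity)]
    simp
  have hA' : HasSum (fun j ↦ ‖LSeries.term g s j‖) (∑' j, ‖LSeries.term g s j‖) := hgs.norm.hasSum
  have hAL : LSeries a s.re = ((∑' j, ‖LSeries.term g s j‖ : ℝ) : ℂ) := by
    rw [Complex.ofReal_tsum]
    exact tsum_congr fun j ↦ hnorm j s
  -- At a zero the leading term is at most the sum of the others in norm, so q times the total is at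
  -- least 2‖g(m + 1)‖, which `h1` excludes.
  have hsplit := HasSum.norm_le_of_bounded (hS.update (m + 1) 0) (hA'.update (m + 1) 0)
    fun j ↦ by
      by_cases hj : j = m + 1
      · subst hj; simp
      · simp [Function.update_of_ne hj]
  have hterm : ‖LSeries.term g s (m + 1)‖ = ‖g (m + 1)‖ / q := by
    rw [LSeries.term_of_ne_zero m.succ_ne_zero, norm_div,
      Complex.norm_natCast_cpow_of_pos m.succ_pos, hq]
    push_cast
    rfl
  rw [hqC, hAL, hc] at h1
  rw [← Complex.ofReal_mul, ← Complex.ofReal_sub, Complex.norm_real] at h1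
  have h3 := (le_abs_self _).trans_lt h1
  simp only [zero_sub, add_zero, norm_neg, hterm] at hsplit
  rw [div_le_iff₀ hqpos] at hsplit
  have h4 : ‖g (m + 1)‖ / q * q = ‖g (m + 1)‖ := div_mul_cancel₀ _ hqpos.ne'
  nlinarith

variable {k : ℤ}

theorem exists_norm_L_le (hk : 0 < k) (f : CuspForm 𝒮ℒ k) {ε : ℝ} (hε : 0 < ε) :
    ∃ C : ℝ, ∀ s : ℂ, 1 + ε ≤ s.re → ‖L hk f s‖ ≤ C := by
  have h := lseriesSummable_normCoeff f hk (s := ((1 + ε : ℝ) : ℂ))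
    (by rw [Complex.ofReal_re]; linarith)
  refine ⟨∑' n, ‖LSeries.term (normCoeff f) ((1 + ε : ℝ) : ℂ) n‖, fun s hs ↦ ?_⟩
  rw [L_eq_LSeries f hk (by linarith)]
  exact tsum_of_norm_bounded h.norm.hasSum fun n ↦
    LSeries.norm_term_le_of_re_le_re _ (by simpa using hs) n

variable {f : CuspForm 𝒮ℒ k}

namespace IsNormalizedHeckeEigenform

theorem exists_lower_bound_L (hk : 0 < k) (hf : IsNormalizedHeckeEigenform f) {ε : ℝ}
    (hε : 0 < ε) : ∃ B : ℝ, 0 < B ∧ ∀ s : ℂ, 1 + ε ≤ s.re → 1 ≤ B * ‖L hk f s‖ := by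
  obtain ⟨B, hB, h⟩ := exists_lower_bound_LSeries (g := normCoeff f) (σ := 1 + ε) (by positivity)
    (lseriesSummable_normCoeff f hk (by rw [Complex.ofReal_re]; linarith)) hf.normCoeff_one
    fun p hp m ↦ hf.normCoeff_prime_mul hp m
  exact ⟨B, hB, fun s hs ↦ L_eq_LSeries f hk (s := s) (by linarith) ▸ h s hs⟩

theorem L_ne_zero (hk : 0 < k) (hf : IsNormalizedHeckeEigenform f) {s : ℂ} (hs : 1 < s.re) :
    L hk f s ≠ 0 := by
  obtain ⟨B, -, h⟩ := hf.exists_lower_bound_L hk (sub_pos.mpr hs)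
  intro h0
  have := h s (by linarith)
  rw [h0, norm_zero, mul_zero] at this
  linarith

/-- Cauchy's estimate bounds L', and the lower bound for |L| controls the denominator. -/
theorem exists_norm_logDeriv_L_le (hk : 0 < k) (hf : IsNormalizedHeckeEigenform f) {ε : ℝ}
    (hε : 0 < ε) : ∃ C : ℝ, ∀ s : ℂ, 1 + ε ≤ s.re → ‖logDeriv (L hk f) s‖ ≤ C := by
  obtain ⟨B, hB, hlow⟩ := hf.exists_lower_bound_L hk hε
  obtain ⟨C, hC⟩ := exists_norm_L_le hk f (half_pos hε)
  refine ⟨C / (ε / 2) * B, fun s hs ↦ ?_⟩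
  have h1 : ‖deriv (L hk f) s‖ ≤ C / (ε / 2) :=
    Complex.norm_deriv_le_of_forall_mem_sphere_norm_le (half_pos hε)
      (differentiable_L hk f).diffContOnCl fun w hw ↦ hC w <| by
        rw [mem_sphere_iff_norm, norm_sub_rev] at hw
        have := (Complex.re_le_norm (s - w)).trans_eq hw
        rw [Complex.sub_re] at this
        linarith
  have h2 := hlow s hs
  have h3 : 0 < ‖L hk f s‖ := norm_pos_iff.mpr (hf.L_ne_zero hk (by linarith))
  rw [logDeriv_apply, norm_div, div_le_iff₀ h3, mul_assoc]
  exact h1.trans (le_mul_of_one_le_right ((norm_nonneg _).trans h1) h2)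

theorem L_conj (hk : 0 < k) (hf : IsNormalizedHeckeEigenform f) :
    conj ∘ L hk f ∘ conj = L hk f := by
  have hd : Differentiable ℂ (conj ∘ L hk f ∘ conj) := fun s ↦ by
    have := (differentiable_L hk f (conj s)).conj_conj
    rwa [Complex.conj_conj] at this
  refine AnalyticOnNhd.eq_of_eventuallyEq (z₀ := 2) (fun s _ ↦ hd.analyticAt s)
    (fun s _ ↦ (differentiable_L hk f).analyticAt s) ?_
  filter_upwards [(isOpen_lt continuous_const Complex.continuous_re).mem_nhds
    (show (2 : ℂ) ∈ {s : ℂ | 1 < s.re} by norm_num)] with s hs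
  rw [comp_apply, comp_apply, L_eq_LSeries f hk hs, L_eq_LSeries f hk (by simpa using hs),
    LSeries, LSeries, Complex.conj_tsum]
  refine tsum_congr fun n ↦ ?_
  rcases Nat.eq_zero_or_pos n with rfl | hn
  · simp
  rw [LSeries.term_of_ne_zero hn.ne', LSeries.term_of_ne_zero hn.ne', map_div₀, hf.conj_normCoeff,
    Complex.cpow_conj _ _ (by simp [Complex.natCast_arg, Real.pi_ne_zero.symm]), Complex.conj_conj,
    Complex.conj_natCast]

theorem iteratedDeriv_L_conj (hk : 0 < k) (hf : IsNormalizedHeckeEigenform f) (m : ℕ) :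
    conj ∘ iteratedDeriv m (L hk f) ∘ conj = iteratedDeriv m (L hk f) := by
  induction m with
  | zero => simpa using! hf.L_conj hk
  | succ m ih =>
    rw [iteratedDeriv_succ]
    conv_rhs => rw [← ih, deriv_conj_conj]

/-- Otherwise L would be identically 1, against its trivial zero. An index n ≥ 2 is needed because
differentiation kills the term n = 1. -/
theorem exists_normCoeff_ne_zero (hk : 0 < k) (hf : IsNormalizedHeckeEigenform f) :
    ∃ n, 2 ≤ n ∧ normCoeff f n ≠ 0 := by
  by_contra! h
  have hL : L hk f = fun _ ↦ 1 := by
    refine AnalyticOnNhd.eq_of_eventuallyEq (z₀ := 2)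
      (fun s _ ↦ (differentiable_L hk f).analyticAt s) (fun s _ ↦ analyticAt_const) ?_
    filter_upwards [(isOpen_lt continuous_const Complex.continuous_re).mem_nhds
      (show (2 : ℂ) ∈ {s : ℂ | 1 < s.re} by norm_num)] with s hs
    rw [L_eq_LSeries f hk hs, LSeries, tsum_eq_single 1]
    · simp [LSeries.term, hf.normCoeff_one]
    · intro n hn
      rcases Nat.lt_or_ge n 2 with h2 | h2
      · interval_cases n
        · simp
        · simp at hn
      · rw [LSeries.term_of_ne_zero (by omega), h n h2, zero_div]
  have := L_trivial_zero hk f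
  rw [hL] at this
  exact one_ne_zero this

/-- The derivatives of `L` have no zeros far to the right. -/
theorem exists_iteratedDeriv_L_ne_zero (hk : 0 < k) (hf : IsNormalizedHeckeEigenform f) (m : ℕ) :
    ∃ σ : ℝ, 1 < σ ∧ ∀ s : ℂ, σ ≤ s.re → iteratedDeriv m (L hk f) s ≠ 0 := by
  obtain ⟨n, hn, hn0⟩ := hf.exists_normCoeff_ne_zero hk
  have habs := abscissa_normCoeff_le f hk
  have hcoeff : (LSeries.logMul^[m] (normCoeff f)) n = Complex.log n ^ m * normCoeff f n := by
    induction m with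
    | zero => simp
    | succ m ih => rw [iterate_succ', comp_apply, LSeries.logMul, ih, pow_succ']; ring
  have hlog : Complex.log n ≠ 0 := by
    rw [← Complex.natCast_log, Complex.ofReal_ne_zero]
    exact (Real.log_pos (by exact_mod_cast hn)).ne'
  obtain ⟨σ, hσ⟩ := exists_LSeries_ne_zero (g := LSeries.logMul^[m] (normCoeff f))
    (by rw [LSeries.absicssaOfAbsConv_logPowMul]; exact habs.trans_lt (EReal.coe_lt_top 1))
    (n := n) (by omega) (by rw [hcoeff]; exact mul_ne_zero (pow_ne_zero _ hlog) hn0)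
  refine ⟨max σ 2, by simp, fun s hs ↦ ?_⟩
  have hs1 : 1 < s.re := by linarith [le_max_right σ 2]
  have hev : L hk f =ᶠ[𝓝 s] LSeries (normCoeff f) := by
    filter_upwards [(isOpen_lt continuous_const Complex.continuous_re).mem_nhds hs1] with z hz
    exact L_eq_LSeries f hk hz
  rw [hev.iteratedDeriv_eq, LSeries_iteratedDeriv m (habs.trans_lt (by exact_mod_cast hs1))]
  exact mul_ne_zero (pow_ne_zero _ (by norm_num)) (hσ s ((le_max_left _ _).trans hs))

end IsNormalizedHeckeEigenform

end EigenformL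
end

/-! ### Estimates for sine and cosine; zeros of cos πs + r sin πs. -/

noncomputable section
namespace EigenformL

open Filter Topology

theorem norm_sin_sq (z : ℂ) : ‖Complex.sin z‖ ^ 2 = Real.sin z.re ^ 2 + Real.sinh z.im ^ 2 := by
  have h : Complex.sin z = (Real.sin z.re * Real.cosh z.im : ℝ) +
      (Real.cos z.re * Real.sinh z.im : ℝ) * Complex.I := by
    rw [Complex.sin_eq]
    push_cast
    ring
  rw [Complex.sq_norm, h, Complex.normSq_add_mul_I, mul_pow, mul_pow, Real.cosh_sq,
    Real.cos_sq']
  ring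

theorem norm_cos_sq (z : ℂ) : ‖Complex.cos z‖ ^ 2 = Real.cos z.re ^ 2 + Real.sinh z.im ^ 2 := by
  have h : Complex.cos z = (Real.cos z.re * Real.cosh z.im : ℝ) +
      (-(Real.sin z.re * Real.sinh z.im) : ℝ) * Complex.I := by
    rw [Complex.cos_eq]
    push_cast
    ring
  rw [Complex.sq_norm, h, Complex.normSq_add_mul_I, neg_sq, mul_pow, mul_pow, Real.cosh_sq,
    Real.sin_sq]
  ring

theorem norm_sin_sq_le (z : ℂ) : ‖Complex.sin z‖ ^ 2 ≤ 1 + ‖Complex.cos z‖ ^ 2 := by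
  rw [norm_sin_sq, norm_cos_sq]
  nlinarith [Real.sin_sq_add_cos_sq z.re, sq_nonneg (Real.cos z.re)]

theorem le_sinh_sq (x : ℝ) : x ^ 2 ≤ Real.sinh x ^ 2 := by
  rw [sq_le_sq, Real.abs_sinh]
  exact Real.self_le_sinh_iff.mpr (abs_nonneg x)

/-- Jordan's inequality handles the real part; |sinh x| ≥ |x| and π ≥ 2 handle the imaginary part.
-/
theorem two_mul_norm_le_norm_sin_pi {d : ℂ} (hd : |d.re| ≤ 1 / 2) :
    2 * ‖d‖ ≤ ‖Complex.sin (Real.pi * d)‖ := by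
  refine le_of_sq_le_sq ?_ (norm_nonneg _)
  rw [norm_sin_sq, mul_pow, Complex.sq_norm, Complex.normSq_apply, Complex.re_ofReal_mul,
    Complex.im_ofReal_mul]
  have h1 : 2 * |d.re| ≤ |Real.sin (Real.pi * d.re)| := by
    have := Real.mul_abs_le_abs_sin (x := Real.pi * d.re)
      (by rw [abs_mul, abs_of_pos Real.pi_pos]; nlinarith [Real.pi_pos])
    rw [abs_mul, abs_of_pos Real.pi_pos] at this
    refine le_trans (le_of_eq ?_) this
    field_simp
  have h2 : (2 * d.re) ^ 2 ≤ Real.sin (Real.pi * d.re) ^ 2 := by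
    rw [sq_le_sq, abs_mul, abs_two]
    exact h1
  have h3 := le_sinh_sq (Real.pi * d.im)
  have h4 : (2 * d.im) ^ 2 ≤ (Real.pi * d.im) ^ 2 := by
    rw [mul_pow, mul_pow]
    gcongr
    exact Real.two_le_pi
  nlinarith

/-- `tan (π z)` is bounded away from the real axis. -/
theorem exists_norm_sin_pi_le {ε : ℝ} (hε : 0 < ε) :
    ∃ T : ℝ, 0 < T ∧ ∀ z : ℂ, ε ≤ |z.im| →
      ‖Complex.sin (Real.pi * z)‖ ≤ T * ‖Complex.cos (Real.pi * z)‖ ∧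
      Complex.cos (Real.pi * z) ≠ 0 := by
  -- Here |cos| ≥ ε and |sin|² ≤ 1 + |cos|², so |sin| ≤ 1 + |cos| ≤ (1/ε + 1)|cos|.
  refine ⟨1 / ε + 1, by positivity, fun z hz ↦ ?_⟩
  have h1 : ε ^ 2 ≤ ‖Complex.cos (Real.pi * z)‖ ^ 2 := by
    rw [norm_cos_sq, Complex.im_ofReal_mul]
    have h2 := le_sinh_sq (Real.pi * z.im)
    have h3 : ε ^ 2 ≤ z.im ^ 2 := by rw [← sq_abs z.im]; gcongr
    have h4 : z.im ^ 2 ≤ (Real.pi * z.im) ^ 2 := by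
      rw [mul_pow]
      exact le_mul_of_one_le_left (sq_nonneg _) (one_le_pow₀ (by linarith [Real.two_le_pi]))
    nlinarith [sq_nonneg (Real.cos (Real.pi * z : ℂ).re)]
  have h2 : ε ≤ ‖Complex.cos (Real.pi * z)‖ := le_of_sq_le_sq h1 (norm_nonneg _)
  refine ⟨?_, norm_pos_iff.mp (hε.trans_le h2)⟩
  refine le_of_sq_le_sq ?_ (by positivity)
  refine (norm_sin_sq_le _).trans ?_
  have h3 : 1 ≤ 1 / ε * ‖Complex.cos (Real.pi * z)‖ := by
    rw [one_div, inv_mul_eq_div, one_le_div hε]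
    exact h2
  nlinarith [norm_nonneg (Complex.cos (Real.pi * z))]

theorem norm_cos_le_of_zero {z r : ℂ} (hr : ‖r‖ ≤ 1 / 8)
    (h : Complex.cos z + Complex.sin z * r = 0) :
    ‖Complex.cos z‖ < 1 / 4 ∧ ‖Complex.sin z‖ ^ 2 ≤ 2 := by
  have h1 : ‖Complex.cos z‖ ≤ ‖Complex.sin z‖ * (1 / 8) := by
    rw [eq_neg_of_add_eq_zero_left h, norm_neg, norm_mul]
    gcongr
  have h2 := norm_sin_sq_le z
  have h3 : ‖Complex.cos z‖ ^ 2 ≤ (‖Complex.sin z‖ * (1 / 8)) ^ 2 := by gcongr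
  constructor <;> nlinarith [norm_nonneg (Complex.cos z), norm_nonneg (Complex.sin z)]

/-- Zeros lie near the middle of the strip, so two of them in one strip have real parts at most 1/2
apart, the range allowed in `two_mul_norm_le_norm_sin_pi`. -/
theorem norm_sub_half_le_of_zero {s r : ℂ} {N : ℤ} (hN : (N : ℝ) ≤ s.re) (hN' : s.re ≤ N + 1)
    (hr : ‖r‖ ≤ 1 / 8) (h : Complex.cos (Real.pi * s) + Complex.sin (Real.pi * s) * r = 0) :
    |s.re - (N + 1 / 2)| ≤ 1 / 4 := by
  have hcos := (norm_cos_le_of_zero hr h).1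
  set d : ℂ := s - ((N + 1 / 2 : ℝ) : ℂ) with hd
  have hdre : d.re = s.re - (N + 1 / 2) := by rw [hd, Complex.sub_re, Complex.ofReal_re]
  have h1 := two_mul_norm_le_norm_sin_pi (d := d) (by rw [hdre, abs_le]; constructor <;> linarith)
  have h2 : ‖Complex.sin (Real.pi * d)‖ = ‖Complex.cos (Real.pi * s)‖ := by
    have : (Real.pi : ℂ) * d = (Real.pi * s - N * Real.pi) - Real.pi / 2 := by
      rw [hd]
      push_cast
      ring
    rw [this, Complex.sin_sub_pi_div_two, norm_neg, Complex.cos_antiperiodic.sub_int_mul_eq,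
      Int.cast_negOnePow ℂ, norm_mul,
      norm_zpow, norm_neg, norm_one, one_zpow, one_mul]
  rw [← hdre]
  have := Complex.abs_re_le_norm d
  linarith

/-- Two solutions of `cos (π s) + sin (π s) r s = 0` in the same strip agree if `r` is a small
function with small Lipschitz constant. -/
theorem eq_of_zero_of_mem_strip {s t r r' : ℂ} {N : ℤ} (hs : (N : ℝ) ≤ s.re) (hs' : s.re ≤ N + 1)
    (ht : (N : ℝ) ≤ t.re) (ht' : t.re ≤ N + 1) (hr : ‖r‖ ≤ 1 / 8) (hr' : ‖r'‖ ≤ 1 / 8)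
    (hrr' : ‖r' - r‖ ≤ 1 / 8 * ‖s - t‖)
    (h : Complex.cos (Real.pi * s) + Complex.sin (Real.pi * s) * r = 0)
    (h' : Complex.cos (Real.pi * t) + Complex.sin (Real.pi * t) * r' = 0) : s = t := by
  have h1 := abs_le.mp (norm_sub_half_le_of_zero hs hs' hr h)
  have h2 := abs_le.mp (norm_sub_half_le_of_zero ht ht' hr' h')
  have h3 := two_mul_norm_le_norm_sin_pi (d := s - t)
    (by rw [Complex.sub_re, abs_le]; constructor <;> linarith)
  -- Eliminating the cosines from the two equations. The left side has norm at least 2‖s - t‖, the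
  -- right side at most ‖s - t‖/4.
  have h4 : Complex.sin (Real.pi * (s - t)) =
      Complex.sin (Real.pi * s) * Complex.sin (Real.pi * t) * (r - r') := by
    rw [mul_sub, Complex.sin_sub]
    linear_combination Complex.sin (Real.pi * s) * h' - Complex.sin (Real.pi * t) * h
  have h5 : ‖Complex.sin (Real.pi * s)‖ * ‖Complex.sin (Real.pi * t)‖ ≤ 2 := by
    nlinarith [(norm_cos_le_of_zero hr h).2, (norm_cos_le_of_zero hr' h').2,
      sq_nonneg (‖Complex.sin (Real.pi * s)‖ - ‖Complex.sin (Real.pi * t)‖)]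
  rw [h4, norm_mul, norm_mul, norm_sub_rev r r'] at h3
  have h6 := mul_le_mul h5 hrr' (norm_nonneg _) zero_le_two
  rw [← sub_eq_zero, ← norm_eq_zero]
  linarith [norm_nonneg (s - t)]

/-- A holomorphic function that is small on a right half plane has small Lipschitz constant
there. -/
theorem norm_sub_le_of_norm_le {r : ℂ → ℂ} {X η : ℝ} (hr : DifferentiableOn ℂ r {s | X < s.re})
    (hb : ∀ s : ℂ, X < s.re → ‖r s‖ ≤ η) {s t : ℂ} (hs : X + 1 < s.re) (ht : X + 1 < t.re) :
    ‖r t - r s‖ ≤ η * ‖t - s‖ := by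
  have ho : IsOpen {s : ℂ | X < s.re} := isOpen_lt continuous_const Complex.continuous_re
  have hball {w z : ℂ} (hw : X + 1 < w.re) (hz : z ∈ Metric.closedBall w 1) : X < z.re := by
    rw [mem_closedBall_iff_norm, norm_sub_rev] at hz
    have := (Complex.re_le_norm _).trans hz
    rw [Complex.sub_re] at this
    linarith
  refine Convex.norm_image_sub_le_of_norm_deriv_le (s := {s : ℂ | X + 1 < s.re})
    (fun w (hw : X + 1 < w.re) ↦ hr.differentiableAt (ho.mem_nhds (by
      change X < w.re; linarith))) (fun w hw ↦ ?_) (convex_halfSpace_re_gt _) hs ht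
  have := Complex.norm_deriv_le_of_forall_mem_sphere_norm_le (c := w) one_pos
    (f := r) (C := η) (DifferentiableOn.diffContOnCl ?_) fun z hz ↦
      hb z (hball hw (Metric.sphere_subset_closedBall hz))
  · simpa using this
  · rw [closure_ball _ one_ne_zero]
    exact hr.mono fun z hz ↦ hball hw hz

end EigenformL
end

/-! ### The reflection factor and its logarithmic derivative Q. -/

noncomputable section
namespace EigenformL

open Filter Topology Function
open scoped ComplexConjugate

theorem sub_mem_slitHalfPlane {κ ε : ℝ} (hε : 0 ≤ ε) {s : ℂ} (hs : s ∈ slitRegion κ ε) :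
    s - κ ∈ slitHalfPlane κ ε := by
  have h1 := hs.1
  refine ⟨?_, hs.2.imp (fun h ↦ ?_) fun h ↦ ?_⟩
  · rw [Complex.sub_re, Complex.ofReal_re]; linarith
  · simpa using h
  · rw [Complex.sub_re, Complex.ofReal_re]; linarith

theorem add_mem_slitHalfPlane {κ ε : ℝ} (hκ : 0 ≤ κ) (hε : 0 ≤ ε) {s : ℂ}
    (hs : s ∈ slitRegion κ ε) : s + κ ∈ slitHalfPlane κ ε := by
  have h1 := hs.1
  have h2 : (s + κ).re = s.re + κ := by rw [Complex.add_re, Complex.ofReal_re]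
  exact ⟨by rw [h2]; linarith, .inr (by rw [h2]; linarith)⟩

theorem hasDerivAt_Gamma {s : ℂ} (hs : ∀ m : ℕ, s ≠ -m) :
    HasDerivAt Complex.Gamma (Complex.digamma s * Complex.Gamma s) s := by
  rw [Complex.digamma_def, logDeriv_apply, div_mul_cancel₀ _ (Complex.Gamma_ne_zero hs)]
  exact (Complex.differentiableAt_Gamma _ hs).hasDerivAt

theorem isOpen_setOf_ne_neg_nat : IsOpen {s : ℂ | ∀ m : ℕ, s ≠ -m} := by
  have : {s : ℂ | ∀ m : ℕ, s ≠ -m} = (Set.range fun m : ℕ ↦ -(m : ℂ))ᶜ := by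
    ext s
    simp [eq_comm]
  rw [this, isOpen_compl_iff]
  have h : (Set.range fun m : ℕ ↦ -(m : ℂ)) = Neg.neg ⁻¹' (Set.range ((↑) : ℤ → ℂ)) ∩
      {s : ℂ | s.re ≤ 0} := by
    ext s
    simp only [Set.mem_range, Set.mem_inter_iff, Set.mem_preimage, Set.mem_ofPred_eq]
    constructor
    · rintro ⟨m, rfl⟩
      exact ⟨⟨m, by simp⟩, by simp⟩
    · rintro ⟨⟨m, hm⟩, hs⟩
      have hm0 : 0 ≤ m := by
        have := congrArg Complex.re hm
        simp only [Complex.intCast_re, Complex.neg_re] at this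
        have h : (0 : ℝ) ≤ m := by linarith
        exact_mod_cast h
      lift m to ℕ using hm0
      exact ⟨m, by rw [eq_comm, ← neg_eq_iff_eq_neg, ← hm]; simp⟩
  rw [h]
  exact (Complex.isClosed_range_intCast.preimage continuous_neg).inter
    (isClosed_le Complex.continuous_re continuous_const)

theorem differentiableAt_digamma {s : ℂ} (hs : ∀ m : ℕ, s ≠ -m) :
    DifferentiableAt ℂ Complex.digamma s := by
  have hd : DifferentiableOn ℂ Complex.Gamma {s : ℂ | ∀ m : ℕ, s ≠ -m} := fun z hz ↦
    (Complex.differentiableAt_Gamma z hz).differentiableWithinAt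
  have := (hd.deriv isOpen_setOf_ne_neg_nat).differentiableAt (isOpen_setOf_ne_neg_nat.mem_nhds hs)
  exact this.div (Complex.differentiableAt_Gamma s hs) (Complex.Gamma_ne_zero hs)

variable {k : ℤ} (hk : 0 < k) (f : CuspForm 𝒮ℒ k)

theorem slitDomain_add_ne {κ : ℝ} (hκ : 0 ≤ κ) {s : ℂ} (hs : s ∈ slitDomain κ) (m : ℕ) :
    s + κ ≠ -m := by
  intro h
  have h1 := congrArg Complex.re h
  have h2 := hs.1
  have : (0 : ℝ) ≤ m := m.cast_nonneg
  simp at h1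
  linarith

theorem weight_nonneg {k : ℤ} (hk : 0 < k) : 0 ≤ ((k : ℝ) - 1) / 2 := by
  have : (1 : ℝ) ≤ k := by exact_mod_cast hk
  linarith

/-- The logarithmic derivative of `reflectionFactor`. -/
def reflectionLogDeriv (s : ℂ) : ℂ :=
  -2 * Complex.log (2 * Real.pi) + Complex.digamma (s + (((k : ℝ) - 1) / 2 : ℝ)) +
    Complex.digamma (s - (((k : ℝ) - 1) / 2 : ℝ)) + logDeriv (L hk f) s

variable {f}

namespace IsNormalizedHeckeEigenform

theorem hasDerivAt_reflectionFactor (hf : IsNormalizedHeckeEigenform f) {s : ℂ}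
    (hs : s ∈ slitDomain (((k : ℝ) - 1) / 2)) :
    HasDerivAt (reflectionFactor hk f) (reflectionLogDeriv hk f s * reflectionFactor hk f s) s := by
  have hpi : (2 * (Real.pi : ℂ)) ≠ 0 := by simp [Real.pi_ne_zero]
  have h1 : HasDerivAt (fun s : ℂ ↦ (2 * (Real.pi : ℂ)) ^ (-(2 * s)))
      ((2 * (Real.pi : ℂ)) ^ (-(2 * s)) * Complex.log (2 * Real.pi) * -(2 * 1)) s :=
    (((hasDerivAt_id s).const_mul 2).neg).const_cpow (.inl hpi)
  have h2 := (hasDerivAt_Gamma (slitDomain_add_ne (weight_nonneg hk) hs)).comp_add_const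
  have h3 := (hasDerivAt_Gamma (slitDomain_sub_ne hs)).comp_sub_const
  have h4 := (differentiable_L hk f s).hasDerivAt
  have h5 : deriv (L hk f) s = logDeriv (L hk f) s * L hk f s := by
    rw [logDeriv_apply, div_mul_cancel₀ _ (hf.L_ne_zero hk hs.1)]
  rw [h5] at h4
  have h := ((h1.mul h2).mul h3).mul h4
  unfold reflectionFactor reflectionLogDeriv
  simp only [ofReal_weight]
  convert! h using 1
  simp only [Pi.mul_apply]
  ring

theorem differentiableOn_reflectionLogDeriv (hf : IsNormalizedHeckeEigenform f) :
    DifferentiableOn ℂ (reflectionLogDeriv hk f) (slitDomain (((k : ℝ) - 1) / 2)) := by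
  intro s hs
  refine DifferentiableAt.differentiableWithinAt ?_
  have h2 : DifferentiableAt ℂ
      (fun s : ℂ ↦ Complex.digamma (s + (((k : ℝ) - 1) / 2 : ℝ))) s :=
    (differentiableAt_digamma (slitDomain_add_ne (weight_nonneg hk) hs)).comp s (by fun_prop)
  have h3 : DifferentiableAt ℂ
      (fun s : ℂ ↦ Complex.digamma (s - (((k : ℝ) - 1) / 2 : ℝ))) s :=
    (differentiableAt_digamma (slitDomain_sub_ne hs)).comp s (by fun_prop)
  have h4 : DifferentiableAt ℂ (logDeriv (L hk f)) s :=
    ((differentiable_L hk f).analyticAt s).deriv.differentiableAt.div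
      (differentiable_L hk f s) (hf.L_ne_zero hk hs.1)
  exact ((h2.const_add _).add h3).add h4

/-- The digamma values change by O(1) on discs of bounded radius, and L'/L is itself bounded. All
points stay in the region with parameter ε/2. -/
theorem boundedVariation_reflectionLogDeriv (hf : IsNormalizedHeckeEigenform f) :
    BoundedVariation (((k : ℝ) - 1) / 2) (reflectionLogDeriv hk f) := by
  intro ε hε
  set κ := ((k : ℝ) - 1) / 2 with hκ
  have hκ0 : 0 ≤ κ := weight_nonneg hk
  obtain ⟨C, hC⟩ := digamma_variation_of_mem_slitHalfPlane κ (half_pos hε)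
  obtain ⟨D, hD⟩ := hf.exists_norm_logDeriv_L_le hk (half_pos hε)
  refine ⟨|C| * (1 + ε) + |C| * (1 + ε) + (|D| + |D|), by positivity, fun s hs w hw ↦ ?_⟩
  have hw' := closedBall_subset_slitRegion hs hw
  have hs' := slitRegion_mono κ (half_le_self hε.le) hs
  rw [mem_closedBall_iff_norm] at hw
  have hvar (z z' : ℂ) (hz : z ∈ slitHalfPlane κ (ε / 2)) (hz' : z' ∈ slitHalfPlane κ (ε / 2))
      (h : z - z' = w - s) : ‖Complex.digamma z - Complex.digamma z'‖ ≤ |C| * (1 + ε) := by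
    refine (hC z hz z' hz').trans ?_
    rw [h]
    gcongr
    · exact le_abs_self C
    · linarith
  have h1 := hvar _ _ (add_mem_slitHalfPlane hκ0 (half_pos hε).le hw')
    (add_mem_slitHalfPlane hκ0 (half_pos hε).le hs') (by ring)
  have h2 := hvar _ _ (sub_mem_slitHalfPlane (half_pos hε).le hw')
    (sub_mem_slitHalfPlane (half_pos hε).le hs') (by ring)
  have h3 : ‖logDeriv (L hk f) w - logDeriv (L hk f) s‖ ≤ |D| + |D| :=
    (norm_sub_le _ _).trans (add_le_add ((hD w hw'.1).trans (le_abs_self D))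
      ((hD s hs'.1).trans (le_abs_self D)))
  have h4 : reflectionLogDeriv hk f w - reflectionLogDeriv hk f s =
      (Complex.digamma (w + κ) - Complex.digamma (s + κ)) +
      (Complex.digamma (w - κ) - Complex.digamma (s - κ)) +
      (logDeriv (L hk f) w - logDeriv (L hk f) s) := by
    unfold reflectionLogDeriv
    ring
  rw [h4]
  exact (norm_add₃_le).trans (add_le_add (add_le_add h1 h2) h3)

theorem reflectionLogDeriv_re_large (hf : IsNormalizedHeckeEigenform f) {ε : ℝ}
    (hε : 0 < ε) (M : ℝ) :
    ∃ r : ℝ, ∀ s ∈ slitRegion (((k : ℝ) - 1) / 2) ε, r ≤ ‖s‖ →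
      M ≤ (reflectionLogDeriv hk f s).re := by
  set κ := ((k : ℝ) - 1) / 2 with hκ
  have hκ0 : 0 ≤ κ := weight_nonneg hk
  obtain ⟨D, hD⟩ := hf.exists_norm_logDeriv_L_le hk hε
  obtain ⟨r, hr⟩ := digamma_re_large_of_mem_slitHalfPlane κ hε
    ((M + D - (-2 * Complex.log (2 * Real.pi)).re) / 2)
  refine ⟨r + κ, fun s hs hsr ↦ ?_⟩
  have hκn : ‖(κ : ℂ)‖ = κ := by rw [Complex.norm_real, Real.norm_of_nonneg hκ0]
  have h1 := hr _ (add_mem_slitHalfPlane hκ0 hε.le hs) (by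
    have := norm_sub_le (s + κ) κ
    rw [add_sub_cancel_right, hκn] at this
    linarith)
  have h2 := hr _ (sub_mem_slitHalfPlane hε.le hs) (by
    have := norm_add_le (s - κ) κ
    rw [sub_add_cancel, hκn] at this
    linarith)
  have h3 := (Complex.abs_re_le_norm _).trans (hD s hs.1)
  have h4 := (abs_le.mp h3).1
  unfold reflectionLogDeriv
  simp only [Complex.add_re]
  linarith

/-- Q is real on the real axis, so that Q^m, and with it the real part of A, is positive far to the
right there. -/
theorem conj_reflectionLogDeriv (hf : IsNormalizedHeckeEigenform f) (x : ℝ) :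
    conj (reflectionLogDeriv hk f x) = reflectionLogDeriv hk f x := by
  have hlog (g : ℂ → ℂ) (hg : conj ∘ g ∘ conj = g) (y : ℝ) :
      conj (logDeriv g y) = logDeriv g y := by
    have h1 : conj (g y) = g y := by
      have := congrFun hg y
      simpa using this
    have h2 : conj (deriv g y) = deriv g y := by
      have := congrFun (deriv_conj_conj (f := g)) y
      rw [hg] at this
      simpa using this.symm
    rw [logDeriv_apply, map_div₀, h1, h2]
  have hGamma : conj ∘ Complex.Gamma ∘ conj = Complex.Gamma := by
    ext z
    simp [Complex.Gamma_conj]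
  have hL := hlog _ (hf.L_conj hk) x
  have h1 := hlog _ hGamma (x + ((k : ℝ) - 1) / 2)
  have h2 := hlog _ hGamma (x - ((k : ℝ) - 1) / 2)
  rw [← Complex.digamma_def, Complex.ofReal_add] at h1
  rw [← Complex.digamma_def, Complex.ofReal_sub] at h2
  have h3 : Complex.log (2 * Real.pi) = (Real.log (2 * Real.pi) : ℝ) := by
    rw [Complex.ofReal_log (by positivity)]
    push_cast
    rfl
  rw [reflectionLogDeriv, map_add, map_add, map_add, h1, h2, hL, map_mul, h3, Complex.conj_ofReal,
    map_neg, map_ofNat]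

/-- `reflectionFactor` is positive far to the right on the real axis. -/
theorem eventually_reflectionFactor_pos (hf : IsNormalizedHeckeEigenform f) :
    ∀ᶠ x : ℝ in atTop, ∃ g : ℝ, 0 < g ∧ reflectionFactor hk f x = g := by
  have hlim := LSeries.tendsto_atTop (f := normCoeff f)
    ((abscissa_normCoeff_le f hk).trans_lt (EReal.coe_lt_top 1))
  rw [hf.normCoeff_one] at hlim
  have hre := (Complex.continuous_re.tendsto 1).comp hlim
  filter_upwards [hre.eventually (eventually_gt_nhds (show (0 : ℝ) < (1 : ℂ).re by simp)),
    eventually_gt_atTop 1, eventually_gt_atTop (((k : ℝ) - 1) / 2)] with x h1 h2 h3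
  have h4 := weight_nonneg hk
  rw [comp_apply, ← L_eq_LSeries f hk (by simpa using h2)] at h1
  have hLr : L hk f x = ((L hk f x).re : ℂ) := by
    have := congrFun (hf.L_conj hk) x
    rw [comp_apply, comp_apply, Complex.conj_ofReal] at this
    exact (Complex.conj_eq_iff_re.mp this).symm
  refine ⟨(2 * Real.pi) ^ (-(2 * x)) * Real.Gamma (x + ((k : ℝ) - 1) / 2) *
    Real.Gamma (x - ((k : ℝ) - 1) / 2) * (L hk f x).re, ?_, ?_⟩
  · have := Real.Gamma_pos_of_pos (s := x + ((k : ℝ) - 1) / 2) (by linarith)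
    have := Real.Gamma_pos_of_pos (s := x - ((k : ℝ) - 1) / 2) (by linarith)
    positivity
  · rw [reflectionFactor, hLr, ofReal_weight]
    simp only [Complex.ofReal_mul, ← Complex.Gamma_ofReal, Complex.ofReal_add, Complex.ofReal_sub,
      Complex.ofReal_re]
    rw [Complex.ofReal_cpow (by positivity)]
    push_cast
    rfl

end IsNormalizedHeckeEigenform

end EigenformL
end

/-! ### Zeros of the derivatives of L in the left half plane. -/

noncomputable section
namespace EigenformL

open Filter Topology Function
open scoped ComplexConjugate

variable {k : ℤ} {f : CuspForm 𝒮ℒ k}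

namespace IsNormalizedHeckeEigenform

theorem reflectionFactor_ne_zero (hk : 0 < k) (hf : IsNormalizedHeckeEigenform f) {s : ℂ}
    (hs : s ∈ slitDomain (((k : ℝ) - 1) / 2)) : reflectionFactor hk f s ≠ 0 := by
  have hpi : (2 * (Real.pi : ℂ)) ≠ 0 := by simp [Real.pi_ne_zero]
  rw [reflectionFactor, ofReal_weight]
  exact mul_ne_zero (mul_ne_zero (mul_ne_zero (Complex.cpow_ne_zero_iff.mpr (.inl hpi))
    (Complex.Gamma_ne_zero (slitDomain_add_ne (weight_nonneg hk) hs)))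
    (Complex.Gamma_ne_zero (slitDomain_sub_ne hs))) (hf.L_ne_zero hk hs.1)

/-- The shape of the derivatives of `L` to the left of the critical strip. -/
theorem exists_iteratedDeriv_L_eq (hk : 0 < k) (hf : IsNormalizedHeckeEigenform f) (m : ℕ) :
    ∃ A B : ℂ → ℂ, DifferentiableOn ℂ A (slitDomain (((k : ℝ) - 1) / 2)) ∧
      DifferentiableOn ℂ B (slitDomain (((k : ℝ) - 1) / 2)) ∧
      (∀ ε > 0, ∀ η > 0, ∃ r : ℝ, ∀ s ∈ slitRegion (((k : ℝ) - 1) / 2) ε, r ≤ ‖s‖ →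
        0 < ‖A s‖ ∧ ‖B s‖ ≤ η * ‖A s‖) ∧
      (∀ᶠ x : ℝ in atTop, 0 < (A x).re) ∧
      ∀ s ∈ slitDomain (((k : ℝ) - 1) / 2), iteratedDeriv m (L hk f) (1 - s) =
        (-1) ^ m * (2 * reflectionFactor hk f s) *
          (Complex.cos (Real.pi * s) * A s + Complex.sin (Real.pi * s) * B s) := by
  set κ := ((k : ℝ) - 1) / 2 with hκ
  set Q := reflectionLogDeriv hk f with hQ
  have hlarge : ∀ ε > 0, ∀ M : ℝ, ∃ r : ℝ, ∀ s ∈ slitRegion κ ε, r ≤ ‖s‖ → M ≤ (Q s).re :=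
    fun ε hε M ↦ hf.reflectionLogDeriv_re_large hk hε M
  obtain ⟨A, B, hA, hB, hAQ, hBQ, hF⟩ := exists_iteratedDeriv_eq
    (κ := κ) (F := fun s ↦ L hk f (1 - s)) (G := fun s ↦ 2 * reflectionFactor hk f s) (Q := Q)
    (fun s hs ↦ by rw [L_one_sub hk (even_of_ne_zero f hf.ne_zero) f hs]; ring)
    (fun s hs ↦ by
      convert! (hf.hasDerivAt_reflectionFactor hk hs).const_mul 2 using 1
      ring)
    (hf.differentiableOn_reflectionLogDeriv hk) (hf.boundedVariation_reflectionLogDeriv hk) m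
  refine ⟨A, B, hA, hB, fun ε hε η hη ↦ ?_, ?_, fun s hs ↦ ?_⟩
  -- The constant 1/2 gives ‖A‖ ≥ ‖Q‖^m / 2, so B need only be at most (η/2)‖Q‖^m.
  · obtain ⟨r₁, h₁⟩ := hAQ.eventually_le hlarge hε (η := 1 / 2) (by norm_num)
    obtain ⟨r₂, h₂⟩ := hBQ.eventually_le hlarge hε (half_pos hη)
    obtain ⟨r₃, h₃⟩ := hlarge ε hε 1
    refine ⟨max r₁ (max r₂ r₃), fun s hs hsr ↦ ?_⟩
    have hA1 := h₁ s hs ((le_max_left _ _).trans hsr)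
    have hB1 := h₂ s hs (((le_max_left _ _).trans (le_max_right _ _)).trans hsr)
    have hQ1 := (h₃ s hs (((le_max_right _ _).trans (le_max_right _ _)).trans hsr)).trans
      (Complex.re_le_norm _)
    have hQm : 0 < ‖Q s‖ ^ m := by positivity
    have h4 := norm_sub_norm_le ((Q ^ m) s) (A s)
    rw [norm_sub_rev, Pi.pow_apply, norm_pow] at h4
    rw [Pi.sub_apply, Pi.pow_apply] at hA1
    have h5 : ‖Q s‖ ^ m ≤ 2 * ‖A s‖ := by linarith
    exact ⟨by linarith, by nlinarith⟩
  · obtain ⟨r₁, h₁⟩ := hAQ.eventually_le hlarge one_pos (η := 1 / 2) (by norm_num)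
    obtain ⟨r₂, h₂⟩ := hlarge 1 one_pos 1
    have hκ0 : 0 ≤ κ := weight_nonneg hk
    filter_upwards [eventually_ge_atTop r₁, eventually_ge_atTop r₂, eventually_ge_atTop (κ + 2)]
      with x hx1 hx2 hx3
    have hmem : (x : ℂ) ∈ slitRegion κ 1 := by
      constructor
      · rw [Complex.ofReal_re]; linarith
      · right; rw [Complex.ofReal_re]; linarith
    have hnorm : ‖(x : ℂ)‖ = x := by
      rw [Complex.norm_real, Real.norm_of_nonneg (by linarith)]
    have hA1 := h₁ x hmem (by rwa [hnorm])
    have hQ1 := h₂ x hmem (by rwa [hnorm])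
    have hQr : Q x = ((Q x).re : ℂ) :=
      (Complex.conj_eq_iff_re.mp (hf.conj_reflectionLogDeriv hk x)).symm
    rw [Pi.sub_apply, Pi.pow_apply] at hA1
    generalize (Q x).re = q at hQr hQ1
    rw [hQr, ← Complex.ofReal_pow, Complex.norm_real, Real.norm_of_nonneg (by linarith)] at hA1
    have h2 := (abs_le.mp ((Complex.abs_re_le_norm _).trans hA1)).1
    rw [Complex.sub_re, Complex.ofReal_re] at h2
    have : 0 < q ^ m := by positivity
    linarith
  · have h1 := hF s hs
    simp only [iteratedDeriv_comp_const_sub, smul_eq_mul] at h1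
    rw [mul_assoc, ← h1, ← mul_assoc, ← mul_pow]
    simp

/-- The derivatives of `L` have no zeros far away in the left half plane, off the real axis. -/
theorem exists_iteratedDeriv_L_ne_zero_of_im (hk : 0 < k) (hf : IsNormalizedHeckeEigenform f)
    (m : ℕ) {ε : ℝ} (hε : 0 < ε) :
    ∃ δ : ℝ, ((k : ℝ) - 1) / 2 + 1 < δ ∧ ∀ s : ℂ, δ ≤ ‖s‖ → s.re ≤ -ε → ε ≤ |s.im| →
      iteratedDeriv m (L hk f) s ≠ 0 := by
  obtain ⟨A, B, -, -, hAB, -, hL⟩ := hf.exists_iteratedDeriv_L_eq hk m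
  obtain ⟨T, hT, htan⟩ := exists_norm_sin_pi_le hε
  obtain ⟨r, hr⟩ := hAB ε hε (1 / (2 * T)) (by positivity)
  -- The estimates hold at 1 - s, whose norm is at least ‖s‖ - 1.
  refine ⟨max (r + 1) (((k : ℝ) - 1) / 2 + 2), lt_of_lt_of_le (by linarith) (le_max_right _ _),
    fun s hs hre him ↦ ?_⟩
  have hmem : 1 - s ∈ slitRegion (((k : ℝ) - 1) / 2) ε := by
    refine ⟨?_, .inl ?_⟩
    · rw [Complex.sub_re, Complex.one_re]; linarith
    · simpa using him
  have hmem' := slitRegion_subset _ hε hmem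
  have hnorm : r ≤ ‖1 - s‖ := by
    have h1 := norm_sub_norm_le s 1
    rw [norm_sub_rev, norm_one] at h1
    linarith [le_max_left (r + 1) (((k : ℝ) - 1) / 2 + 2)]
  obtain ⟨hA, hB⟩ := hr _ hmem hnorm
  obtain ⟨hsin, hcos⟩ := htan (1 - s) (by simpa using him)
  have h := hL _ hmem'
  rw [sub_sub_cancel] at h
  rw [h]
  refine mul_ne_zero (mul_ne_zero (pow_ne_zero _ (by norm_num))
    (mul_ne_zero two_ne_zero (hf.reflectionFactor_ne_zero hk hmem'))) fun h0 ↦ ?_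
  -- At a zero the cosine and sine terms cancel, yet the sine term is at most half the cosine term
  -- in norm.
  have h1 : ‖Complex.cos (Real.pi * (1 - s)) * A (1 - s)‖ ≤
      (T * ‖Complex.cos (Real.pi * (1 - s))‖) * (1 / (2 * T) * ‖A (1 - s)‖) := by
    rw [eq_neg_of_add_eq_zero_left h0, norm_neg, norm_mul]
    gcongr
  rw [norm_mul] at h1
  have h2 : (T * ‖Complex.cos (Real.pi * (1 - s))‖) * (1 / (2 * T) * ‖A (1 - s)‖) =
      ‖Complex.cos (Real.pi * (1 - s))‖ * ‖A (1 - s)‖ / 2 := by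
    field_simp
  have h3 : 0 < ‖Complex.cos (Real.pi * (1 - s))‖ * ‖A (1 - s)‖ :=
    mul_pos (norm_pos_iff.mpr hcos) hA
  linarith

/-- In each unit strip far to the left, bounded by integers, the derivatives of `L` have at most
one zero. -/
theorem exists_unique_zero_in_strip (hk : 0 < k) (hf : IsNormalizedHeckeEigenform f) (m : ℕ) :
    ∃ X : ℝ, ∀ s t : ℂ, ∀ N : ℤ, X < s.re → X < t.re → N ≤ s.re → s.re ≤ N + 1 → N ≤ t.re →
      t.re ≤ N + 1 → iteratedDeriv m (L hk f) (1 - s) = 0 →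
      iteratedDeriv m (L hk f) (1 - t) = 0 → s = t := by
  obtain ⟨A, B, hA, hB, hAB, -, hL⟩ := hf.exists_iteratedDeriv_L_eq hk m
  obtain ⟨r, hr⟩ := hAB 1 one_pos (1 / 8) (by norm_num)
  have hκ := weight_nonneg hk
  set X := max r (((k : ℝ) - 1) / 2 + 2) with hX
  have hXr : r ≤ X := le_max_left _ _
  have hXκ : ((k : ℝ) - 1) / 2 + 2 ≤ X := le_max_right _ _
  have hmem {s : ℂ} (hs : X < s.re) : s ∈ slitRegion (((k : ℝ) - 1) / 2) 1 :=
    ⟨by linarith, .inr (by linarith)⟩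
  have hmem' {s : ℂ} (hs : X < s.re) := slitRegion_subset _ one_pos (hmem hs)
  have hAB' {s : ℂ} (hs : X < s.re) := hr s (hmem hs) (by linarith [Complex.re_le_norm s])
  have hsmall {s : ℂ} (hs : X < s.re) : ‖B s / A s‖ ≤ 1 / 8 := by
    rw [norm_div, div_le_iff₀ (hAB' hs).1]
    exact (hAB' hs).2
  have hdiff : DifferentiableOn ℂ (fun s ↦ B s / A s) {s | X < s.re} :=
    (hB.mono fun s hs ↦ hmem' hs).div (hA.mono fun s hs ↦ hmem' hs)
      fun s hs ↦ norm_pos_iff.mp (hAB' hs).1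
  have hzero {s : ℂ} (hs : X < s.re) (h : iteratedDeriv m (L hk f) (1 - s) = 0) :
      Complex.cos (Real.pi * s) + Complex.sin (Real.pi * s) * (B s / A s) = 0 := by
    have hA0 := norm_pos_iff.mp (hAB' hs).1
    rw [hL s (hmem' hs)] at h
    have h1 := (mul_eq_zero.mp h).resolve_left (mul_ne_zero (pow_ne_zero _ (by norm_num))
      (mul_ne_zero two_ne_zero (hf.reflectionFactor_ne_zero hk (hmem' hs))))
    field_simp
    linear_combination h1
  -- The extra 1 leaves room for the unit discs in the Lipschitz bound for B/A.
  refine ⟨X + 1, fun s t N hs ht hs1 hs2 ht1 ht2 hs0 ht0 ↦ ?_⟩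
  have hs' : X < s.re := by linarith
  have ht' : X < t.re := by linarith
  refine eq_of_zero_of_mem_strip hs1 hs2 ht1 ht2 (hsmall hs') (hsmall ht') ?_ (hzero hs' hs0)
    (hzero ht' ht0)
  rw [norm_sub_rev s t]
  exact norm_sub_le_of_norm_le hdiff (fun s hs ↦ hsmall hs) hs ht

/-- Far to the left, the derivatives of `L` alternate in sign at consecutive integers. -/
theorem exists_sign_iteratedDeriv_L (hk : 0 < k) (hf : IsNormalizedHeckeEigenform f) (m : ℕ) :
    ∃ X : ℝ, ∀ N : ℤ, X ≤ N →
      0 < (-1) ^ m * (-1) ^ N * (iteratedDeriv m (L hk f) (1 - N)).re := by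
  obtain ⟨A, B, -, -, -, hA, hL⟩ := hf.exists_iteratedDeriv_L_eq hk m
  obtain ⟨X, hX⟩ := (hA.and (hf.eventually_reflectionFactor_pos hk)).exists_forall_of_atTop
  refine ⟨max X (((k : ℝ) - 1) / 2 + 2), fun N hN ↦ ?_⟩
  have hκ := weight_nonneg hk
  obtain ⟨hA0, g, hg, hG⟩ := hX N ((le_max_left _ _).trans hN)
  have hN' := (le_max_right _ _).trans hN
  have hmem : ((N : ℝ) : ℂ) ∈ slitDomain (((k : ℝ) - 1) / 2) := by
    constructor
    · rw [Complex.ofReal_re]; linarith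
    · right; rw [Complex.ofReal_re]; linarith
  have hcos : Complex.cos (Real.pi * (N : ℝ)) = (((-1) ^ N : ℝ) : ℂ) := by
    rw [← Complex.ofReal_mul, ← Complex.ofReal_cos, mul_comm, Real.cos_int_mul_pi]
  -- At integers the sine term drops out, and the sign is read off from (-1)^N, A and the positive
  -- reflection factor.
  have hsin : Complex.sin (Real.pi * (N : ℝ)) = 0 := by
    rw [Complex.ofReal_intCast, mul_comm, Complex.sin_int_mul_pi]
  have h := hL _ hmem
  rw [hcos, hsin, hG, zero_mul, add_zero, Complex.ofReal_intCast] at h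
  rw [h]
  have h1 : (-1 : ℂ) ^ m * (2 * (g : ℂ)) * ((((-1) ^ N : ℝ) : ℂ) * A N) =
      (((-1) ^ m * (-1) ^ N * (2 * g) : ℝ) : ℂ) * A N := by
    push_cast
    ring
  rw [h1, Complex.re_ofReal_mul]
  rw [Complex.ofReal_intCast] at hA0
  have h2 : ((-1 : ℝ) ^ m * (-1) ^ N) * ((-1) ^ m * (-1) ^ N) = 1 := by
    rw [mul_mul_mul_comm, ← mul_pow, ← mul_zpow]
    simp
  calc (0 : ℝ) < 2 * g * (A N).re := by positivity
    _ = ((-1 : ℝ) ^ m * (-1) ^ N) * ((-1) ^ m * (-1) ^ N) * (2 * g * (A N).re) := by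
      rw [h2, one_mul]
    _ = _ := by ring

/-- Far to the left, all zeros of the derivatives of `L` are real, and there is exactly one between
any two consecutive integers. -/
theorem exists_real_zeros_iteratedDeriv_L (hk : 0 < k) (hf : IsNormalizedHeckeEigenform f)
    (m : ℕ) : ∃ α : ℝ, α < -(((k : ℝ) - 1) / 2) - 1 ∧
      (∀ s : ℂ, s.re ≤ α → iteratedDeriv m (L hk f) s = 0 → s.im = 0) ∧
      (∀ n : ℤ, (n : ℝ) ≤ α → ∃! x : ℝ, x ∈ Set.Ioo ((n : ℝ) - 1) (n : ℝ) ∧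
        iteratedDeriv m (L hk f) (x : ℂ) = 0) := by
  obtain ⟨X, hX⟩ := hf.exists_unique_zero_in_strip hk m
  obtain ⟨Y, hY⟩ := hf.exists_sign_iteratedDeriv_L hk m
  have hconj (s : ℂ) : iteratedDeriv m (L hk f) (conj s) = conj (iteratedDeriv m (L hk f) s) := by
    have := congrFun (hf.iteratedDeriv_L_conj hk m) (conj s)
    rw [← this]
    simp
  set Z := max X (max Y (((k : ℝ) - 1) / 2 + 2)) with hZ
  have hZX : X ≤ Z := le_max_left _ _
  have hZY : Y ≤ Z := (le_max_left _ _).trans (le_max_right _ _)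
  have hZκ : ((k : ℝ) - 1) / 2 + 2 ≤ Z := (le_max_right _ _).trans (le_max_right _ _)
  refine ⟨-Z, by linarith, fun s hs h0 ↦ ?_, fun n hn ↦ ?_⟩
  · have h1 : (1 - s).re = 1 - s.re := by rw [Complex.sub_re, Complex.one_re]
    have h2 : (1 - conj s).re = 1 - s.re := by
      rw [Complex.sub_re, Complex.one_re, Complex.conj_re]
    -- A zero and its conjugate have the same real part, hence lie in the same strip and must
    -- coincide.
    have h3 := hX (1 - s) (1 - conj s) ⌊(1 - s).re⌋ (by linarith) (by linarith)
      (Int.floor_le _) (Int.lt_floor_add_one _).le (by rw [h2, ← h1]; exact Int.floor_le _)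
      (by rw [h2, ← h1]; exact (Int.lt_floor_add_one _).le) (by rwa [sub_sub_cancel])
      (by rw [sub_sub_cancel, hconj, h0, map_zero])
    rw [sub_right_inj] at h3
    exact Complex.conj_eq_iff_im.mp h3.symm
  · refine existsUnique_of_exists_of_unique ?_ fun x y hx hy ↦ ?_
    -- Under x ↦ 1 - x the interval (n - 1, n) becomes (N, N + 1) with N = 1 - n; the signs at its
    -- two ends are opposite.
    · have h1 := hY (1 - n) (by push_cast; linarith)
      have h2 := hY (1 - n + 1) (by push_cast; linarith)
      have e1 : (1 : ℂ) - ((1 - n : ℤ) : ℂ) = ((n : ℝ) : ℂ) := by push_cast; ring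
      have e2 : (1 : ℂ) - ((1 - n + 1 : ℤ) : ℂ) = (((n : ℝ) - 1 : ℝ) : ℂ) := by push_cast; ring
      rw [e1] at h1
      rw [e2, zpow_add_one₀ (by norm_num)] at h2
      have hcont : Continuous fun x : ℝ ↦ (-1 : ℝ) ^ m * (-1) ^ (1 - n) *
          (iteratedDeriv m (L hk f) (x : ℂ)).re := by
        have : Continuous (iteratedDeriv m (L hk f)) :=
          ((differentiable_L hk f).contDiff (n := m)).continuous_iteratedDeriv m le_rfl
        fun_prop
      obtain ⟨x, hx, hx0⟩ := intermediate_value_Ioo (show (n : ℝ) - 1 ≤ n by linarith)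
        hcont.continuousOn
        (Set.mem_Ioo.mpr ⟨by linarith, h1⟩)
      refine ⟨x, hx, ?_⟩
      have h3 : (iteratedDeriv m (L hk f) (x : ℂ)).re = 0 :=
        (mul_eq_zero.mp hx0).resolve_left
          (mul_ne_zero (pow_ne_zero _ (by norm_num)) (zpow_ne_zero _ (by norm_num)))
      have h4 := hconj x
      rw [Complex.conj_ofReal] at h4
      rw [← Complex.conj_eq_iff_re.mp h4.symm, h3, Complex.ofReal_zero]
    · have hre (x : ℝ) : (1 - (x : ℂ)).re = 1 - x := by simp
      have h := hX (1 - x) (1 - y) (1 - n) (by rw [hre]; linarith [hx.1.2])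
        (by rw [hre]; linarith [hy.1.2]) (by rw [hre]; push_cast; linarith [hx.1.2])
        (by rw [hre]; push_cast; linarith [hx.1.1]) (by rw [hre]; push_cast; linarith [hy.1.2])
        (by rw [hre]; push_cast; linarith [hy.1.1]) (by rw [sub_sub_cancel]; exact hx.2)
        (by rw [sub_sub_cancel]; exact hy.2)
      rw [sub_right_inj] at h
      exact_mod_cast h

end IsNormalizedHeckeEigenform

end EigenformL
end

theorem theorem1p1 {k : ℤ} (hk : 0 < k) (f : CuspForm 𝒮ℒ k)
    (hf : EigenformL.IsNormalizedHeckeEigenform f) (m : ℕ) :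
    (∃ σ : ℝ, 1 < σ ∧
      ∀ s : ℂ, σ ≤ s.re → iteratedDeriv m (EigenformL.L hk f) s ≠ 0) ∧
    (∀ ε : ℝ, 0 < ε → ∃ δ : ℝ, ((k : ℝ) - 1) / 2 + 1 < δ ∧
      ∀ s : ℂ, δ ≤ ‖s‖ → s.re ≤ -ε → ε ≤ |s.im| →
        iteratedDeriv m (EigenformL.L hk f) s ≠ 0) ∧
    (∃ α : ℝ, α < -(((k : ℝ) - 1) / 2) - 1 ∧
      (∀ s : ℂ, s.re ≤ α → iteratedDeriv m (EigenformL.L hk f) s = 0 → s.im = 0) ∧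
      (∀ n : ℤ, (n : ℝ) ≤ α →
        ∃! x : ℝ, x ∈ Set.Ioo ((n : ℝ) - 1) (n : ℝ) ∧
          iteratedDeriv m (EigenformL.L hk f) (x : ℂ) = 0)) :=
  ⟨hf.exists_iteratedDeriv_L_ne_zero hk m,
    fun _ hε ↦ hf.exists_iteratedDeriv_L_ne_zero_of_im hk m hε,
    hf.exists_real_zeros_iteratedDeriv_L hk m⟩
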